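/- **Theorem (Carnot 2 satisfies Consistency and Liveness).** Let $n\ge 2$, $n\ge 3f+1$, let $x\ge 2$, and consider any execution of the protocol Carnot 2 described below, in the model described below, with at most $f$ faulty processors among $p_1,\dots,p_n$. Let $\mathcal F$ be the extraction function defined below, $M^*$ the set of messages received by at least one processor, and $M_c(t)$ the set of messages received by correct processors at timeslots $\le t$. Then: 1. (Consistency) $\mathcal F(M_1)\preceq\mathcal F(M_2)$ (prefix) for all $M_1\subseteq M_2\subseteq M^*$. 2. (Liveness) If a correct processor receives the transaction $\mathrm{tr}$, then $\mathrm{tr}\in\mathcal F(M_c(t))$ for some $t$. 3. (Agreement on blocks) If $p_i,p_j$ are correct and $b$ is in the variable $\mathtt{blocks}$ of $p_i$ at the end of timeslot $t$, then $b$ is in $\mathtt{blocks}$ of $p_j$ at the end of timeslot $\max\{t,\mathrm{GST}\}+2\delta+s$. 4. (Progression) Every correct processor enters every view $v\ge 1$. 5. (Finalisation by correct leaders) If $v\geq 1$ is initial, $\mathtt{lead}(v)$ is correct, and no correct processor enters view $v$ before GST, then some view $v$ block $b$ has a stage-2 certificate received by all correct processors, and no correct processor sends a nullify$(v)$ message.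 **Model.** Time is discrete, $t=0,1,2,\dots$. Faulty processors are arbitrary. Channels are point-to-point and authenticated; for a known $\Delta$, an unknown GST and an unknown $1\le\delta\le\Delta$, a message sent by a correct processor to another one at time $t$ arrives at some $t'$ with $t<t'\le\max\{t,\mathrm{GST}\}+\delta$; a message to oneself arrives immediately. Finitely many messages arrive per processor and timeslot. Correct processors begin, possibly at different times, by time GST. The environment may give finitely many transactions to each processor at each timeslot. Cryptography is perfect: the hash function $H$ is injective, signatures (on blocks, transactions, and signature shares) are unforgeable, and a $k$-of-$n$ threshold certificate requires shares of $k$ processors. For each $1\le k\le n$ an $(n,k)$-erasure code is given: a bit string $C$ is encoded as $n$ fragments whose length depends on $n,k,|C|$ only, and any $k$ of them with $|C|$ determine $C$. The tag $\tau(C,k)=(|C|,k,r)$ contains the root $r$ of the Merkle tree over the fragments of $C$; a certified fragment of a tag $(\beta,k,r)$ at $i$ is a string of the right length with a validation path from $r$ at position $i$. Decoding $k$ certified fragments of a tag $z$ yields $C$ only if $\tau(C,k)=z$. **Blocks and messages.** Views $1,2,\dots$ are grouped into superviews of $x$ consecutive views; the first view of a superview is called initial; $\mathtt{lead}(v)=p_{j+1}$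 with $j\equiv w \bmod n$ for $v$ in superview $w$. The genesis block $b_{\rm gen}$ has view $0$ and empty payload. Any other block is a tuple $b=(v,(\beta,k,r),(\beta,n-f-1,r'),h)$ signed by $\mathtt{lead}(v)$, with $v\ge1$, $k\in[n-f-1,n-1]$; its parent is the block with hash $h$. A certified fragment of $b$ is one of its first tag. A certified recovery fragment of $b$ is one of its second tag (for $k=n-f-1$ it is, by definition, a certified fragment of $b$). Processors send stage-1 votes and stage-2 votes for blocks, and nullify$(v)$ messages. Stage-1 certificates, stage-2 certificates and N-certificates need $n-f$ shares (of stage-1 votes, stage-2 votes, nullify messages respectively), and stage-2 M-certificates need $f+1$ stage-2 votes. A set of messages contains a certificate if it contains the certificate itself or sufficiently many of the individual messages from which it is formed. $\mathtt{blocks}$ of a processor contains $b_{\rm gen}$ and every block $b$ whose parent is in $\mathtt{blocks}$ such that the processor (a) has an M-certificate for $b$, or (b) has a stage-1 certificate for $b$ and has received certified fragments ($k$ of them) or certified recovery fragments ($n-f-1$ of them) of $b$ from which it decodes a payload $C$ with $\tau(C,k)$ and $\tau(C,n-f-1)$ equal to the two tags of $b$. $\mathtt{blocks}^\dagger$ and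 $\mathtt{blocks}^\diamond$ consist of $b_{\rm gen}$ and the blocks in $\mathtt{blocks}$ satisfying (a), respectively (b). A fragment of a view $v$ block $b$ is votable if it is certified, the parent $b'$ of $b$ is in $\mathtt{blocks}$, $b'.\mathrm{view}<v$, and the processor has N-certificates for all views strictly between $b'.\mathrm{view}$ and $v$. **Protocol.** Each correct $p_i$ has a present view $\mathtt v$ (initially $1$), a timer $\mathtt T$ (initially $0$, reset on entering a view), and a block $\mathtt b$ (initially $b_{\rm gen}$). At every timeslot it executes the following list in this order, repeatedly until nothing changes any more. 1. Disseminate (send to all) new N-certificates, stage-1 certificates and M-certificates. 2. If $p_i=\mathtt{lead}(\mathtt v)$: if $\mathtt v$ is initial and $p_i$ has not proposed in this superview, propose a block for view $\mathtt v$ with parent $\mathtt b$; otherwise, if $p_i$ has already proposed in this superview but not for all its views, it may (at the implementation's discretion) propose a block for the next view of the superview, whose parent is its last proposal. Proposing means: let the payload $C$ consist of all transactions received but not known to be included in ancestors of the parent, choose $k\in[n-f-1,n-1]$ as a function $g$ of the received messages and the view, with $k=n-f-1$ for initial views, form the block with tags $\tau(C,k),\tau(C,n-f-1)$, and send each $p_j$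 its certified fragment. 3. If $p_i$ has received a votable fragment at $i$ of a view $\mathtt v$ block $b$ and has not yet sent a stage-1 vote in view $\mathtt v$, disseminate a stage-1 vote for $b$ and, unless $p_i=\mathtt{lead}(\mathtt v)$, this fragment. 4. If $\mathtt{blocks}$ contains a view $\mathtt v$ block $b$: set $\mathtt b:=b$, disseminate a stage-2 vote for $b$ unless nullify$(\mathtt v)$ was sent, and enter view $\mathtt v+1$. 5. If nullify$(\mathtt v)$ was not sent, no stage-2 vote was sent in view $\mathtt v$, and either ($\mathtt v$ not initial and: $\mathtt T=\Delta$ and no stage-1 vote was sent in view $\mathtt v$, or $\mathtt T=3\Delta$) or ($\mathtt v$ initial and: $\mathtt T=4\Delta+2s$ and no stage-1 vote was sent in view $\mathtt v$, or $\mathtt T=5\Delta+2s$), then disseminate nullify$(u)$ for all $u\ge\mathtt v$ in the same superview. 6. If $p_i$ has an N-certificate for $\mathtt v$, enter view $\mathtt v+1$. 7. For each new $b\in\mathtt{blocks}^\diamond$ start a timer which expires in time $s$ (a fixed parameter). For each $b$ whose timer expires now with $b\notin\mathtt{blocks}^\dagger$, and each $j$ such that $p_i$ has neither sent to nor received from $p_j$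 the certified recovery fragment of $b$ at $j$, send it to $p_j$. 8. For each block $b$ with $p_i\ne\mathtt{lead}(b.\mathrm{view})$ for which $p_i$ has a stage-1 certificate, disseminate each received certified fragment or certified recovery fragment of $b$ at $i$ (if not done before). **Extraction.** For a set $M$ of messages consider the finite or infinite sequences $b_1,b_2,\dots$ of blocks, with $b_1$ a child of $b_{\rm gen}$ and each $b_i$ the parent of $b_{i+1}$, such that for each $i$: $M$ contains a stage-2 certificate for some $b_j$ of the sequence with $j\ge i$, and $M$ contains certified fragments or certified recovery fragments of $b_i$ from which its payload is decoded and verified as in (b). If there is a unique longest such sequence, $\mathcal F(M)$ is the (finite or infinite) concatenation of the payloads of its blocks; otherwise it is empty. -/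

import Mathlib

namespace Carnot

/-! ### Data types: tags, blocks, messages -/

/-- A tag `(β, k, r)`: payload length, reconstruction parameter, Merkle root. -/
structure Tag (D : Type*) where
  len : ℕ
  k : ℕ
  root : D

/-- A block `(v, τ(C,k), τ(C,n-f-1), h)`. Only the genesis block has no parent hash. -/
structure Block (D : Type*) where
  view : ℕ
  tag : Tag D
  recTag : Tag D
  par : Option D

/-- The objects that get hashed: leaf data of a Merkle tree, pairs of children of an inner node of a
Merkle tree, and blocks. -/
inductive HashInput (D : Type*) where
  | data (c : List Bool)
  | node (l r : D)
  | block (b : Block D)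

/-- The messages. Signatures and signature shares are represented by the index of the signer; that
they cannot be forged is part of the definition of an execution. -/
inductive Msg (n : ℕ) (D Tx : Type*) where
  | tx (tr : Tx)
  | frag (b : Block D) (j : Fin n) (c : List Bool) (path : List D)
  | recFrag (b : Block D) (j : Fin n) (c : List Bool) (path : List D)
  | vote1 (b : Block D) (i : Fin n)
  | vote2 (b : Block D) (i : Fin n)
  | nullify (v : ℕ) (i : Fin n)
  | cert1 (b : Block D)
  | certM (b : Block D)
  | cert2 (b : Block D)
  | certN (v : ℕ)

/-- The block that a message mentions, if any. -/
def Msg.block? {n : ℕ} {D Tx : Type*} : Msg n D Tx → Option (Block D)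
  | .tx _ => none
  | .frag b _ _ _ => some b
  | .recFrag b _ _ _ => some b
  | .vote1 b _ => some b
  | .vote2 b _ => some b
  | .nullify _ _ => none
  | .cert1 b => some b
  | .certM b => some b
  | .cert2 b => some b
  | .certN _ => none

/-- A received message, with its sender (`none` is the environment). -/
abbrev Received (n : ℕ) (D Tx : Type*) := Option (Fin n) × Msg n D Tx

/-- A family of `(n,k)`-erasure codes, `1 ≤ k ≤ n`: bit strings `C` are encoded as `n` fragments
whose length depends on `k` and `C.length` only, and any `k` fragments together with `C.length`
determine `C`. `decode k β c` gets the available fragments only. -/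
structure ErasureCode (n : ℕ) where
  fragLen : ℕ → ℕ → ℕ
  encode : ℕ → List Bool → Fin n → List Bool
  decode : ℕ → ℕ → (Fin n → Option (List Bool)) → Option (List Bool)
  length_encode : ∀ k C j, 1 ≤ k → k ≤ n → (encode k C j).length = fragLen k C.length
  decode_encode : ∀ k C (I : Finset (Fin n)), 1 ≤ k → k ≤ n → I.card = k →
    decode k C.length (fun j => if j ∈ I then some (encode k C j) else none) = some C

/-- The local variables of a processor. -/
structure LState (n : ℕ) (D Tx : Type*) where
  /-- all received messages, with senders -/
  S : Set (Received n D Tx)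
  /-- all messages sent, with recipients -/
  sent : Set (Fin n × Msg n D Tx)
  /-- the present view -/
  view : ℕ
  /-- the variable `b`, used by leaders to choose a parent -/
  parent : Block D
  /-- the timeslot at which the timer `T` was last reset -/
  entered : ℕ
  nullified : Set ℕ
  voted1 : Set ℕ
  voted2 : Set ℕ
  /-- own proposals, with their payloads -/
  proposed : Set (Block D × List Bool)
  /-- expiry times of the timers `T(b)` that have been triggered -/
  timer : Block D → Option ℕ

/-- The messages received so far. -/
def LState.msgs {n : ℕ} {D Tx : Type*} (σ : LState n D Tx) : Set (Msg n D Tx) :=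
  {m | ∃ q, (q, m) ∈ σ.S}

/-- Processor `i` sends the messages in `X` (recipient, message). Messages to oneself are received
immediately. Since `sent` and `S` are sets, sending a message again to the same recipient has no
effect. -/
def LState.send {n : ℕ} {D Tx : Type*} (i : Fin n) (X : Set (Fin n × Msg n D Tx))
    (σ : LState n D Tx) : LState n D Tx :=
  { σ with
    sent := σ.sent ∪ X
    S := σ.S ∪ {p | p.1 = some i ∧ (i, p.2) ∈ X} }

/-- Processor `i` sends all the messages in `Y` to all processors. -/
def LState.disseminate {n : ℕ} {D Tx : Type*} (i : Fin n) (Y : Set (Msg n D Tx))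
    (σ : LState n D Tx) : LState n D Tx :=
  σ.send i {p | p.2 ∈ Y}

/-- Everything that an instance of Carnot 2 is built from. -/
structure Protocol (n : ℕ) (D Tx : Type*) where
  /-- the resilience parameter -/
  f : ℕ
  /-- the number of views in a superview -/
  x : ℕ
  /-- the known bound on message delay -/
  Δ : ℕ
  /-- the waiting time before recovery fragments are sent -/
  s : ℕ
  /-- the (perfect) hash function -/
  hash : HashInput D → D
  hash_injective : Function.Injective hash
  code : ErasureCode n
  /-- representation of sequences of transactions by bit strings -/
  ser : List Tx → List Bool
  parse : List Bool → Option (List Tx)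
  parse_ser : ∀ l, parse (ser l) = some l
  /-- choice of the reconstruction parameter by leaders -/
  g : Set (Received n D Tx) → ℕ → ℕ
  g_mem : ∀ S v, n - f - 1 ≤ g S v ∧ g S v ≤ n - 1
  g_initial : ∀ S v, (v - 1) % x = 0 → g S v = n - f - 1
  /-- the part of `ProposeReady` which is left to the implementation: whether processor `i` in the
  given local state at the given timeslot goes on to propose its next block of a superview -/
  ready : Fin n → ℕ → LState n D Tx → Prop

namespace Protocol

variable {n : ℕ} {D Tx : Type*} (P : Protocol n D Tx)

/-! ### Views and leaders -/

/-- The superview of a view `v ≥ 1`. -/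
def superview (v : ℕ) : ℕ := (v - 1) / P.x + 1

/-- Initial views: `v ≡ 1 mod x` (for `v ≥ 1`). -/
def IsInitial (v : ℕ) : Prop := (v - 1) % P.x = 0

/-- `i` is `lead(v)`; processors are numbered from `0`. -/
def IsLeader (i : Fin n) (v : ℕ) : Prop := (i : ℕ) = P.superview v % n

/-! ### Merkle trees, tags, certified fragments, decoding -/

/-- Root of the full binary tree of depth `d` with leaves `ℓ 0, …, ℓ (2 ^ d - 1)`. -/
def treeRoot : ℕ → (ℕ → D) → D
  | 0, ℓ => ℓ 0
  | d + 1, ℓ => P.hash (.node (treeRoot d ℓ) (treeRoot d (fun i => ℓ (i + 2 ^ d))))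

/-- The siblings, from the top downwards, of the nodes on the path from the root to leaf `i`. -/
def treePath : ℕ → (ℕ → D) → ℕ → List D
  | 0, _, _ => []
  | d + 1, ℓ, i =>
    if i < 2 ^ d then P.treeRoot d (fun j => ℓ (j + 2 ^ d)) :: treePath d ℓ i
    else P.treeRoot d ℓ :: treePath d (fun j => ℓ (j + 2 ^ d)) (i - 2 ^ d)

/-- The root computed from a leaf `y` at position `i` and a list of siblings. -/
def pathRoot : ℕ → List D → ℕ → D → Option D
  | 0, [], _, y => some y
  | d + 1, z :: path, i, y =>
    if i < 2 ^ d then (pathRoot d path i y).map (fun w => P.hash (.node w z))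
    else (pathRoot d path (i - 2 ^ d) y).map (fun w => P.hash (.node z w))
  | _, _, _, _ => none

/-- The leaves of the Merkle tree of `c₁, …, cₙ`, padded to a power of two. -/
def leaves (c : Fin n → List Bool) (i : ℕ) : D :=
  if h : i < n then P.hash (.data (c ⟨i, h⟩)) else P.hash (.data [])

def merkleRoot (c : Fin n → List Bool) : D := P.treeRoot (Nat.clog 2 n) (P.leaves c)

def merklePath (c : Fin n → List Bool) (i : Fin n) : List D :=
  P.treePath (Nat.clog 2 n) (P.leaves c) i

/-- `path` is a validation path from `r` to `c` at position `i`. -/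
def IsValidationPath (r : D) (c : List Bool) (i : Fin n) (path : List D) : Prop :=
  P.pathRoot (Nat.clog 2 n) path i (P.hash (.data c)) = some r

/-- The tag `τ(C,k)`. -/
def tau (C : List Bool) (k : ℕ) : Tag D := ⟨C.length, k, P.merkleRoot (P.code.encode k C)⟩

/-- `(c, path)` is a certified fragment of the tag `z` at `i`. -/
def CertifiedAt (z : Tag D) (i : Fin n) (c : List Bool) (path : List D) : Prop :=
  c.length = P.code.fragLen z.k z.len ∧ P.IsValidationPath z.root c i path

open Classical in
/-- `Decode`, applied to the tag `z` and the fragments `c j`, `j ∈ I`. -/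
noncomputable def Decode (z : Tag D) (I : Finset (Fin n)) (c : Fin n → List Bool) :
    Option (List Bool) :=
  match P.code.decode z.k z.len (fun j => if j ∈ I then some (c j) else none) with
  | none => none
  | some C => if P.tau C z.k = z then some C else none

/-! ### Blocks, certificates, `blocks` -/

def genesis : Block D := ⟨0, P.tau [] n, P.tau [] n, none⟩

/-- `b` is a correctly formed non-genesis block (up to its signature). -/
def WellFormed (b : Block D) : Prop :=
  1 ≤ b.view ∧ n - P.f - 1 ≤ b.tag.k ∧ b.tag.k ≤ n - 1 ∧ b.recTag.k = n - P.f - 1 ∧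
    b.recTag.len = b.tag.len ∧ b.par.isSome

/-- `a` is the parent of `b`. -/
def IsParent (a b : Block D) : Prop := b.par = some (P.hash (.block a))

/-- `a` is an ancestor of `b`. -/
def IsAncestor (a b : Block D) : Prop := Relation.ReflTransGen P.IsParent a b

/-- `M` contains a stage-1 certificate for `b`, or the votes from which it is formed. -/
def HasCert1 (M : Set (Msg n D Tx)) (b : Block D) : Prop :=
  .cert1 b ∈ M ∨ n - P.f ≤ {i : Fin n | Msg.vote1 b i ∈ M}.ncard

/-- `M` contains a stage-2 M-certificate for `b`, or the votes from which it is formed. -/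
def HasCertM (M : Set (Msg n D Tx)) (b : Block D) : Prop :=
  .certM b ∈ M ∨ P.f + 1 ≤ {i : Fin n | Msg.vote2 b i ∈ M}.ncard

/-- `M` contains a stage-2 certificate for `b`, or the votes from which it is formed. -/
def HasCert2 (M : Set (Msg n D Tx)) (b : Block D) : Prop :=
  .cert2 b ∈ M ∨ n - P.f ≤ {i : Fin n | Msg.vote2 b i ∈ M}.ncard

/-- `M` contains an N-certificate for view `v`, or the messages from which it is formed. -/
def HasCertN (M : Set (Msg n D Tx)) (v : ℕ) : Prop :=
  .certN v ∈ M ∨ n - P.f ≤ {i : Fin n | Msg.nullify v i ∈ M}.ncard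

/-- The message `m` is a certified fragment of `b` at `j`, with data `c`. -/
def IsFrag (b : Block D) (j : Fin n) (c : List Bool) (m : Msg n D Tx) : Prop :=
  ∃ path, m = .frag b j c path ∧ P.CertifiedAt b.tag j c path

/-- The message `m` is a certified recovery fragment of `b` at `j`, with data `c`. -/
def IsRecFrag (b : Block D) (j : Fin n) (c : List Bool) (m : Msg n D Tx) : Prop :=
  (b.tag.k = n - P.f - 1 ∧ P.IsFrag b j c m) ∨
  (b.tag.k ≠ n - P.f - 1 ∧ ∃ path, m = .recFrag b j c path ∧ P.CertifiedAt b.recTag j c path)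

/-- The messages in `M` contain certified fragments, or certified recovery fragments, of `b` from
which the payload `C` of `b` is decoded, and both tags of `b` are those of `C`. -/
def Recovers (M : Set (Msg n D Tx)) (b : Block D) (C : List Bool) : Prop :=
  ((∃ (I : Finset (Fin n)) (c : Fin n → List Bool), I.card = b.tag.k ∧
      (∀ j ∈ I, ∃ m ∈ M, P.IsFrag b j (c j) m) ∧ P.Decode b.tag I c = some C) ∨
   (∃ (I : Finset (Fin n)) (c : Fin n → List Bool), I.card = b.recTag.k ∧
      (∀ j ∈ I, ∃ m ∈ M, P.IsRecFrag b j (c j) m) ∧ P.Decode b.recTag I c = some C)) ∧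
  P.tau C b.tag.k = b.tag ∧ P.tau C (n - P.f - 1) = b.recTag

/-- The variable `blocks` of a processor which has received the messages `M`. -/
inductive InBlocks (M : Set (Msg n D Tx)) : Block D → Prop
  | genesis : InBlocks M P.genesis
  | step (b b' : Block D) : P.WellFormed b →
      (P.HasCertM M b ∨ (P.HasCert1 M b ∧ ∃ C, P.Recovers M b C)) →
      InBlocks M b' → P.IsParent b' b → InBlocks M b

/-- The variable `blocks†`. -/
def InDagger (M : Set (Msg n D Tx)) (b : Block D) : Prop :=
  b = P.genesis ∨
    (P.WellFormed b ∧ P.HasCertM M b ∧ ∃ b', P.InBlocks M b' ∧ P.IsParent b' b)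

/-- The variable `blocks⋄`. -/
def InDiamond (M : Set (Msg n D Tx)) (b : Block D) : Prop :=
  b = P.genesis ∨
    (P.WellFormed b ∧ P.HasCert1 M b ∧ (∃ C, P.Recovers M b C) ∧
      ∃ b', P.InBlocks M b' ∧ P.IsParent b' b)

/-- Processor `i`, having received `M`, has a votable fragment for view `v`, namely
`(b, i, c, path)`. -/
def Votable (M : Set (Msg n D Tx)) (v : ℕ) (i : Fin n) (b : Block D) (c : List Bool)
    (path : List D) : Prop :=
  P.WellFormed b ∧ b.view = v ∧ .frag b i c path ∈ M ∧ P.CertifiedAt b.tag i c path ∧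
  ∃ b', P.InBlocks M b' ∧ P.IsParent b' b ∧ b'.view < v ∧
    ∀ u, b'.view < u → u < v → P.HasCertN M u

/-! ### The instructions of processor `i` at timeslot `t` -/

/-- Disseminate (new) N-certificates, stage-1 certificates and stage-2 M-certificates. -/
def certStep (i : Fin n) (σ : LState n D Tx) : LState n D Tx :=
  LState.disseminate i
    {m | (∃ v, m = .certN v ∧ P.HasCertN σ.msgs v) ∨ (∃ b, m = .cert1 b ∧ P.HasCert1 σ.msgs b) ∨
      (∃ b, m = .certM b ∧ P.HasCertM σ.msgs b)} σ

/-- The view `σ.view` is initial and no block was proposed yet for its superview. -/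
def FirstProposal (σ : LState n D Tx) : Prop :=
  P.IsInitial σ.view ∧ ∀ p ∈ σ.proposed, P.superview p.1.view ≠ P.superview σ.view

/-- `ProposeReady` holds, and the next block to be proposed is for view `v` and has parent `a`. -/
def ProposeReady (i : Fin n) (t : ℕ) (σ : LState n D Tx) (v : ℕ) (a : Block D) : Prop :=
  (P.FirstProposal σ ∧ v = σ.view ∧ a = σ.parent) ∨
  (¬ P.FirstProposal σ ∧ P.ready i t σ ∧ v = a.view + 1 ∧
    P.superview a.view = P.superview σ.view ∧ P.superview v = P.superview σ.view ∧
    (∃ C, (a, C) ∈ σ.proposed) ∧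
    ∀ p ∈ σ.proposed, P.superview p.1.view = P.superview σ.view → p.1.view ≤ a.view)

/-- `tr` is known to be included in the payload of an ancestor of `a`: the processor has recovered
that payload, or has itself proposed that ancestor. -/
def KnownIncluded (σ : LState n D Tx) (a : Block D) (tr : Tx) : Prop :=
  ∃ (b : Block D) (C : List Bool) (l : List Tx), P.IsAncestor b a ∧
    (P.Recovers σ.msgs b C ∨ (b, C) ∈ σ.proposed) ∧ P.parse C = some l ∧ tr ∈ l

/-- `l` lists all transactions received but not known to be included in ancestors of `a`. -/
def IsPayload (σ : LState n D Tx) (a : Block D) (l : List Tx) : Prop :=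
  l.Nodup ∧ ∀ tr, tr ∈ l ↔ (.tx tr ∈ σ.msgs ∧ ¬ P.KnownIncluded σ a tr)

/-- The block for view `v` with parent `a`, payload `C`, and reconstruction parameter `k`. -/
def mkBlock (v : ℕ) (a : Block D) (C : List Bool) (k : ℕ) : Block D :=
  ⟨v, P.tau C k, P.tau C (n - P.f - 1), some (P.hash (.block a))⟩

/-- The certified fragment at `j` of a block `b` with payload `C`. -/
def fragOf (b : Block D) (C : List Bool) (j : Fin n) : Msg n D Tx :=
  .frag b j (P.code.encode b.tag.k C j) (P.merklePath (P.code.encode b.tag.k C) j)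

open Classical in
/-- The certified recovery fragment at `j` of a block `b` with payload `C`. -/
noncomputable def recFragOf (b : Block D) (C : List Bool) (j : Fin n) : Msg n D Tx :=
  if b.tag.k = n - P.f - 1 then P.fragOf b C j
  else .recFrag b j (P.code.encode (n - P.f - 1) C j)
    (P.merklePath (P.code.encode (n - P.f - 1) C) j)

/-- If leader and `ProposeReady`, then `ProposeBlock`. -/
def ProposeStep (i : Fin n) (t : ℕ) (σ σ' : LState n D Tx) : Prop :=
  (P.IsLeader i σ.view ∧ ∃ v a l, P.ProposeReady i t σ v a ∧ P.IsPayload σ a l ∧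
    ∃ b, b = P.mkBlock v a (P.ser l) (P.g σ.S v) ∧
      σ' = LState.send i {p | p.2 = P.fragOf b (P.ser l) p.1}
        { σ with proposed := insert (b, P.ser l) σ.proposed }) ∨
  (¬ (P.IsLeader i σ.view ∧ ∃ v a, P.ProposeReady i t σ v a) ∧ σ' = σ)

/-- The stage-1 vote. -/
def VoteStep (i : Fin n) (σ σ' : LState n D Tx) : Prop :=
  (σ.view ∉ σ.voted1 ∧ ∃ b c path, P.Votable σ.msgs σ.view i b c path ∧
    σ' = LState.disseminate i {m | m = .vote1 b i ∨ (¬ P.IsLeader i σ.view ∧ m = .frag b i c path)}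
      { σ with voted1 := insert σ.view σ.voted1 }) ∨
  (¬ (σ.view ∉ σ.voted1 ∧ ∃ b c path, P.Votable σ.msgs σ.view i b c path) ∧ σ' = σ)

open Classical in
/-- If `blocks` contains a block for the present view: stage-2 vote and next view. -/
def BlockStep (i : Fin n) (t : ℕ) (σ σ' : LState n D Tx) : Prop :=
  (∃ b, P.InBlocks σ.msgs b ∧ b.view = σ.view ∧
    σ' = { (if σ.view ∈ σ.nullified then σ else
              LState.disseminate i {.vote2 b i} { σ with voted2 := insert σ.view σ.voted2 }) with
            parent := b
            view := σ.view + 1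
            entered := t }) ∨
  ((¬ ∃ b, P.InBlocks σ.msgs b ∧ b.view = σ.view) ∧ σ' = σ)

/-- `TimeoutReady`; the timer is `T = t - σ.entered`. -/
def TimeoutReady (t : ℕ) (σ : LState n D Tx) : Prop :=
  (¬ P.IsInitial σ.view ∧ t - σ.entered = P.Δ ∧ σ.view ∉ σ.voted1 ∧ σ.view ∉ σ.voted2) ∨
  (¬ P.IsInitial σ.view ∧ t - σ.entered = 3 * P.Δ ∧ σ.view ∉ σ.voted2) ∨
  (P.IsInitial σ.view ∧ t - σ.entered = 4 * P.Δ + 2 * P.s ∧ σ.view ∉ σ.voted1 ∧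
    σ.view ∉ σ.voted2) ∨
  (P.IsInitial σ.view ∧ t - σ.entered = 5 * P.Δ + 2 * P.s ∧ σ.view ∉ σ.voted2)

open Classical in
/-- Upon time-out, nullify the present and the later views of the present superview. -/
noncomputable def timeoutStep (i : Fin n) (t : ℕ) (σ : LState n D Tx) : LState n D Tx :=
  if σ.view ∉ σ.nullified ∧ P.TimeoutReady t σ then
    LState.disseminate i
      {m | ∃ u, σ.view ≤ u ∧ P.superview u = P.superview σ.view ∧ m = .nullify u i}
      { σ with
        nullified := σ.nullified ∪ {u | σ.view ≤ u ∧ P.superview u = P.superview σ.view} }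
  else σ

open Classical in
/-- Next view upon an N-certificate for the present view. -/
noncomputable def nCertStep (t : ℕ) (σ : LState n D Tx) : LState n D Tx :=
  if P.HasCertN σ.msgs σ.view then { σ with view := σ.view + 1, entered := t } else σ

open Classical in
/-- Trigger the timers `T(b)` of new members of `blocks⋄`. -/
noncomputable def timerStep (t : ℕ) (σ : LState n D Tx) : LState n D Tx :=
  { σ with
    timer := fun b =>
      if b ≠ P.genesis ∧ P.InDiamond σ.msgs b ∧ σ.timer b = none then some (t + P.s)
      else σ.timer b }

/-- For each `b` such that `T(b)` expires now and `b ∉ blocks†`: send each `p_j` its certified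
recovery fragment of `b`, unless it was already sent to `p_j` or received from `p_j`. -/
def recoveryStep (i : Fin n) (t : ℕ) (σ : LState n D Tx) : LState n D Tx :=
  LState.send i
    {p | ∃ b C, σ.timer b = some t ∧ ¬ P.InDagger σ.msgs b ∧ P.Recovers σ.msgs b C ∧
      (¬ ∃ c m, P.IsRecFrag b p.1 c m ∧ ((p.1, m) ∈ σ.sent ∨ (some p.1, m) ∈ σ.S)) ∧
      p.2 = P.recFragOf b C p.1} σ

/-- Disseminate one's own fragments of blocks that have a stage-1 certificate. -/
def echoStep (i : Fin n) (σ : LState n D Tx) : LState n D Tx :=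
  LState.disseminate i
    {m | m ∈ σ.msgs ∧ ∃ b c, P.WellFormed b ∧ (P.IsFrag b i c m ∨ P.IsRecFrag b i c m) ∧
      ¬ P.IsLeader i b.view ∧ P.HasCert1 σ.msgs b} σ

/-- One execution of all the instructions, from top to bottom. -/
def Pass (i : Fin n) (t : ℕ) (σ σ' : LState n D Tx) : Prop :=
  ∃ σ₁ σ₂ σ₃, P.ProposeStep i t (P.certStep i σ) σ₁ ∧ P.VoteStep i σ₁ σ₂ ∧
    P.BlockStep i t σ₂ σ₃ ∧
    σ' = P.echoStep i (P.recoveryStep i t (P.timerStep t (P.nCertStep t (P.timeoutStep i t σ₃))))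

/-- The instructions are executed repeatedly within a timeslot, until nothing changes any more. -/
def Run (i : Fin n) (t : ℕ) (σ σ' : LState n D Tx) : Prop :=
  Relation.ReflTransGen (P.Pass i t) σ σ' ∧ P.Pass i t σ' σ'

/-- The initial state of a processor which begins at timeslot `t₀`. -/
def init (t₀ : ℕ) : LState n D Tx where
  S := ∅
  sent := ∅
  view := 1
  parent := P.genesis
  entered := t₀
  nullified := ∅
  voted1 := ∅
  voted2 := ∅
  proposed := ∅
  timer := fun _ => none

/-- Timeslot `t` of processor `i`, which begins at `t₀`: it receives the messages `R`, and then
(unless it has not begun yet) executes its instructions. -/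
def SlotStep (i : Fin n) (t₀ t : ℕ) (R : Set (Received n D Tx)) (σ σ' : LState n D Tx) : Prop :=
  (t < t₀ ∧ σ' = { σ with S := σ.S ∪ R }) ∨ (t₀ ≤ t ∧ P.Run i t { σ with S := σ.S ∪ R } σ')

end Protocol

/-! ### Executions in the partial synchrony model -/

/-- The behaviour over time of `n` processors and the network; `st t i` is the local state of `i` at
the end of timeslot `t` (used for correct `i` only), and `recv t i` are the messages which arrive at
`i` at timeslot `t`. -/
structure Trace (n : ℕ) (D Tx : Type*) where
  correct : Set (Fin n)
  GST : ℕ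
  δ : ℕ
  start : Fin n → ℕ
  recv : ℕ → Fin n → Set (Received n D Tx)
  st : ℕ → Fin n → LState n D Tx

namespace Trace

variable {n : ℕ} {D Tx : Type*} (E : Trace n D Tx)

/-- `i` has sent the message `m` to some processor before timeslot `t`. -/
def SentBefore (i : Fin n) (m : Msg n D Tx) (t : ℕ) : Prop := ∃ t' < t, ∃ j, (j, m) ∈ (E.st t' i).sent

/-- The processors whose signature on `m i` is available to the adversary at timeslot `t`: all
faulty ones, and the correct ones that have sent `m i` before. -/
def signers (m : Fin n → Msg n D Tx) (t : ℕ) : Set (Fin n) :=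
  {i | i ∈ E.correct → E.SentBefore i (m i) t}

/-- Perfect cryptography: the message `m`, arriving at some processor at timeslot `t`, contains no
forged signature, signature share or certificate. -/
def Unforged (P : Protocol n D Tx) (t : ℕ) (m : Msg n D Tx) : Prop :=
  (∀ b, m.block? = some b → 1 ≤ b.view → ∀ i ∈ E.correct, P.IsLeader i b.view →
    ∃ t' < t, ∃ C, (b, C) ∈ (E.st t' i).proposed) ∧
  match m with
  | .vote1 b i => i ∈ E.signers (.vote1 b) t
  | .vote2 b i => i ∈ E.signers (.vote2 b) t
  | .nullify v i => i ∈ E.signers (.nullify v) t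
  | .cert1 b => n - P.f ≤ (E.signers (.vote1 b) t).ncard
  | .certM b => P.f + 1 ≤ (E.signers (.vote2 b) t).ncard
  | .cert2 b => n - P.f ≤ (E.signers (.vote2 b) t).ncard
  | .certN v => n - P.f ≤ (E.signers (.nullify v) t).ncard
  | .tx tr => ∃ t' < t, ∃ i, (none, .tx tr) ∈ E.recv t' i
  | .frag _ _ _ _ => True
  | .recFrag _ _ _ _ => True

/-- `E` is an execution of the protocol `P` in the partial synchrony model with at most `f` faulty
processors. -/
structure IsExecution (P : Protocol n D Tx) : Prop where
  /-- at most `f` processors are faulty; they may behave arbitrarily -/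
  faulty : E.correctᶜ.ncard ≤ P.f
  /-- correct processors begin by `GST` -/
  start_le : ∀ i ∈ E.correct, E.start i ≤ E.GST
  /-- the actual bound `δ` on message delay, which is at most the known bound -/
  delay_pos : 1 ≤ E.δ
  delay_le : E.δ ≤ P.Δ
  /-- correct processors follow the instructions -/
  step_zero : ∀ i ∈ E.correct,
    P.SlotStep i (E.start i) 0 (E.recv 0 i) (P.init (E.start i)) (E.st 0 i)
  step_succ : ∀ i ∈ E.correct, ∀ t,
    P.SlotStep i (E.start i) (t + 1) (E.recv (t + 1) i) (E.st t i) (E.st (t + 1) i)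
  /-- finitely many messages arrive in a timeslot -/
  finite : ∀ t i, (E.recv t i).Finite
  /-- the environment sends transactions only -/
  env : ∀ t i m, (none, m) ∈ E.recv t i → ∃ tr, m = .tx tr
  /-- authenticated channels, and messages take at least one timeslot -/
  auth : ∀ t j, ∀ i ∈ E.correct, ∀ m, (some i, m) ∈ E.recv t j →
    ∃ t' < t, (j, m) ∈ (E.st t' i).sent
  /-- no forged messages -/
  unforged : ∀ t j i m, (some i, m) ∈ E.recv t j → E.Unforged P t m
  /-- messages between correct processors arrive in time -/
  delivery : ∀ i ∈ E.correct, ∀ j ∈ E.correct, i ≠ j → ∀ t m, (j, m) ∈ (E.st t i).sent →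
    ∃ t' ≤ max E.GST t + E.δ, (some i, m) ∈ E.recv t' j

/-- `M*`: the messages received by at least one processor. -/
def allMsgs : Set (Msg n D Tx) :=
  {m | (∃ t i q, (q, m) ∈ E.recv t i) ∨ ∃ t, ∃ i ∈ E.correct, m ∈ (E.st t i).msgs}

/-- `M_c(t)`: the messages received by at least one correct processor at a timeslot `≤ t`. -/
def correctMsgs (t : ℕ) : Set (Msg n D Tx) := {m | ∃ i ∈ E.correct, m ∈ (E.st t i).msgs}

/-- The processor `i` has entered view `v` by the end of timeslot `t` (views are entered one after
the other). -/
def HasEntered (i : Fin n) (v t : ℕ) : Prop :=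
  E.start i ≤ t ∧ v ≤ (E.st t i).view

/-- Every correct processor enters every view. -/
def ViewProgression : Prop := ∀ i ∈ E.correct, ∀ v, 1 ≤ v → ∃ t, E.HasEntered i v t

end Trace

/-! ### Extractable SMR -/

/-- Finite or infinite sequences: `none` is the end of the sequence. -/
def IsSeq {α : Type*} (c : ℕ → Option α) : Prop := ∀ i, c i = none → c (i + 1) = none

/-- The prefix relation for finite or infinite sequences. -/
def IsPrefix {α : Type*} (c c' : ℕ → Option α) : Prop := ∀ i a, c i = some a → c' i = some a

open Classical in
/-- The concatenation of an infinite sequence of finite lists. -/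
noncomputable def concat {α : Type*} (l : ℕ → List α) (m : ℕ) : Option α :=
  if h : ∃ a N, ((List.range N).flatMap l)[m]? = some a then some h.choose else none

namespace Protocol

variable {n : ℕ} {D Tx : Type*} (P : Protocol n D Tx)

/-- `c` is a (finite or infinite) sequence of blocks, each the parent of the next, which starts with
a child of the genesis block, such that the payloads of all its blocks can be recovered from `M`, and
such that for each block of the sequence, `M` contains a stage-2 certificate for that block or for a
later block of the sequence. -/
def IsFinalChain (M : Set (Msg n D Tx)) (c : ℕ → Option (Block D)) : Prop :=
  IsSeq c ∧ (∀ b, c 0 = some b → P.IsParent P.genesis b) ∧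
  (∀ i b b', c i = some b → c (i + 1) = some b' → P.IsParent b b') ∧
  ∀ i b, c i = some b →
    (∃ j b', i ≤ j ∧ c j = some b' ∧ P.HasCert2 M b') ∧ ∃ C, P.Recovers M b C

def IsLongestFinalChain (M : Set (Msg n D Tx)) (c : ℕ → Option (Block D)) : Prop :=
  P.IsFinalChain M c ∧ ∀ c', P.IsFinalChain M c' → ∀ i, c' i ≠ none → c i ≠ none

open Classical in
/-- The transactions in the payload of a block, as recovered from `M`. -/
noncomputable def payloadTxs (M : Set (Msg n D Tx)) (b : Block D) : List Tx :=
  if h : ∃ C, P.Recovers M b C then (P.parse h.choose).getD [] else []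

open Classical in
/-- The function `F` of extractable SMR. -/
noncomputable def extract (M : Set (Msg n D Tx)) : ℕ → Option Tx :=
  if h : ∃! c, P.IsLongestFinalChain M c then
    concat (fun i => ((h.choose i).map (P.payloadTxs M)).getD [])
  else fun _ => none

/-- Consistency of extractable SMR, in the execution `E`. -/
def Consistency (E : Trace n D Tx) : Prop :=
  ∀ M₁ M₂, M₁ ⊆ M₂ → M₂ ⊆ E.allMsgs → IsPrefix (P.extract M₁) (P.extract M₂)

/-- Liveness of extractable SMR, in the execution `E`. -/
def Liveness (E : Trace n D Tx) : Prop :=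
  ∀ i ∈ E.correct, ∀ t tr, .tx tr ∈ (E.st t i).msgs →
    ∃ t' m, P.extract (E.correctMsgs t') m = some tr

/-- Agreement on `blocks` within time `2δ + s` after `GST`. -/
def BlocksAgreement (E : Trace n D Tx) : Prop :=
  ∀ i ∈ E.correct, ∀ j ∈ E.correct, ∀ t b, P.InBlocks (E.st t i).msgs b →
    P.InBlocks (E.st (max t E.GST + 2 * E.δ + P.s) j).msgs b

/-- Correct leaders finalise blocks in initial views that are first entered at `GST` or later. -/
def LeadersFinalise (E : Trace n D Tx) : Prop :=
  ∀ v, 1 ≤ v → P.IsInitial v → ∀ i ∈ E.correct, P.IsLeader i v →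
    (∀ j ∈ E.correct, ∀ t, E.HasEntered j v t → E.GST ≤ t) →
    (∃ b, P.WellFormed b ∧ b.view = v ∧ ∃ t, ∀ j ∈ E.correct, P.HasCert2 (E.st t j).msgs b) ∧
    ∀ j ∈ E.correct, ∀ t k, (k, .nullify v j) ∉ (E.st t j).sent

end Protocol

end Carnot

/-! ### Commitments, erasure codes and recovery of payloads -/

namespace Carnot

namespace Protocol

variable {n : ℕ} {D Tx : Type*} (P : Protocol n D Tx)

/-! ### Merkle trees and erasure codes -/

/-! Perfect cryptography turns payloads into combinatorics. As the hash is injective, a certified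
fragment of an honest tag is the genuine one, so any `n - f - 1` recovery fragments of a block with
honest tags decode to its unique payload (`recovers_of_recFrags`, `payload_unique`). Local states
only grow, so facts about one processor are invariants of single instructions (`invariant`), and at
the end of a timeslot no instruction has an effect any more (`stable_of_pass`).

Safety: two sets of `n - f` processors share a correct one. A correct processor sends stage-1 votes
for at most one block per view, and never both a stage-2 vote and a nullify message for the same
view. So each view has at most one block with a stage-1 certificate, and a view with a stage-2
certificate has no N-certificate. A stage-1 voter has N-certificates for all views between parent
and block; hence no later block can skip a block with a stage-2 certificate, which is therefore an
ancestor of every block with a stage-1 certificate in a view at least as large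
(`isAncestor_of_cert2`). M-certificates do no harm, because the earliest correct stage-2 vote behind
them rests on a stage-1 certificate and a recovered payload (`sound_aux`). All final chains are then
compatible, which is Consistency.

Agreement: a block in `blocks` of one correct processor reaches the others through an M-certificate,
or through recovery fragments that are sent and echoed (`relay_inBlocks`). Hence correct processors
catch up with each other (`catch_up`), and if all of them stayed in one view they would time out and
form an N-certificate for it (`view_unbounded`).

Finalisation: let a correct leader's initial view be entered first at `t₁`, not before GST. By `t₁ +
2δ + s` the leader has proposed, `2δ + s` later its block is votable for all correct processors, and
`δ` later it is in `blocks` of all of them. The time-outs `4Δ + 2s` and `5Δ + 2s` are just long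
enough for the last two events, so no correct processor nullifies, and all of them send stage-2
votes for the block.

Liveness: the receiver of a transaction leads arbitrarily late superviews. In one that starts late
enough, its block is finalised, and the transaction is in this block or in an ancestor. -/

theorem hash_data_inj {c c' : List Bool} (h : P.hash (.data c) = P.hash (.data c')) : c = c' := by
  simpa using P.hash_injective h

theorem hash_node_inj {l r l' r' : D} (h : P.hash (.node l r) = P.hash (.node l' r')) :
    l = l' ∧ r = r' := by
  simpa using P.hash_injective h

theorem treeRoot_inj : ∀ (d : ℕ) (l l' : ℕ → D), P.treeRoot d l = P.treeRoot d l' →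
    ∀ i < 2 ^ d, l i = l' i
  | 0, l, l', h, i, hi => by
    obtain rfl : i = 0 := by simpa using hi
    exact h
  | d + 1, l, l', h, i, hi => by
    obtain ⟨h₁, h₂⟩ := P.hash_node_inj h
    by_cases hd : i < 2 ^ d
    · exact treeRoot_inj d l l' h₁ i hd
    · have := treeRoot_inj d _ _ h₂ (i - 2 ^ d) (by rw [pow_succ] at hi; omega)
      simpa [Nat.sub_add_cancel (not_lt.1 hd)] using this

theorem pathRoot_treePath : ∀ (d : ℕ) (l : ℕ → D) (i : ℕ), i < 2 ^ d →
    P.pathRoot d (P.treePath d l i) i (l i) = some (P.treeRoot d l)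
  | 0, l, i, hi => by
    obtain rfl : i = 0 := by simpa using hi
    simp [treePath, pathRoot, treeRoot]
  | d + 1, l, i, hi => by
    by_cases hd : i < 2 ^ d
    · simp [treePath, pathRoot, treeRoot, hd, pathRoot_treePath d l i hd]
    · have := pathRoot_treePath d (fun j => l (j + 2 ^ d)) (i - 2 ^ d)
        (by rw [pow_succ] at hi; omega)
      simp only [Nat.sub_add_cancel (not_lt.1 hd)] at this
      simp [treePath, pathRoot, treeRoot, hd, this]

/-- Binding of Merkle commitments: injectivity of the hash forces the path to follow the nodes of
the tree. Since `pathRoot` fixes the depth, an inner node cannot pass for a leaf. -/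
theorem eq_of_pathRoot : ∀ (d : ℕ) (path : List D) (i : ℕ) (y : D) (l : ℕ → D), i < 2 ^ d →
    P.pathRoot d path i y = some (P.treeRoot d l) → y = l i
  | 0, [], i, y, l, hi, h => by
    obtain rfl : i = 0 := by simpa using hi
    simpa [pathRoot, treeRoot] using h
  | 0, _ :: _, i, y, l, hi, h => by simp [pathRoot] at h
  | d + 1, [], i, y, l, hi, h => by simp [pathRoot] at h
  | d + 1, z :: path, i, y, l, hi, h => by
    by_cases hd : i < 2 ^ d
    · simp only [pathRoot, hd, if_true, Option.map_eq_some_iff] at h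
      obtain ⟨w, hw, e⟩ := h
      obtain ⟨rfl, -⟩ := P.hash_node_inj e
      exact eq_of_pathRoot d path i y l hd hw
    · simp only [pathRoot, hd, if_false, Option.map_eq_some_iff] at h
      obtain ⟨w, hw, e⟩ := h
      obtain ⟨-, rfl⟩ := P.hash_node_inj e
      have := eq_of_pathRoot d path (i - 2 ^ d) y _ (by rw [pow_succ] at hi; omega) hw
      simpa [Nat.sub_add_cancel (not_lt.1 hd)] using this

theorem fin_lt_two_pow_clog (i : Fin n) : (i : ℕ) < 2 ^ Nat.clog 2 n :=
  lt_of_lt_of_le i.2 (Nat.le_pow_clog (by norm_num) n)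

theorem leaves_fin (c : Fin n → List Bool) (i : Fin n) : P.leaves c i = P.hash (.data (c i)) := by
  simp [leaves]

theorem isValidationPath_merklePath (c : Fin n → List Bool) (i : Fin n) :
    P.IsValidationPath (P.merkleRoot c) (c i) i (P.merklePath c i) := by
  have := P.pathRoot_treePath (Nat.clog 2 n) (P.leaves c) i (fin_lt_two_pow_clog i)
  rwa [leaves_fin] at this

theorem eq_of_isValidationPath {c : Fin n → List Bool} {i : Fin n} {y : List Bool} {path : List D}
    (h : P.IsValidationPath (P.merkleRoot c) y i path) : y = c i := by
  have := P.eq_of_pathRoot _ path i _ _ (fin_lt_two_pow_clog i) h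
  rw [leaves_fin] at this
  exact P.hash_data_inj this

theorem merkleRoot_inj {c c' : Fin n → List Bool} (h : P.merkleRoot c = P.merkleRoot c') :
    c = c' := by
  funext i
  have := P.treeRoot_inj _ _ _ h i (fin_lt_two_pow_clog i)
  rw [leaves_fin, leaves_fin] at this
  exact P.hash_data_inj this

/-- Against an honest tag nobody can certify a wrong fragment, so the origin of a certified fragment
does not matter for decoding. -/
theorem CertifiedAt.eq_encode {C : List Bool} {k : ℕ} {j : Fin n} {c : List Bool} {path : List D}
    (h : P.CertifiedAt (P.tau C k) j c path) : c = P.code.encode k C j :=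
  P.eq_of_isValidationPath h.2

theorem certifiedAt_tau {k : ℕ} (h₁ : 1 ≤ k) (h₂ : k ≤ n) (C : List Bool) (j : Fin n) :
    P.CertifiedAt (P.tau C k) j (P.code.encode k C j) (P.merklePath (P.code.encode k C) j) :=
  ⟨P.code.length_encode k C j h₁ h₂, P.isValidationPath_merklePath _ j⟩

theorem decode_tau {k : ℕ} (h₁ : 1 ≤ k) (h₂ : k ≤ n) {C : List Bool} {I : Finset (Fin n)}
    (hI : I.card = k) {c : Fin n → List Bool} (hc : ∀ j ∈ I, c j = P.code.encode k C j) :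
    P.Decode (P.tau C k) I c = some C := by
  have e : (fun j => if j ∈ I then some (c j) else none) =
      fun j => if j ∈ I then some (P.code.encode k C j) else none := by
    funext j
    split_ifs with hj
    · rw [hc j hj]
    · rfl
  have e' := P.code.decode_encode k C I h₁ h₂ hI
  rw [← e] at e'
  have e'' : P.code.decode (P.tau C k).k (P.tau C k).len
      (fun j => if j ∈ I then some (c j) else none) = some C := e'
  unfold Decode
  rw [e'']
  exact if_pos rfl

/-- Equal Merkle roots force equal fragments, and `k` of these together with the length determine
the bit string. -/
theorem tau_inj {k : ℕ} (h₁ : 1 ≤ k) (h₂ : k ≤ n) {C C' : List Bool}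
    (h : P.tau C k = P.tau C' k) : C = C' := by
  obtain ⟨I, -, hI⟩ := Finset.exists_subset_card_eq (s := (Finset.univ : Finset (Fin n))) (n := k)
    (by simpa using h₂)
  have e : P.code.encode k C = P.code.encode k C' := by
    simp only [tau, Tag.mk.injEq] at h
    exact P.merkleRoot_inj h.2.2
  have a := P.decode_tau h₁ h₂ (C := C) hI (c := P.code.encode k C) (fun _ _ => rfl)
  have b := P.decode_tau h₁ h₂ (C := C') hI (c := P.code.encode k C) (fun _ _ => by rw [e])
  rw [h, b] at a
  simpa using a.symm

/-! ### Monotonicity in the set of received messages -/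

variable {M M' : Set (Msg n D Tx)} {b : Block D}

theorem HasCert1.mono (h : M ⊆ M') (hb : P.HasCert1 M b) : P.HasCert1 M' b :=
  hb.imp (@h _) fun hc => hc.trans (Set.ncard_le_ncard (fun _ hi => h hi) (Set.toFinite _))

theorem HasCertM.mono (h : M ⊆ M') (hb : P.HasCertM M b) : P.HasCertM M' b :=
  hb.imp (@h _) fun hc => hc.trans (Set.ncard_le_ncard (fun _ hi => h hi) (Set.toFinite _))

theorem HasCert2.mono (h : M ⊆ M') (hb : P.HasCert2 M b) : P.HasCert2 M' b :=
  hb.imp (@h _) fun hc => hc.trans (Set.ncard_le_ncard (fun _ hi => h hi) (Set.toFinite _))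

theorem HasCertN.mono {v : ℕ} (h : M ⊆ M') (hb : P.HasCertN M v) : P.HasCertN M' v :=
  hb.imp (@h _) fun hc => hc.trans (Set.ncard_le_ncard (fun _ hi => h hi) (Set.toFinite _))

theorem Recovers.mono {C : List Bool} (h : M ⊆ M') (hb : P.Recovers M b C) :
    P.Recovers M' b C := by
  refine ⟨hb.1.imp ?_ ?_, hb.2⟩
  · rintro ⟨I, c, hI, hc, hd⟩
    exact ⟨I, c, hI, fun j hj => (hc j hj).imp fun m hm => ⟨h hm.1, hm.2⟩, hd⟩
  · rintro ⟨I, c, hI, hc, hd⟩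
    exact ⟨I, c, hI, fun j hj => (hc j hj).imp fun m hm => ⟨h hm.1, hm.2⟩, hd⟩

theorem InBlocks.mono (h : M ⊆ M') (hb : P.InBlocks M b) : P.InBlocks M' b := by
  induction hb with
  | genesis => exact .genesis
  | step b b' hw hc _ hp ih =>
    exact .step b b' hw (hc.imp (HasCertM.mono P h) fun ⟨h₁, C, hC⟩ =>
      ⟨HasCert1.mono P h h₁, C, hC.mono P h⟩) ih hp

theorem InDiamond.mono (h : M ⊆ M') (hb : P.InDiamond M b) : P.InDiamond M' b :=
  hb.imp_right fun ⟨hw, hc, ⟨C, hC⟩, b', hb', hp⟩ =>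
    ⟨hw, hc.mono P h, ⟨C, hC.mono P h⟩, b', hb'.mono P h, hp⟩

theorem Votable.mono {v : ℕ} {i : Fin n} {c : List Bool} {path : List D} (h : M ⊆ M')
    (hb : P.Votable M v i b c path) : P.Votable M' v i b c path := by
  obtain ⟨hw, hv, hm, hc, b', hb', hp, hlt, hN⟩ := hb
  exact ⟨hw, hv, h hm, hc, b', hb'.mono P h, hp, hlt, fun u h₁ h₂ => (hN u h₁ h₂).mono P h⟩

/-! ### Recovering payloads -/

theorem IsParent.unique {a a' : Block D} (h : P.IsParent a b) (h' : P.IsParent a' b) : a = a' := by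
  have := h.symm.trans h'
  simp only [Option.some.injEq] at this
  simpa using P.hash_injective this

theorem not_isParent_genesis {a : Block D} : ¬ P.IsParent a P.genesis := by
  simp [IsParent, genesis]

theorem WellFormed.ne_genesis (h : P.WellFormed b) : b ≠ P.genesis := by
  rintro rfl
  simpa [genesis] using h.1

/-- The second tag always has parameter `n - f - 1` and pins down the payload alone. Thus the
payload chosen in `payloadTxs` does not depend on the fragments it is decoded from. -/
theorem payload_unique (hn : 3 * P.f + 1 ≤ n) (hn₂ : 2 ≤ n) {C C' : List Bool}
    (h : P.tau C (n - P.f - 1) = b.recTag) (h' : P.tau C' (n - P.f - 1) = b.recTag) : C = C' :=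
  P.tau_inj (by omega) (by omega) (h.trans h'.symm)

/-- The tags of the genesis block have parameter `n`, whereas verification requires `n - f - 1` in
the second one. -/
theorem not_recovers_genesis (hn₂ : 2 ≤ n) {C : List Bool} : ¬ P.Recovers M P.genesis C := by
  rintro ⟨-, -, h⟩
  simp only [tau, genesis, Tag.mk.injEq] at h
  omega

/-- Both tags being honest, the fragments can only be those of the encoding of `C` with parameter `n
- f - 1`. If `b.tag.k` has this value, they are certified by the first tag, otherwise by the second.
-/
theorem recovers_of_recFrags (hn : 3 * P.f + 1 ≤ n) (hn₂ : 2 ≤ n) {C : List Bool}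
    (hw : P.WellFormed b) (h₁ : P.tau C b.tag.k = b.tag) (h₂ : P.tau C (n - P.f - 1) = b.recTag)
    {J : Set (Fin n)} (hJ : n - P.f - 1 ≤ J.ncard)
    (hm : ∀ j ∈ J, ∃ c, ∃ m ∈ M, P.IsRecFrag b j c m) : P.Recovers M b C := by
  classical
  refine ⟨.inr ?_, h₁, h₂⟩
  obtain ⟨I, hIJ, hI⟩ := Finset.exists_subset_card_eq (s := J.toFinset) (n := n - P.f - 1)
    (by rwa [Set.ncard_eq_toFinset_card'] at hJ)
  have key : ∀ j ∈ I, ∃ m ∈ M, P.IsRecFrag b j (P.code.encode (n - P.f - 1) C j) m := by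
    intro j hj
    obtain ⟨c, m, hmM, hm⟩ := hm j (by simpa using hIJ hj)
    suffices c = P.code.encode (n - P.f - 1) C j from this ▸ ⟨m, hmM, hm⟩
    rcases hm with ⟨hk, path, -, hc⟩ | ⟨-, path, -, hc⟩
    · rw [← h₁, hk] at hc
      exact hc.eq_encode P
    · rw [← h₂] at hc
      exact hc.eq_encode P
  refine ⟨I, P.code.encode (n - P.f - 1) C, hI.trans hw.2.2.2.1.symm, key, ?_⟩
  rw [← h₂]
  exact P.decode_tau (by omega) (by omega) hI fun _ _ => rfl

theorem isFrag_fragOf {C : List Bool} (hk : 1 ≤ b.tag.k) (hk' : b.tag.k ≤ n)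
    (h : P.tau C b.tag.k = b.tag) (j : Fin n) :
    P.IsFrag b j (P.code.encode b.tag.k C j) (P.fragOf (Tx := Tx) b C j) := by
  refine ⟨_, rfl, ?_⟩
  have := P.certifiedAt_tau hk hk' C j
  rwa [h] at this

theorem isRecFrag_recFragOf (hn : 3 * P.f + 1 ≤ n) (hn₂ : 2 ≤ n) {C : List Bool}
    (h₁ : P.tau C b.tag.k = b.tag) (h₂ : P.tau C (n - P.f - 1) = b.recTag) (j : Fin n) :
    ∃ c, P.IsRecFrag b j c (P.recFragOf b C j) := by
  unfold recFragOf
  split_ifs with hk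
  · exact ⟨_, .inl ⟨hk, P.isFrag_fragOf (by omega) (by omega) h₁ j⟩⟩
  · refine ⟨_, .inr ⟨hk, _, rfl, ?_⟩⟩
    have := P.certifiedAt_tau (k := n - P.f - 1) (by omega) (by omega) C j
    rwa [h₂] at this

end Protocol

end Carnot

/-! ### Single instructions and quiescent states of a processor -/

namespace Carnot

/-! ### Growth of the local state -/

namespace LState

variable {n : ℕ} {D Tx : Type*}

/-- The components of the local state which never shrink. -/
structure Le (σ σ' : LState n D Tx) : Prop where
  S : σ.S ⊆ σ'.S
  sent : σ.sent ⊆ σ'.sent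
  view : σ.view ≤ σ'.view
  nullified : σ.nullified ⊆ σ'.nullified
  voted1 : σ.voted1 ⊆ σ'.voted1
  voted2 : σ.voted2 ⊆ σ'.voted2
  proposed : σ.proposed ⊆ σ'.proposed
  timer : ∀ b e, σ.timer b = some e → σ'.timer b = some e

theorem Le.refl (σ : LState n D Tx) : Le σ σ :=
  ⟨subset_rfl, subset_rfl, le_rfl, subset_rfl, subset_rfl, subset_rfl, subset_rfl,
    fun _ _ h => h⟩

theorem Le.trans {σ₁ σ₂ σ₃ : LState n D Tx} (h : Le σ₁ σ₂) (h' : Le σ₂ σ₃) : Le σ₁ σ₃ :=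
  ⟨h.S.trans h'.S, h.sent.trans h'.sent, h.view.trans h'.view, h.nullified.trans h'.nullified,
    h.voted1.trans h'.voted1, h.voted2.trans h'.voted2, h.proposed.trans h'.proposed,
    fun b e hb => h'.timer b e (h.timer b e hb)⟩

theorem Le.msgs {σ σ' : LState n D Tx} (h : Le σ σ') : σ.msgs ⊆ σ'.msgs :=
  fun _ ⟨q, hq⟩ => ⟨q, h.S hq⟩

theorem le_send (i : Fin n) (X : Set (Fin n × Msg n D Tx)) (σ : LState n D Tx) :
    Le σ (σ.send i X) :=
  ⟨Set.subset_union_left, Set.subset_union_left, le_rfl, subset_rfl, subset_rfl, subset_rfl,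
    subset_rfl, fun _ _ h => h⟩

theorem le_disseminate (i : Fin n) (Y : Set (Msg n D Tx)) (σ : LState n D Tx) :
    Le σ (σ.disseminate i Y) :=
  le_send i _ σ

/-- A sending step that does not leave the growing components behind is no step at all. This detects
idle instructions in a pass that ends where it began. -/
theorem eq_of_send_le {i : Fin n} {X : Set (Fin n × Msg n D Tx)} {σ : LState n D Tx}
    (h : Le (σ.send i X) σ) : σ.send i X = σ := by
  have h₁ := h.S
  have h₂ := h.sent
  have e₁ : σ.S ∪ {p | p.1 = some i ∧ (i, p.2) ∈ X} = σ.S :=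
    Set.union_eq_left.2 fun p hp => h₁ (.inr hp)
  have e₂ : σ.sent ∪ X = σ.sent := Set.union_eq_left.2 fun p hp => h₂ (.inr hp)
  simp [send, e₁, e₂]

theorem sent_of_send_le {i k : Fin n} {m : Msg n D Tx} {X : Set (Fin n × Msg n D Tx)}
    {σ : LState n D Tx} (h : Le (σ.send i X) σ) (hm : (k, m) ∈ X) : (k, m) ∈ σ.sent :=
  h.sent (.inr hm)

end LState

open LState (Le)

namespace Protocol

variable {n : ℕ} {D Tx : Type*} (P : Protocol n D Tx) {i : Fin n} {t : ℕ}

/-! ### Single instructions -/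

/-- The effect of a single instruction. -/
inductive Micro (i : Fin n) (t : ℕ) : LState n D Tx → LState n D Tx → Prop
  | cert (σ) : Micro i t σ (P.certStep i σ)
  | propose (σ v a l) : P.IsLeader i σ.view → P.ProposeReady i t σ v a → P.IsPayload σ a l →
      Micro i t σ (LState.send i
        {p | p.2 = P.fragOf (P.mkBlock v a (P.ser l) (P.g σ.S v)) (P.ser l) p.1}
        { σ with
          proposed := insert (P.mkBlock v a (P.ser l) (P.g σ.S v), P.ser l) σ.proposed })
  | vote (σ b c path) : σ.view ∉ σ.voted1 → P.Votable σ.msgs σ.view i b c path →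
      Micro i t σ (LState.disseminate i
        {m | m = .vote1 b i ∨ (¬ P.IsLeader i σ.view ∧ m = .frag b i c path)}
        { σ with voted1 := insert σ.view σ.voted1 })
  | blockNull (σ b) : P.InBlocks σ.msgs b → b.view = σ.view → σ.view ∈ σ.nullified →
      Micro i t σ { σ with parent := b, view := σ.view + 1, entered := t }
  | blockVote (σ b) : P.InBlocks σ.msgs b → b.view = σ.view → σ.view ∉ σ.nullified →
      Micro i t σ { LState.disseminate i {.vote2 b i}
          { σ with voted2 := insert σ.view σ.voted2 } with
        parent := b, view := σ.view + 1, entered := t }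
  | timeout (σ) : σ.view ∉ σ.nullified → P.TimeoutReady t σ →
      (¬ ∃ b, P.InBlocks σ.msgs b ∧ b.view = σ.view) →
      (σ.view ∈ σ.voted1 ∨ ¬ ∃ b c path, P.Votable σ.msgs σ.view i b c path) →
      Micro i t σ (LState.disseminate i
        {m | ∃ u, σ.view ≤ u ∧ P.superview u = P.superview σ.view ∧ m = .nullify u i}
        { σ with
          nullified := σ.nullified ∪ {u | σ.view ≤ u ∧ P.superview u = P.superview σ.view} })
  | nCert (σ) : P.HasCertN σ.msgs σ.view →
      Micro i t σ { σ with view := σ.view + 1, entered := t }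
  | timer (σ) : Micro i t σ (P.timerStep t σ)
  | recovery (σ) : Micro i t σ (P.recoveryStep i t σ)
  | echo (σ) : Micro i t σ (P.echoStep i σ)

theorem le_timerStep (σ : LState n D Tx) : Le σ (P.timerStep t σ) := by
  refine ⟨subset_rfl, subset_rfl, le_rfl, subset_rfl, subset_rfl, subset_rfl, subset_rfl, ?_⟩
  intro b e h
  simp [timerStep, h]

variable {P} in
theorem Micro.le {σ σ' : LState n D Tx} (h : P.Micro i t σ σ') : Le σ σ' := by
  cases h with
  | cert => exact LState.le_disseminate _ _ _
  | propose v a l =>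
    refine Le.trans ?_ (LState.le_send _ _ _)
    exact ⟨subset_rfl, subset_rfl, le_rfl, subset_rfl, subset_rfl, subset_rfl,
      Set.subset_insert _ _, fun _ _ h => h⟩
  | vote b c path =>
    refine Le.trans ?_ (LState.le_disseminate _ _ _)
    exact ⟨subset_rfl, subset_rfl, le_rfl, subset_rfl, Set.subset_insert _ _, subset_rfl,
      subset_rfl, fun _ _ h => h⟩
  | blockNull b =>
    exact ⟨subset_rfl, subset_rfl, Nat.le_succ _, subset_rfl, subset_rfl, subset_rfl, subset_rfl,
      fun _ _ h => h⟩
  | blockVote b =>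
    exact ⟨Set.subset_union_left, Set.subset_union_left, Nat.le_succ _, subset_rfl, subset_rfl,
      Set.subset_insert _ _, subset_rfl, fun _ _ h => h⟩
  | timeout =>
    refine Le.trans ?_ (LState.le_disseminate _ _ _)
    exact ⟨subset_rfl, subset_rfl, le_rfl, Set.subset_union_left, subset_rfl, subset_rfl,
      subset_rfl, fun _ _ h => h⟩
  | nCert =>
    exact ⟨subset_rfl, subset_rfl, Nat.le_succ _, subset_rfl, subset_rfl, subset_rfl, subset_rfl,
      fun _ _ h => h⟩
  | timer => exact P.le_timerStep _
  | recovery => exact LState.le_send _ _ _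
  | echo => exact LState.le_disseminate _ _ _

/-- Finitely many instructions. -/
abbrev Micros (i : Fin n) (t : ℕ) : LState n D Tx → LState n D Tx → Prop :=
  Relation.ReflTransGen (P.Micro i t)

variable {P} in
theorem Micros.le {σ σ' : LState n D Tx} (h : P.Micros i t σ σ') : Le σ σ' := by
  induction h with
  | refl => exact .refl _
  | tail _ h ih => exact ih.trans h.le

theorem ProposeStep.micros {σ σ' : LState n D Tx} (h : P.ProposeStep i t σ σ') :
    P.Micros i t σ σ' := by
  rcases h with ⟨hl, v, a, l, hr, hp, b, rfl, rfl⟩ | ⟨-, rfl⟩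
  · exact .single (.propose σ v a l hl hr hp)
  · exact .refl

theorem VoteStep.micros {σ σ' : LState n D Tx} (h : P.VoteStep i σ σ') : P.Micros i t σ σ' := by
  rcases h with ⟨hv, b, c, path, hb, rfl⟩ | ⟨-, rfl⟩
  · exact .single (.vote σ b c path hv hb)
  · exact .refl

theorem BlockStep.micros {σ σ' : LState n D Tx} (h : P.BlockStep i t σ σ') :
    P.Micros i t σ σ' := by
  rcases h with ⟨b, hb, hv, rfl⟩ | ⟨-, rfl⟩
  · split_ifs with hn
    · exact .single (.blockNull σ b hb hv hn)
    · exact .single (.blockVote σ b hb hv hn)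
  · exact .refl

/-- At the time-out instruction, the two preceding instructions have been executed. -/
theorem timeoutStep_micros {σ₁ σ₂ σ₃ : LState n D Tx} (hΔ : 1 ≤ P.Δ) (h₂ : P.VoteStep i σ₁ σ₂)
    (h₃ : P.BlockStep i t σ₂ σ₃) : P.Micros i t σ₃ (P.timeoutStep i t σ₃) := by
  unfold timeoutStep
  split_ifs with h
  · have he : σ₃.entered ≠ t := by
      rintro e
      have := h.2
      simp only [TimeoutReady, e, Nat.sub_self] at this
      omega
    rcases h₃ with ⟨b, hb, hv, rfl⟩ | ⟨hb, rfl⟩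
    · exact absurd rfl he
    · refine .single (.timeout _ h.1 h.2 hb ?_)
      rcases h₂ with ⟨-, b, c, path, -, rfl⟩ | ⟨hv, rfl⟩
      · left
        exact Set.mem_insert _ _
      · by_contra! hc
        exact hv hc
  · exact .refl

theorem Pass.micros {σ σ' : LState n D Tx} (hΔ : 1 ≤ P.Δ) (h : P.Pass i t σ σ') :
    P.Micros i t σ σ' := by
  obtain ⟨σ₁, σ₂, σ₃, h₁, h₂, h₃, rfl⟩ := h
  refine .trans (.single (.cert σ)) <| .trans (h₁.micros P) <| .trans (h₂.micros P) <|
    .trans (h₃.micros P) <| .trans (P.timeoutStep_micros hΔ h₂ h₃) ?_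
  refine .trans ?_ <| .trans (.single (.timer _)) <| .trans (.single (.recovery _))
    (.single (.echo _))
  unfold nCertStep
  split_ifs with h
  · exact .single (.nCert _ h)
  · exact .refl

theorem Run.micros {σ σ' : LState n D Tx} (hΔ : 1 ≤ P.Δ) (h : P.Run i t σ σ') :
    P.Micros i t σ σ' := by
  have := h.1
  clear h
  induction this with
  | refl => exact .refl
  | tail _ h ih => exact ih.trans (h.micros P hΔ)

/-! ### States in which no instruction has an effect -/

/-- No instruction has an effect any more. -/
structure Stable (i : Fin n) (t : ℕ) (σ : LState n D Tx) : Prop where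
  certN : ∀ v, P.HasCertN σ.msgs v → ∀ k, (k, .certN v) ∈ σ.sent
  cert1 : ∀ b, P.HasCert1 σ.msgs b → ∀ k, (k, .cert1 b) ∈ σ.sent
  certM : ∀ b, P.HasCertM σ.msgs b → ∀ k, (k, .certM b) ∈ σ.sent
  proposed : P.IsLeader i σ.view → ¬ P.FirstProposal σ
  voted1 : ∀ b c path, P.Votable σ.msgs σ.view i b c path → σ.view ∈ σ.voted1
  noBlock : ∀ b, P.InBlocks σ.msgs b → b.view ≠ σ.view
  timeout : P.TimeoutReady t σ → σ.view ∈ σ.nullified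
  noCertN : ¬ P.HasCertN σ.msgs σ.view
  timer : ∀ b, b ≠ P.genesis → P.InDiamond σ.msgs b → ∃ e, σ.timer b = some e
  recovery : ∀ b C, σ.timer b = some t → ¬ P.InDagger σ.msgs b → P.Recovers σ.msgs b C →
    ∀ k, (k, P.recFragOf b C k) ∈ σ.sent ∨
      ∃ c m, P.IsRecFrag b k c m ∧ ((k, m) ∈ σ.sent ∨ (some k, m) ∈ σ.S)
  echo : ∀ m ∈ σ.msgs, ∀ b c, P.WellFormed b → (P.IsFrag b i c m ∨ P.IsRecFrag b i c m) →
    ¬ P.IsLeader i b.view → P.HasCert1 σ.msgs b → ∀ k, (k, m) ∈ σ.sent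

theorem eq_of_le_timerStep {σ : LState n D Tx} (h : Le (P.timerStep t σ) σ) :
    P.timerStep t σ = σ := by
  have : (P.timerStep t σ).timer = σ.timer := by
    funext b
    rcases hb : (P.timerStep t σ).timer b with _ | e
    · symm
      by_contra hc
      obtain ⟨e, he⟩ := Option.ne_none_iff_exists'.1 hc
      have := (P.le_timerStep (t := t) σ).timer b e he
      rw [hb] at this
      simp at this
    · exact (h.timer b e hb).symm
  calc P.timerStep t σ = { σ with timer := (P.timerStep t σ).timer } := rfl
    _ = σ := by rw [this]

/-- In a pass from `σ` to `σ`, every intermediate state lies between `σ` and `σ` in the order `Le`.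
So each instruction separately is idle, and its guard fails or its effect is already present. -/
theorem stable_of_pass {σ : LState n D Tx} (hΔ : 1 ≤ P.Δ) (h : P.Pass i t σ σ) :
    P.Stable i t σ := by
  obtain ⟨σ₁, σ₂, σ₃, h₁, h₂, h₃, e⟩ := h
  have l₁ := (h₁.micros P).le
  have l₂ := (h₂.micros P (t := t)).le
  have l₃ := (h₃.micros P).le
  have l₄ := (P.timeoutStep_micros hΔ h₂ h₃).le
  set σ₄ := P.timeoutStep i t σ₃ with e₄
  have l₅ : Le σ₄ (P.nCertStep t σ₄) := by
    unfold nCertStep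
    split_ifs with hN
    · exact (Micro.nCert (i := i) σ₄ hN).le
    · exact .refl _
  set σ₅ := P.nCertStep t σ₄ with e₅
  have l₆ : Le σ₅ (P.timerStep t σ₅) := P.le_timerStep _
  set σ₆ := P.timerStep t σ₅ with e₆
  have l₇ : Le σ₆ (P.recoveryStep i t σ₆) := LState.le_send _ _ _
  set σ₇ := P.recoveryStep i t σ₆ with e₇
  have l₈ : Le σ₇ σ := e ▸ LState.le_disseminate _ _ _
  have m₇ := l₈
  have m₆ := l₇.trans m₇
  have m₅ := l₆.trans m₆
  have m₄ := l₅.trans m₅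
  have m₃ := l₄.trans m₄
  have m₂ := l₃.trans m₃
  have m₁ := l₂.trans m₂
  have m₀ := l₁.trans m₁
  have c₀ : P.certStep i σ = σ := LState.eq_of_send_le m₀
  have hsent : ∀ m, ((∃ v, m = .certN v ∧ P.HasCertN σ.msgs v) ∨
      (∃ b, m = .cert1 b ∧ P.HasCert1 σ.msgs b) ∨ (∃ b, m = .certM b ∧ P.HasCertM σ.msgs b)) →
      ∀ k, (k, m) ∈ σ.sent := fun m hm k => LState.sent_of_send_le m₀ hm
  rw [c₀] at h₁
  have c₁ : σ₁ = σ ∧ ¬ (P.IsLeader i σ.view ∧ ∃ v a, P.ProposeReady i t σ v a) := by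
    rcases h₁ with ⟨hl, v, a, l, hr, hp, b, rfl, rfl⟩ | ⟨h, rfl⟩
    · exfalso
      -- The new proposal would already be in `σ.proposed`. This contradicts either the absence of
      -- proposals in the superview or the maximality of `a.view`.
      have hb := m₁.proposed (Set.mem_insert _ _)
      rcases hr with ⟨hf, rfl, rfl⟩ | ⟨-, -, rfl, -, hv, -, hmax⟩
      · exact hf.2 _ hb rfl
      · have := hmax _ hb hv
        simp [mkBlock] at this
    · exact ⟨rfl, h⟩
  obtain ⟨rfl, hprop⟩ := c₁
  have c₂ : σ₂ = σ₁ ∧ ¬ (σ₁.view ∉ σ₁.voted1 ∧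
      ∃ b c path, P.Votable σ₁.msgs σ₁.view i b c path) := by
    rcases h₂ with ⟨hv, b, c, path, hb, rfl⟩ | ⟨h, rfl⟩
    · exact absurd (m₂.voted1 (Set.mem_insert _ _)) hv
    · exact ⟨rfl, h⟩
  obtain ⟨rfl, hvote⟩ := c₂
  have c₃ : σ₃ = σ₂ ∧ ¬ ∃ b, P.InBlocks σ₂.msgs b ∧ b.view = σ₂.view := by
    rcases h₃ with ⟨b, hb, hv, rfl⟩ | ⟨h, rfl⟩
    · have := m₃.view
      simp at this
    · exact ⟨rfl, h⟩
  obtain ⟨rfl, hblock⟩ := c₃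
  have c₄ : σ₄ = σ₃ ∧ ¬ (σ₃.view ∉ σ₃.nullified ∧ P.TimeoutReady t σ₃) := by
    have m₄' := m₄
    rw [e₄] at m₄' ⊢
    unfold timeoutStep at m₄' ⊢
    split_ifs at m₄' ⊢ with hT
    · exact absurd (m₄'.nullified (.inr ⟨le_rfl, rfl⟩)) hT.1
    · exact ⟨rfl, hT⟩
  obtain ⟨c₄, htime⟩ := c₄
  rw [c₄] at e₅
  have c₅ : σ₅ = σ₃ ∧ ¬ P.HasCertN σ₃.msgs σ₃.view := by
    have m₅' := m₅
    rw [e₅] at m₅' ⊢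
    unfold nCertStep at m₅' ⊢
    split_ifs at m₅' ⊢ with hN
    · have := m₅'.view
      simp at this
    · exact ⟨rfl, hN⟩
  obtain ⟨c₅, hN⟩ := c₅
  rw [c₅] at e₆
  have c₆ : σ₆ = σ₃ := by
    rw [e₆]
    rw [e₆] at m₆
    exact P.eq_of_le_timerStep m₆
  rw [c₆] at e₇ e₆
  have m₇' := m₇
  rw [e₇] at m₇'
  have c₇ : σ₇ = σ₃ := e₇.trans (LState.eq_of_send_le m₇')
  rw [c₇] at e
  have m₈ : Le (P.echoStep i σ₃) σ₃ := e ▸ .refl _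
  refine ⟨fun v hv k => hsent _ (.inl ⟨v, rfl, hv⟩) k,
    fun b hb k => hsent _ (.inr (.inl ⟨b, rfl, hb⟩)) k,
    fun b hb k => hsent _ (.inr (.inr ⟨b, rfl, hb⟩)) k,
    fun hl hf => hprop ⟨hl, _, _, .inl ⟨hf, rfl, rfl⟩⟩, ?_,
    fun b hb hv => hblock ⟨b, hb, hv⟩, ?_, hN, ?_, ?_, ?_⟩
  · intro b c path hb
    by_contra hv
    exact hvote ⟨hv, b, c, path, hb⟩
  · intro hT
    by_contra hv
    exact htime ⟨hv, hT⟩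
  · intro b hb hd
    by_contra! hc
    have h₀ : σ₃.timer b = none := by
      by_contra h
      obtain ⟨e, he⟩ := Option.ne_none_iff_exists'.1 h
      exact hc e he
    have := congrArg (fun σ => σ.timer b) e₆
    simp [timerStep, hb, hd, h₀] at this
  · intro b C hb hd hr k
    by_cases hk : ∃ c m, P.IsRecFrag b k c m ∧ ((k, m) ∈ σ₃.sent ∨ (some k, m) ∈ σ₃.S)
    · exact .inr hk
    · exact .inl (LState.sent_of_send_le m₇' ⟨b, C, hb, hd, hr, hk, rfl⟩)
  · intro m hm b c hw hf hl hc k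
    refine LState.sent_of_send_le m₈ ?_
    exact ⟨hm, b, c, hw, hf, hl, hc⟩

/-! ### What an instruction can add to the local state -/

/-- The reasons for which processor `i` in the local state `σ` may send a message to `k`, moving on
to the local state `σ'`. -/
inductive Reason (i : Fin n) (σ σ' : LState n D Tx) (k : Fin n) : Msg n D Tx → Prop
  | certN (v) : P.HasCertN σ.msgs v → Reason i σ σ' k (.certN v)
  | cert1 (b) : P.HasCert1 σ.msgs b → Reason i σ σ' k (.cert1 b)
  | certM (b) : P.HasCertM σ.msgs b → Reason i σ σ' k (.certM b)
  | vote1 (b c path) : σ.view ∉ σ.voted1 → P.Votable σ.msgs σ.view i b c path →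
      σ.view ∈ σ'.voted1 → Reason i σ σ' k (.vote1 b i)
  | vote2 (b) : P.InBlocks σ.msgs b → b.view = σ.view → σ.view ∈ σ'.voted2 →
      Reason i σ σ' k (.vote2 b i)
  | nullify (u) : u ∈ σ'.nullified → Reason i σ σ' k (.nullify u i)
  | ownFrag (b c path) : .frag b i c path ∈ σ.msgs → Reason i σ σ' k (.frag b i c path)
  | ownRecFrag (b c path) : .recFrag b i c path ∈ σ.msgs → Reason i σ σ' k (.recFrag b i c path)
  | propFrag (b C c path) : (b, C) ∈ σ'.proposed → Reason i σ σ' k (.frag b k c path)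
  | recovFrag (b c path) : σ.timer b ≠ none → Reason i σ σ' k (.frag b k c path)
  | recovRecFrag (b c path) : σ.timer b ≠ none → Reason i σ σ' k (.recFrag b k c path)

variable {P}

theorem Micro.new_sent {σ σ' : LState n D Tx} (h : P.Micro i t σ σ') {k : Fin n}
    {m : Msg n D Tx} (hm : (k, m) ∈ σ'.sent) : (k, m) ∈ σ.sent ∨ P.Reason i σ σ' k m := by
  cases h with
  | cert =>
    rcases hm with hm | ⟨v, rfl, hm⟩ | ⟨b, rfl, hm⟩ | ⟨b, rfl, hm⟩
    · exact .inl hm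
    · exact .inr (.certN v hm)
    · exact .inr (.cert1 b hm)
    · exact .inr (.certM b hm)
  | propose v a l hl hr hp =>
    rcases hm with hm | hm
    · exact .inl hm
    · obtain rfl : m = P.fragOf _ _ k := hm
      exact .inr (.propFrag _ (P.ser l) _ _ (Set.mem_insert _ _))
  | vote b c path hv hb =>
    rcases hm with hm | rfl | ⟨-, rfl⟩
    · exact .inl hm
    · exact .inr (.vote1 b c path hv hb (Set.mem_insert _ _))
    · exact .inr (.ownFrag b c path hb.2.2.1)
  | blockNull b => exact .inl hm
  | blockVote b hb hv hn =>
    rcases hm with hm | rfl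
    · exact .inl hm
    · exact .inr (.vote2 b hb hv (Set.mem_insert _ _))
  | timeout hv hT hb hvote =>
    rcases hm with hm | ⟨u, h₁, h₂, rfl⟩
    · exact .inl hm
    · exact .inr (.nullify u (.inr ⟨h₁, h₂⟩))
  | nCert => exact .inl hm
  | timer => exact .inl hm
  | recovery =>
    rcases hm with hm | ⟨b, C, hb, -, -, -, hm⟩
    · exact .inl hm
    · right
      obtain rfl : m = P.recFragOf b C k := hm
      unfold recFragOf
      split_ifs
      · exact .recovFrag b _ _ (by simp [hb])
      · exact .recovRecFrag b _ _ (by simp [hb])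
  | echo =>
    rcases hm with hm | ⟨hm, b, c, -, hf, -⟩
    · exact .inl hm
    · right
      rcases hf with ⟨path, rfl, -⟩ | ⟨-, path, rfl, -⟩ | ⟨-, path, rfl, -⟩
      · exact .ownFrag b c path hm
      · exact .ownFrag b c path hm
      · exact .ownRecFrag b c path hm

theorem Micro.new_S {σ σ' : LState n D Tx} (h : P.Micro i t σ σ') {q : Option (Fin n)}
    {m : Msg n D Tx} (hm : (q, m) ∈ σ'.S) :
    (q, m) ∈ σ.S ∨ (q = some i ∧ (i, m) ∈ σ'.sent) := by
  cases h with
  | cert | propose | vote | blockVote | timeout | recovery | echo =>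
    rcases hm with hm | ⟨rfl, hm⟩
    · exact .inl hm
    · exact .inr ⟨rfl, .inr hm⟩
  | blockNull | nCert | timer => exact .inl hm

theorem Micro.self_receipt {σ σ' : LState n D Tx} (h : P.Micro i t σ σ') {m : Msg n D Tx}
    (hm : (i, m) ∈ σ'.sent) : (i, m) ∈ σ.sent ∨ (some i, m) ∈ σ'.S := by
  cases h with
  | cert | propose | vote | blockVote | timeout | recovery | echo =>
    rcases hm with hm | hm
    · exact .inl hm
    · exact .inr (.inr ⟨rfl, hm⟩)
  | blockNull | nCert | timer => exact .inl hm

theorem Micro.new_msgs {σ σ' : LState n D Tx} (h : P.Micro i t σ σ') {m : Msg n D Tx}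
    (hm : m ∈ σ'.msgs) : m ∈ σ.msgs ∨ (i, m) ∈ σ'.sent := by
  obtain ⟨q, hq⟩ := hm
  rcases h.new_S hq with hq | ⟨-, hq⟩
  · exact .inl ⟨q, hq⟩
  · exact .inr hq

end Protocol

end Carnot

/-! ### Executions and their invariants -/

namespace Carnot

open LState (Le)

namespace Protocol

variable {n : ℕ} {D Tx : Type*} {P : Protocol n D Tx} {i : Fin n} {t : ℕ}

/-! ### New components of the local state -/

/-- Needed in `vote1_unique` for two votes that arise in the same instruction; votes from different
instructions are separated by `voted1`. -/
theorem Micro.new_vote1_eq {σ σ' : LState n D Tx} (h : P.Micro i t σ σ') {k k' : Fin n}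
    {b b' : Block D} {q q' : Fin n} (hm : (k, .vote1 b q) ∈ σ'.sent) (hn : (k, .vote1 b q) ∉ σ.sent)
    (hm' : (k', .vote1 b' q') ∈ σ'.sent) (hn' : (k', .vote1 b' q') ∉ σ.sent) : b = b' := by
  cases h with
  | vote b₀ c path hv hb =>
    rcases hm with hm | hm | ⟨-, hm⟩
    · exact absurd hm hn
    · rcases hm' with hm' | hm' | ⟨-, hm'⟩
      · exact absurd hm' hn'
      · simp only [Msg.vote1.injEq] at hm hm'
        exact hm.1.trans hm'.1.symm
      · simp at hm'
    · simp at hm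
  | cert =>
    rcases hm with hm | ⟨v, hm, -⟩ | ⟨b, hm, -⟩ | ⟨b, hm, -⟩
    · exact absurd hm hn
    all_goals simp at hm
  | propose v a l =>
    rcases hm with hm | hm
    · exact absurd hm hn
    · simp [fragOf] at hm
  | blockVote b =>
    rcases hm with hm | hm
    · exact absurd hm hn
    · simp at hm
  | timeout =>
    rcases hm with hm | ⟨u, -, -, hm⟩
    · exact absurd hm hn
    · simp at hm
  | recovery =>
    rcases hm with hm | ⟨b, C, -, -, -, -, hm⟩
    · exact absurd hm hn
    · simp only [recFragOf, fragOf] at hm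
      split_ifs at hm
  | echo =>
    rcases hm with hm | ⟨-, b, c, -, hf, -⟩
    · exact absurd hm hn
    · rcases hf with ⟨path, hf, -⟩ | ⟨-, path, hf, -⟩ | ⟨-, path, hf, -⟩ <;> simp at hf
  | blockNull | nCert | timer => exact absurd hm hn

theorem Micro.new_voted1 {σ σ' : LState n D Tx} (h : P.Micro i t σ σ') {u : ℕ}
    (hu : u ∈ σ'.voted1) : u ∈ σ.voted1 ∨ ∃ b, b.view = u ∧ (∀ k, (k, .vote1 b i) ∈ σ'.sent) ∧
      (¬ P.IsLeader i u → ∃ c path, P.CertifiedAt b.tag i c path ∧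
        ∀ k, (k, .frag b i c path) ∈ σ'.sent) := by
  cases h with
  | vote b c path hv hb =>
    rcases hu with rfl | hu
    · exact .inr ⟨b, hb.2.1, fun k => .inr (.inl rfl), fun hl => ⟨c, path, hb.2.2.2.1,
        fun k => .inr (.inr ⟨hl, rfl⟩)⟩⟩
    · exact .inl hu
  | _ => exact .inl hu

theorem Micro.new_voted2 {σ σ' : LState n D Tx} (h : P.Micro i t σ σ') {u : ℕ}
    (hu : u ∈ σ'.voted2) :
    u ∈ σ.voted2 ∨ (u = σ.view ∧ σ'.view = σ.view + 1 ∧ u ∉ σ'.nullified) := by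
  cases h with
  | blockVote b hb hv hn =>
    rcases hu with rfl | hu
    · exact .inr ⟨rfl, rfl, hn⟩
    · exact .inl hu
  | _ => exact .inl hu

/-- The situation in which processor `i` nullifies the views from `σ.view` on. -/
structure NullifyReady (P : Protocol n D Tx) (i : Fin n) (t : ℕ) (σ : LState n D Tx) : Prop where
  timeout : P.TimeoutReady t σ
  noBlock : ∀ b, P.InBlocks σ.msgs b → b.view ≠ σ.view
  voted1 : ∀ b c path, P.Votable σ.msgs σ.view i b c path → σ.view ∈ σ.voted1

theorem Micro.new_nullified {σ σ' : LState n D Tx} (h : P.Micro i t σ σ') {u : ℕ}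
    (hu : u ∈ σ'.nullified) : u ∈ σ.nullified ∨ (σ.view ≤ u ∧
      P.superview u = P.superview σ.view ∧ P.NullifyReady i t σ ∧
      ∀ k, (k, .nullify u i) ∈ σ'.sent) := by
  cases h with
  | timeout hn hT hb hv =>
    rcases hu with hu | ⟨h₁, h₂⟩
    · exact .inl hu
    · refine .inr ⟨h₁, h₂, ⟨hT, fun b hb₁ hb₂ => hb ⟨b, hb₁, hb₂⟩, ?_⟩,
        fun k => .inr ⟨u, h₁, h₂, rfl⟩⟩
      intro b c path hbv
      exact hv.resolve_right fun h => h ⟨b, c, path, hbv⟩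
  | _ => exact .inl hu

theorem Micro.new_view {σ σ' : LState n D Tx} (h : P.Micro i t σ σ') :
    (σ'.view = σ.view ∧ σ'.parent = σ.parent ∧ σ'.entered = σ.entered) ∨
    (σ'.view = σ.view + 1 ∧ σ'.entered = t ∧
      ((P.InBlocks σ.msgs σ'.parent ∧ σ'.parent.view = σ.view ∧
        (σ.view ∈ σ.nullified ∨ ∀ k, (k, .vote2 σ'.parent i) ∈ σ'.sent)) ∨
       (P.HasCertN σ.msgs σ.view ∧ σ'.parent = σ.parent))) := by
  cases h with
  | blockNull b hb hv hn => exact .inr ⟨rfl, rfl, .inl ⟨hb, hv, .inl hn⟩⟩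
  | blockVote b hb hv hn => exact .inr ⟨rfl, rfl, .inl ⟨hb, hv, .inr fun k => .inr rfl⟩⟩
  | nCert h => exact .inr ⟨rfl, rfl, .inr ⟨h, rfl⟩⟩
  | _ => exact .inl ⟨rfl, rfl, rfl⟩

theorem Micro.new_proposed {σ σ' : LState n D Tx} (h : P.Micro i t σ σ') {p : Block D × List Bool}
    (hp : p ∈ σ'.proposed) : p ∈ σ.proposed ∨ ((∃ v a l, P.IsLeader i σ.view ∧
      P.ProposeReady i t σ v a ∧ P.IsPayload σ a l ∧
      p = (P.mkBlock v a (P.ser l) (P.g σ.S v), P.ser l)) ∧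
      (∀ k, (k, P.fragOf p.1 p.2 k) ∈ σ'.sent) ∧ ∀ p' ∈ σ'.proposed, p' = p ∨ p' ∈ σ.proposed) := by
  cases h with
  | propose v a l hl hr hpl =>
    rcases hp with rfl | hp
    · exact .inr ⟨⟨v, a, l, hl, hr, hpl, rfl⟩, fun k => .inr rfl, fun p' hp' => hp'⟩
    · exact .inl hp
  | _ => exact .inl hp

theorem Micro.new_timer {σ σ' : LState n D Tx} (h : P.Micro i t σ σ') {b : Block D} {e : ℕ}
    (he : σ'.timer b = some e) : σ.timer b = some e ∨
      (e = t + P.s ∧ b ≠ P.genesis ∧ P.InDiamond σ.msgs b) := by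
  cases h with
  | timer =>
    simp only [timerStep] at he
    split_ifs at he with hc
    · exact .inr ⟨by simpa using he.symm, hc.1, hc.2.1⟩
    · exact .inl he
  | _ => exact .inl he

/-! ### Superviews and leaders -/

theorem superview_lt (hx : 0 < P.x) {u v : ℕ} (hu : 1 ≤ u) (h : u < v) (hv : P.IsInitial v) :
    P.superview u < P.superview v := by
  unfold superview
  have h₁ : (v - 1) / P.x * P.x = v - 1 := Nat.div_mul_cancel (Nat.dvd_of_mod_eq_zero hv)
  have : (u - 1) / P.x < (v - 1) / P.x := by
    rw [Nat.div_lt_iff_lt_mul hx, h₁]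
    omega
  omega

/-- A time-out nullifies the present and later views of a superview. As an initial view comes first
in its superview, it is nullified only by processors that are in it. -/
theorem eq_of_superview_eq (hx : 0 < P.x) {u v : ℕ} (hu : 1 ≤ u) (h : u ≤ v) (hv : P.IsInitial v)
    (e : P.superview v = P.superview u) : u = v := by
  rcases h.eq_or_lt with h | h
  · exact h
  · exact absurd e (superview_lt hx hu h hv).ne'

theorem initial_eq_of_superview_eq (hx : 0 < P.x) {u v : ℕ} (hu : 1 ≤ u) (hv : 1 ≤ v)
    (hu' : P.IsInitial u) (hv' : P.IsInitial v) (e : P.superview u = P.superview v) : u = v := by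
  rcases le_total u v with h | h
  · exact eq_of_superview_eq hx hu h hv' e.symm
  · exact (eq_of_superview_eq hx hv h hu' e).symm

theorem IsLeader.unique {j : Fin n} {v : ℕ} (h : P.IsLeader i v) (h' : P.IsLeader j v) : i = j :=
  Fin.ext (Eq.trans h (Eq.symm h'))

/-! ### Messages mentioning a block -/

variable {M : Set (Msg n D Tx)} {b : Block D}

theorem exists_mem_of_ncard_pos {α : Type*} {p : α → Prop} {k : ℕ} (hk : 1 ≤ k)
    (h : k ≤ {a | p a}.ncard) : ∃ a, p a :=
  Set.nonempty_of_ncard_ne_zero (s := {a | p a}) (by omega)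

/-- A quorum is nonempty, so a certificate always exhibits a message that carries the block; to this
message unforgeability of the leader's signature applies. -/
theorem HasCert1.mention (hn : 3 * P.f + 1 ≤ n) (h : P.HasCert1 M b) :
    ∃ m ∈ M, m.block? = some b := by
  rcases h with h | h
  · exact ⟨_, h, rfl⟩
  · obtain ⟨j, hj⟩ := exists_mem_of_ncard_pos (by omega) h
    exact ⟨_, hj, rfl⟩

theorem HasCertM.mention (h : P.HasCertM M b) : ∃ m ∈ M, m.block? = some b := by
  rcases h with h | h
  · exact ⟨_, h, rfl⟩
  · obtain ⟨j, hj⟩ := exists_mem_of_ncard_pos (by omega) h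
    exact ⟨_, hj, rfl⟩

theorem HasCert2.mention (hn : 3 * P.f + 1 ≤ n) (h : P.HasCert2 M b) :
    ∃ m ∈ M, m.block? = some b := by
  rcases h with h | h
  · exact ⟨_, h, rfl⟩
  · obtain ⟨j, hj⟩ := exists_mem_of_ncard_pos (by omega) h
    exact ⟨_, hj, rfl⟩

theorem InBlocks.cases (h : P.InBlocks M b) : b = P.genesis ∨ (P.WellFormed b ∧
    (P.HasCertM M b ∨ (P.HasCert1 M b ∧ ∃ C, P.Recovers M b C)) ∧
    ∃ b', P.InBlocks M b' ∧ P.IsParent b' b) := by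
  cases h with
  | genesis => exact .inl rfl
  | step b b' hw hc hb hp => exact .inr ⟨hw, hc, b', hb, hp⟩

theorem InBlocks.mention (hn : 3 * P.f + 1 ≤ n) (h : P.InBlocks M b) :
    b = P.genesis ∨ ∃ m ∈ M, m.block? = some b :=
  h.cases.imp_right fun h => h.2.1.elim HasCertM.mention fun h => h.1.mention hn

end Protocol

/-! ### Executions -/

namespace Trace

variable {n : ℕ} {D Tx : Type*} (P : Protocol n D Tx) (E : Trace n D Tx)

/-- The local state of `i` before timeslot `t`. -/
def prev (i : Fin n) : ℕ → LState n D Tx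
  | 0 => P.init (E.start i)
  | t + 1 => E.st t i

/-- The local state of `i` at timeslot `t`, after it has received the messages of this timeslot. -/
def inb (i : Fin n) (t : ℕ) : LState n D Tx :=
  { E.prev P i t with S := (E.prev P i t).S ∪ E.recv t i }

/-- `i` is in the local state `σ` at some point of timeslot `t`. -/
def At (i : Fin n) (t : ℕ) (σ : LState n D Tx) : Prop :=
  (t < E.start i ∧ E.st t i = E.inb P i t ∧ σ = E.inb P i t) ∨
  (E.start i ≤ t ∧ P.Micros i t (E.inb P i t) σ ∧ P.Micros i t σ (E.st t i))

variable {P E}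

theorem IsExecution.one_le_Δ (hE : E.IsExecution P) : 1 ≤ P.Δ := hE.delay_pos.trans hE.delay_le

variable {i j : Fin n} {t : ℕ} {σ : LState n D Tx}

theorem At.le_st (h : E.At P i t σ) : Le σ (E.st t i) := by
  rcases h with ⟨-, h, rfl⟩ | ⟨-, -, h⟩
  · exact h ▸ .refl _
  · exact h.le

theorem At.inb_le (h : E.At P i t σ) : Le (E.inb P i t) σ := by
  rcases h with ⟨-, -, rfl⟩ | ⟨-, h, -⟩
  · exact .refl _
  · exact h.le

theorem prev_le_inb : Le (E.prev P i t) (E.inb P i t) :=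
  ⟨Set.subset_union_left, subset_rfl, le_rfl, subset_rfl, subset_rfl, subset_rfl, subset_rfl,
    fun _ _ h => h⟩

theorem recv_subset_inb : E.recv t i ⊆ (E.inb P i t).S := Set.subset_union_right

namespace IsExecution

variable (hE : E.IsExecution P) (hi : i ∈ E.correct)
include hE hi

theorem slotStep (t : ℕ) :
    P.SlotStep i (E.start i) t (E.recv t i) (E.prev P i t) (E.st t i) := by
  cases t with
  | zero => exact hE.step_zero i hi
  | succ t => exact hE.step_succ i hi t

theorem at_st (t : ℕ) : E.At P i t (E.st t i) := by
  rcases hE.slotStep hi t with ⟨h, e⟩ | ⟨h, hr⟩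
  · exact .inl ⟨h, e, e⟩
  · exact .inr ⟨h, hr.micros P hE.one_le_Δ, .refl⟩

theorem at_inb (t : ℕ) : E.At P i t (E.inb P i t) := by
  rcases hE.slotStep hi t with ⟨h, e⟩ | ⟨h, hr⟩
  · exact .inl ⟨h, e, rfl⟩
  · exact .inr ⟨h, .refl, hr.micros P hE.one_le_Δ⟩

theorem stable (h : E.start i ≤ t) : P.Stable i t (E.st t i) := by
  rcases hE.slotStep hi t with ⟨h', -⟩ | ⟨-, hr⟩
  · omega
  · exact P.stable_of_pass hE.one_le_Δ hr.2

theorem inb_le_st : Le (E.inb P i t) (E.st t i) := (hE.at_inb hi t).le_st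

theorem st_le_st {t t' : ℕ} (h : t ≤ t') : Le (E.st t i) (E.st t' i) := by
  induction h with
  | refl => exact .refl _
  | step _ ih => exact ih.trans ((prev_le_inb (P := P) (t := _ + 1)).trans (hE.inb_le_st hi))

theorem st_le_inb {t t' : ℕ} (h : t < t') : Le (E.st t i) (E.inb P i t') := by
  cases t' with
  | zero => omega
  | succ t' => exact (hE.st_le_st hi (Nat.lt_succ_iff.1 h)).trans (prev_le_inb (t := t' + 1))

theorem inb_le_inb {t t' : ℕ} (h : t ≤ t') : Le (E.inb P i t) (E.inb P i t') := by
  rcases h.eq_or_lt with rfl | h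
  · exact .refl _
  · exact (hE.inb_le_st hi).trans (hE.st_le_inb hi h)

/-- Properties which hold at the beginning, and are preserved by the passing of time, by the receipt
of messages and by every instruction, hold all the time. -/
theorem invariant {Q : ℕ → LState n D Tx → Prop} (h₀ : Q 0 (P.init (E.start i)))
    (hsucc : ∀ t σ, Q t σ → Q (t + 1) σ)
    (hrecv : ∀ t σ, Q t σ → Q t { σ with S := σ.S ∪ E.recv t i })
    (hmicro : ∀ t σ σ', E.start i ≤ t → E.At P i t σ → E.At P i t σ' → P.Micro i t σ σ' →
      Q t σ → Q t σ') : ∀ {t σ}, E.At P i t σ → Q t σ := by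
  have key : ∀ t, Q t (E.inb P i t) → ∀ σ, E.At P i t σ → Q t σ := by
    intro t h σ hσ
    rcases hσ with ⟨-, -, rfl⟩ | ⟨hs, h₁, h₂⟩
    · exact h
    · induction h₁ with
      | refl => exact h
      | tail h₁ hm ih =>
        -- The state before the instruction also leads to the end of the timeslot, as `At` demands.
        have h₂' := Relation.ReflTransGen.head hm h₂
        exact hmicro t _ _ hs (.inr ⟨hs, h₁, h₂'⟩) (.inr ⟨hs, h₁.tail hm, h₂⟩) hm (ih h₂')
  have all : ∀ t, Q t (E.inb P i t) := by
    intro t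
    induction t with
    | zero => exact hrecv 0 _ h₀
    | succ t ih => exact hrecv _ _ (hsucc _ _ (key t ih _ (hE.at_st hi t)))
  exact fun {t σ} h => key t (all t) σ h

/-! ### Invariants -/

theorem self_receipt (h : E.At P i t σ) : ∀ m, (i, m) ∈ σ.sent → (some i, m) ∈ σ.S := by
  refine hE.invariant hi (Q := fun _ σ => ∀ m, (i, m) ∈ σ.sent → (some i, m) ∈ σ.S)
    ?_ (fun _ _ h => h) ?_ ?_ h
  · intro m hm
    exact hm.elim
  · exact fun t σ h m hm => .inl (h m hm)
  · intro t σ σ' _ _ _ hM h m hm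
    rcases hM.self_receipt hm with hm | hm
    · exact hM.le.S (h m hm)
    · exact hm

theorem source (h : E.At P i t σ) : ∀ q m, (q, m) ∈ σ.S →
    (q = some i ∧ (i, m) ∈ σ.sent) ∨ ∃ t' ≤ t, (q, m) ∈ E.recv t' i := by
  refine hE.invariant hi (Q := fun t σ => ∀ q m, (q, m) ∈ σ.S →
    (q = some i ∧ (i, m) ∈ σ.sent) ∨ ∃ t' ≤ t, (q, m) ∈ E.recv t' i) ?_ ?_ ?_ ?_ h
  · intro q m hm
    exact hm.elim
  · intro t σ h q m hm
    exact (h q m hm).imp_right fun ⟨t', ht', hm⟩ => ⟨t', by omega, hm⟩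
  · intro t σ h q m hm
    rcases hm with hm | hm
    · exact h q m hm
    · exact .inr ⟨t, le_rfl, hm⟩
  · intro t σ σ' _ _ _ hM h q m hm
    rcases hM.new_S hm with hm | hm
    · exact (h q m hm).imp_left fun ⟨h₁, h₂⟩ => ⟨h₁, hM.le.sent h₂⟩
    · exact .inl hm

theorem one_le_view (h : E.At P i t σ) : 1 ≤ σ.view := by
  refine hE.invariant hi (Q := fun _ σ => 1 ≤ σ.view) le_rfl (fun _ _ h => h) (fun _ _ h => h) ?_ h
  intro t σ σ' _ _ _ hM h
  exact h.trans hM.le.view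

/-- Invariants for sent messages are preserved by receiving messages and by instructions that do not
send anything new. -/
theorem sent_invariant {R : ℕ → LState n D Tx → Fin n → Msg n D Tx → Prop}
    (hmono : ∀ t t' σ σ' k m, t ≤ t' → Le σ σ' → R t σ k m → R t' σ' k m)
    (hnew : ∀ t σ σ' k m, E.start i ≤ t → E.At P i t σ → E.At P i t σ' → P.Micro i t σ σ' →
      (k, m) ∈ σ'.sent → (∀ k m, (k, m) ∈ σ.sent → R t σ k m) → P.Reason i σ σ' k m → R t σ' k m)
    (h : E.At P i t σ) : ∀ k m, (k, m) ∈ σ.sent → R t σ k m := by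
  refine hE.invariant hi (Q := fun t σ => ∀ k m, (k, m) ∈ σ.sent → R t σ k m) ?_ ?_ ?_ ?_ h
  · intro k m hm
    exact hm.elim
  · intro t σ h k m hm
    exact hmono t _ σ σ k m (Nat.le_succ t) (.refl _) (h k m hm)
  · intro t σ h k m hm
    refine hmono t t σ _ k m le_rfl ?_ (h k m hm)
    exact ⟨Set.subset_union_left, subset_rfl, le_rfl, subset_rfl, subset_rfl, subset_rfl,
      subset_rfl, fun _ _ h => h⟩
  · intro t σ σ' hs h₁ h₂ hM h k m hm
    rcases hM.new_sent hm with hm' | hr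
    · exact hmono t t σ σ' k m le_rfl hM.le (h k m hm')
    · exact hnew t σ σ' k m hs h₁ h₂ hM hm h hr

theorem sent_vote1 (h : E.At P i t σ) {k : Fin n} {b : Block D} {q : Fin n}
    (hm : (k, .vote1 b q) ∈ σ.sent) : q = i ∧ b.view ∈ σ.voted1 ∧
      ∃ c path, P.Votable σ.msgs b.view i b c path := by
  refine hE.sent_invariant hi (R := fun _ σ _ m => ∀ b q, m = .vote1 b q → q = i ∧
    b.view ∈ σ.voted1 ∧ ∃ c path, P.Votable σ.msgs b.view i b c path) ?_ ?_ h _ _ hm _ _ rfl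
  · rintro t t' σ σ' k m - hl h b q rfl
    obtain ⟨h₁, h₂, c, path, h₃⟩ := h b q rfl
    exact ⟨h₁, hl.voted1 h₂, c, path, h₃.mono P hl.msgs⟩
  · rintro t σ σ' k m - - - hM hm - hr b q rfl
    cases hr with
    | vote1 _ c path _ hb hv =>
      have e := hb.2.1
      exact ⟨rfl, e ▸ hv, c, path, e ▸ hb.mono P hM.le.msgs⟩

/-- A vote puts its view into `voted1`, and the vote instruction acts only in views outside
`voted1`. -/
theorem vote1_unique (h : E.At P i t σ) : ∀ {k k' : Fin n} {b b' : Block D},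
    (k, .vote1 b i) ∈ σ.sent → (k', .vote1 b' i) ∈ σ.sent → b.view = b'.view → b = b' := by
  refine hE.invariant hi (Q := fun t σ => ∀ {k k' : Fin n} {b b' : Block D},
    (k, .vote1 b i) ∈ σ.sent → (k', .vote1 b' i) ∈ σ.sent → b.view = b'.view → b = b')
    ?_ (fun _ _ h => h) (fun _ _ h => h) ?_ h
  · intro k k' b b' hm
    exact hm.elim
  · intro t σ σ' hs h₁ h₂ hM h k k' b b' hm hm' e
    by_cases ho : (k, .vote1 b i) ∈ σ.sent <;> by_cases ho' : (k', .vote1 b' i) ∈ σ.sent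
    · exact h ho ho' e
    · exfalso
      cases (hM.new_sent hm').resolve_left ho' with
      | vote1 _ c path hv hb =>
        exact hv (hb.2.1 ▸ e ▸ (hE.sent_vote1 hi h₁ ho).2.1)
    · exfalso
      cases (hM.new_sent hm).resolve_left ho with
      | vote1 _ c path hv hb =>
        exact hv (hb.2.1 ▸ e.symm ▸ (hE.sent_vote1 hi h₁ ho').2.1)
    · exact hM.new_vote1_eq hm ho hm' ho'

theorem voted1_sent (h : E.At P i t σ) : ∀ u ∈ σ.voted1, ∃ b : Block D, b.view = u ∧
    (∀ k, (k, Msg.vote1 b i) ∈ σ.sent) ∧ (¬ P.IsLeader i u → ∃ c path,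
      P.CertifiedAt b.tag i c path ∧ ∀ k, (k, Msg.frag b i c path) ∈ σ.sent) := by
  refine hE.invariant hi (Q := fun _ σ => ∀ u ∈ σ.voted1, ∃ b : Block D, b.view = u ∧
    (∀ k, (k, Msg.vote1 b i) ∈ σ.sent) ∧ (¬ P.IsLeader i u → ∃ c path,
      P.CertifiedAt b.tag i c path ∧ ∀ k, (k, Msg.frag b i c path) ∈ σ.sent))
    ?_ (fun _ _ h => h) (fun _ _ h => h) ?_ h
  · intro u hu
    exact hu.elim
  · intro t σ σ' _ _ _ hM h u hu
    rcases hM.new_voted1 hu with hu | hu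
    · obtain ⟨b, h₁, h₂, h₃⟩ := h u hu
      refine ⟨b, h₁, fun k => hM.le.sent (h₂ k), fun hl => ?_⟩
      obtain ⟨c, path, hc, hs⟩ := h₃ hl
      exact ⟨c, path, hc, fun k => hM.le.sent (hs k)⟩
    · exact hu

/-- A stage-2 vote is sent on leaving a view that was not nullified, and later nullifications
concern only the then present view and larger ones. This makes stage-2 certificates and
N-certificates incompatible. -/
theorem voted2_spec (h : E.At P i t σ) : ∀ u ∈ σ.voted2, u < σ.view ∧ u ∉ σ.nullified := by
  refine hE.invariant hi (Q := fun _ σ => ∀ u ∈ σ.voted2, u < σ.view ∧ u ∉ σ.nullified)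
    ?_ (fun _ _ h => h) (fun _ _ h => h) ?_ h
  · intro u hu
    exact hu.elim
  · intro t σ σ' _ _ _ hM h u hu
    rcases hM.new_voted2 hu with hu | ⟨rfl, hv, hn⟩
    · refine ⟨(h u hu).1.trans_le hM.le.view, fun hc => ?_⟩
      rcases hM.new_nullified hc with hc | hc
      · exact (h u hu).2 hc
      · have := (h u hu).1
        omega
    · exact ⟨by omega, hn⟩

theorem sent_vote2 (h : E.At P i t σ) {k : Fin n} {b : Block D} {q : Fin n}
    (hm : (k, .vote2 b q) ∈ σ.sent) : q = i ∧ b.view ∈ σ.voted2 := by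
  refine hE.sent_invariant hi (R := fun _ σ _ m => ∀ b q, m = .vote2 b q → q = i ∧
    b.view ∈ σ.voted2) ?_ ?_ h _ _ hm _ _ rfl
  · rintro t t' σ σ' k m - hl h b q rfl
    exact ⟨(h b q rfl).1, hl.voted2 (h b q rfl).2⟩
  · rintro t σ σ' k m - - - hM hm - hr b q rfl
    cases hr with
    | vote2 _ _ e hv => exact ⟨rfl, e ▸ hv⟩

theorem sent_nullify (h : E.At P i t σ) {k : Fin n} {u : ℕ} {q : Fin n}
    (hm : (k, .nullify u q) ∈ σ.sent) : q = i ∧ u ∈ σ.nullified := by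
  refine hE.sent_invariant hi (R := fun _ σ _ m => ∀ u q, m = .nullify u q → q = i ∧
    u ∈ σ.nullified) ?_ ?_ h _ _ hm _ _ rfl
  · rintro t t' σ σ' k m - hl h b q rfl
    exact ⟨(h b q rfl).1, hl.nullified (h b q rfl).2⟩
  · rintro t σ σ' k m - - - hM hm - hr b q rfl
    cases hr with
    | nullify _ hu => exact ⟨rfl, hu⟩

theorem nullified_sent (h : E.At P i t σ) : ∀ u ∈ σ.nullified,
    (∀ k, (k, Msg.nullify u i) ∈ σ.sent) ∧ ∃ t₀ σ₀, t₀ ≤ t ∧ E.start i ≤ t₀ ∧ E.At P i t₀ σ₀ ∧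
      σ₀.view ≤ u ∧ P.superview u = P.superview σ₀.view ∧ P.NullifyReady i t₀ σ₀ := by
  refine hE.invariant hi (Q := fun t σ => ∀ u ∈ σ.nullified,
    (∀ k, (k, Msg.nullify u i) ∈ σ.sent) ∧ ∃ t₀ σ₀, t₀ ≤ t ∧ E.start i ≤ t₀ ∧ E.At P i t₀ σ₀ ∧
      σ₀.view ≤ u ∧ P.superview u = P.superview σ₀.view ∧ P.NullifyReady i t₀ σ₀)
    ?_ ?_ (fun _ _ h => h) ?_ h
  · intro u hu
    exact hu.elim
  · intro t σ h u hu
    obtain ⟨h₁, t₀, σ₀, h₂, h₃⟩ := h u hu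
    exact ⟨h₁, t₀, σ₀, by omega, h₃⟩
  · intro t σ σ' hs hσ _ hM h u hu
    rcases hM.new_nullified hu with hu | ⟨h₁, h₂, h₃, h₄⟩
    · exact ⟨fun k => hM.le.sent ((h u hu).1 k), (h u hu).2⟩
    · exact ⟨h₄, t, σ, le_rfl, hs, hσ, h₁, h₂, h₃⟩

/-- Views are left because of a block or because of an N-certificate. -/
theorem past_views (h : E.At P i t σ) : ∀ u, 1 ≤ u → u < σ.view →
    (∃ b, P.InBlocks σ.msgs b ∧ b.view = u ∧
      (u ∈ σ.nullified ∨ ∀ k, (k, Msg.vote2 b i) ∈ σ.sent)) ∨ P.HasCertN σ.msgs u := by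
  let R : ℕ → LState n D Tx → Prop := fun u σ => (∃ b, P.InBlocks σ.msgs b ∧ b.view = u ∧
      (u ∈ σ.nullified ∨ ∀ k, (k, Msg.vote2 b i) ∈ σ.sent)) ∨ P.HasCertN σ.msgs u
  have hmono : ∀ u σ σ', Le σ σ' → R u σ → R u σ' := by
    rintro u σ σ' hl (⟨b, hb, hv, h⟩ | h)
    · exact .inl ⟨b, hb.mono P hl.msgs, hv,
        h.imp (@hl.nullified u) fun h k => hl.sent (h k)⟩
    · exact .inr (h.mono P hl.msgs)
  refine hE.invariant hi (Q := fun _ σ => ∀ u, 1 ≤ u → u < σ.view → R u σ)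
    ?_ (fun _ _ h => h) ?_ ?_ h
  · intro u h₁ h₂
    simp [Protocol.init] at h₂
    omega
  · intro t σ h u h₁ h₂
    refine hmono u σ _ ?_ (h u h₁ h₂)
    exact ⟨Set.subset_union_left, subset_rfl, le_rfl, subset_rfl, subset_rfl, subset_rfl,
      subset_rfl, fun _ _ h => h⟩
  · intro t σ σ' _ _ _ hM h u h₁ h₂
    by_cases hu : u < σ.view
    · exact hmono u σ σ' hM.le (h u h₁ hu)
    · rcases hM.new_view with ⟨e, -⟩ | ⟨e, -, hc⟩
      · omega
      · obtain rfl : u = σ.view := by omega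
        rcases hc with ⟨hb, hv, hc⟩ | ⟨hc, -⟩
        · exact .inl ⟨_, hb.mono P hM.le.msgs, hv, hc.imp_left (@hM.le.nullified _)⟩
        · exact .inr (hc.mono P hM.le.msgs)

/-- These are the conditions on a parent in `Votable`: a leader which uses `σ.parent` holds all the
evidence that the voters will need. -/
theorem parent_spec (h : E.At P i t σ) : P.InBlocks σ.msgs σ.parent ∧ σ.parent.view < σ.view ∧
    ∀ u, σ.parent.view < u → u < σ.view → P.HasCertN σ.msgs u := by
  refine hE.invariant hi (Q := fun _ σ => P.InBlocks σ.msgs σ.parent ∧ σ.parent.view < σ.view ∧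
    ∀ u, σ.parent.view < u → u < σ.view → P.HasCertN σ.msgs u)
    ?_ (fun _ _ h => h) ?_ ?_ h
  · refine ⟨.genesis, Nat.one_pos, fun u h₁ h₂ => ?_⟩
    simp [Protocol.init, Protocol.genesis] at h₁ h₂
    omega
  · rintro t σ ⟨h₁, h₂, h₃⟩
    have hl : σ.msgs ⊆ LState.msgs { σ with S := σ.S ∪ E.recv t i } :=
      fun m ⟨q, hq⟩ => ⟨q, .inl hq⟩
    exact ⟨h₁.mono P hl, h₂, fun u hu hu' => (h₃ u hu hu').mono P hl⟩
  · rintro t σ σ' - - - hM ⟨h₁, h₂, h₃⟩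
    rcases hM.new_view with ⟨e, e', -⟩ | ⟨e, -, ⟨hb, hv, -⟩ | ⟨hc, e'⟩⟩
    · rw [e, e']
      exact ⟨h₁.mono P hM.le.msgs, h₂, fun u hu hu' => (h₃ u hu hu').mono P hM.le.msgs⟩
    · exact ⟨hb.mono P hM.le.msgs, by omega, fun u hu hu' => by omega⟩
    · rw [e, e']
      refine ⟨h₁.mono P hM.le.msgs, by omega, fun u hu hu' => ?_⟩
      by_cases hu'' : u < σ.view
      · exact (h₃ u hu hu'').mono P hM.le.msgs
      · obtain rfl : u = σ.view := by omega
        exact hc.mono P hM.le.msgs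

/-- By the last clause, the view has been entered by the end of timeslot `σ.entered`, so bounds on
entry times are bounds on timers. The maximum covers states before the start, where `entered` lies
in the future. -/
theorem entered_spec (h : E.At P i t σ) : E.start i ≤ σ.entered ∧
    σ.entered ≤ max t (E.start i) ∧ σ.view ≤ (E.st σ.entered i).view := by
  refine hE.invariant hi (Q := fun t σ => E.start i ≤ σ.entered ∧
    σ.entered ≤ max t (E.start i) ∧ σ.view ≤ (E.st σ.entered i).view)
    ?_ ?_ (fun _ _ h => h) ?_ h
  · exact ⟨le_rfl, le_max_right _ _, hE.one_le_view hi (hE.at_st hi _)⟩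
  · rintro t σ ⟨h₁, h₂, h₃⟩
    exact ⟨h₁, h₂.trans (max_le_max_right _ (Nat.le_succ t)), h₃⟩
  · rintro t σ σ' hs - hσ' hM ⟨h₁, h₂, h₃⟩
    rcases hM.new_view with ⟨e, -, e'⟩ | ⟨-, e, -⟩
    · rw [e, e']
      exact ⟨h₁, h₂, h₃⟩
    · rw [e]
      exact ⟨hs, le_max_left _ _, hσ'.le_st.view⟩

/-- Fragments at `j` go to processor `j`, or are passed on by processor `j`, which then has them. So
in each case `j` gets or has its own fragment, as `own_recFrag` needs. -/
theorem sent_frag (h : E.At P i t σ) {k : Fin n} {b : Block D} {j : Fin n} {c : List Bool}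
    {path : List D} (hm : (k, .frag b j c path) ∈ σ.sent) :
    j = k ∨ (j = i ∧ .frag b j c path ∈ σ.msgs) := by
  refine hE.sent_invariant hi (R := fun _ σ k m => ∀ b j c path, m = .frag b j c path →
    j = k ∨ (j = i ∧ .frag b j c path ∈ σ.msgs)) ?_ ?_ h _ _ hm _ _ _ _ rfl
  · rintro t t' σ σ' k m - hl h b j c path rfl
    exact (h b j c path rfl).imp_right fun h => ⟨h.1, hl.msgs h.2⟩
  · rintro t σ σ' k m - - - hM hm - hr b j c path rfl
    cases hr with
    | ownFrag _ _ _ h => exact .inr ⟨rfl, hM.le.msgs h⟩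
    | propFrag | recovFrag => exact .inl rfl

theorem sent_recFrag (h : E.At P i t σ) {k : Fin n} {b : Block D} {j : Fin n} {c : List Bool}
    {path : List D} (hm : (k, .recFrag b j c path) ∈ σ.sent) :
    j = k ∨ (j = i ∧ .recFrag b j c path ∈ σ.msgs) := by
  refine hE.sent_invariant hi (R := fun _ σ k m => ∀ b j c path, m = .recFrag b j c path →
    j = k ∨ (j = i ∧ .recFrag b j c path ∈ σ.msgs)) ?_ ?_ h _ _ hm _ _ _ _ rfl
  · rintro t t' σ σ' k m - hl h b j c path rfl
    exact (h b j c path rfl).imp_right fun h => ⟨h.1, hl.msgs h.2⟩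
  · rintro t σ σ' k m - - - hM hm - hr b j c path rfl
    cases hr with
    | ownRecFrag _ _ _ h => exact .inr ⟨rfl, hM.le.msgs h⟩
    | recovRecFrag => exact .inl rfl

theorem timer_inDiamond (h : E.At P i t σ) : ∀ b, σ.timer b ≠ none →
    b ≠ P.genesis ∧ P.InDiamond σ.msgs b := by
  refine hE.invariant hi (Q := fun _ σ => ∀ b, σ.timer b ≠ none →
    b ≠ P.genesis ∧ P.InDiamond σ.msgs b) ?_ (fun _ _ h => h) ?_ ?_ h
  · intro b hb
    exact (hb rfl).elim
  · intro t σ h b hb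
    refine ⟨(h b hb).1, (h b hb).2.mono P ?_⟩
    exact fun m ⟨q, hq⟩ => ⟨q, .inl hq⟩
  · intro t σ σ' _ _ _ hM h b hb
    obtain ⟨e, he⟩ := Option.ne_none_iff_exists'.1 hb
    rcases hM.new_timer he with he | ⟨-, h₁, h₂⟩
    · have := h b (by simp [he])
      exact ⟨this.1, this.2.mono P hM.le.msgs⟩
    · exact ⟨h₁, h₂.mono P hM.le.msgs⟩

theorem timer_spec (h : E.At P i t σ) : ∀ b e, σ.timer b = some e → ∃ t₀ ≤ t, E.start i ≤ t₀ ∧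
    e = t₀ + P.s ∧ (E.st t₀ i).timer b = some e := by
  refine hE.invariant hi (Q := fun t σ => ∀ b e, σ.timer b = some e → ∃ t₀ ≤ t, E.start i ≤ t₀ ∧
    e = t₀ + P.s ∧ (E.st t₀ i).timer b = some e) ?_ ?_ (fun _ _ h => h) ?_ h
  · intro b e hb
    simp [Protocol.init] at hb
  · intro t σ h b e he
    obtain ⟨t₀, h₁, h₂⟩ := h b e he
    exact ⟨t₀, by omega, h₂⟩
  · intro t σ σ' hs _ hσ' hM h b e he
    rcases hM.new_timer he with he' | ⟨h₁, -⟩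
    · exact h b e he'
    · exact ⟨t, le_rfl, hs, h₁, hσ'.le_st.timer _ _ he⟩

end IsExecution

end Trace

end Carnot

/-! ### Proposals, quorums and safety -/

namespace Carnot

open LState (Le)

namespace Trace

variable {n : ℕ} {D Tx : Type*} {P : Protocol n D Tx} {E : Trace n D Tx}
variable {i j : Fin n} {t : ℕ} {σ : LState n D Tx}

theorem st_subset_allMsgs (hi : i ∈ E.correct) : (E.st t i).msgs ⊆ E.allMsgs :=
  fun _ hm => .inr ⟨t, i, hi, hm⟩

namespace IsExecution

variable (hE : E.IsExecution P) (hi : i ∈ E.correct)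
include hE hi

/-! ### Proposals -/

/-- The later proposals in a superview have view `a.view + 1` with `a` in the same superview, hence
are not for initial views. So a proposal for an initial view takes its view and its parent from the
local state. -/
theorem proposed_spec (hx : 0 < P.x) (h : E.At P i t σ) : ∀ p ∈ σ.proposed, 1 ≤ p.1.view ∧
    (∀ k, (k, P.fragOf p.1 p.2 k) ∈ σ.sent) ∧ P.IsLeader i p.1.view ∧
    ∃ t₀ σ₀ a l, t₀ ≤ t ∧ E.start i ≤ t₀ ∧ E.At P i t₀ σ₀ ∧
      P.superview p.1.view = P.superview σ₀.view ∧ P.IsPayload σ₀ a l ∧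
      p = (P.mkBlock p.1.view a (P.ser l) (P.g σ₀.S p.1.view), P.ser l) ∧
      (P.IsInitial p.1.view → p.1.view = σ₀.view ∧ a = σ₀.parent) := by
  refine hE.invariant hi (Q := fun t σ => ∀ p ∈ σ.proposed, 1 ≤ p.1.view ∧
    (∀ k, (k, P.fragOf p.1 p.2 k) ∈ σ.sent) ∧ P.IsLeader i p.1.view ∧
    ∃ t₀ σ₀ a l, t₀ ≤ t ∧ E.start i ≤ t₀ ∧ E.At P i t₀ σ₀ ∧
      P.superview p.1.view = P.superview σ₀.view ∧ P.IsPayload σ₀ a l ∧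
      p = (P.mkBlock p.1.view a (P.ser l) (P.g σ₀.S p.1.view), P.ser l) ∧
      (P.IsInitial p.1.view → p.1.view = σ₀.view ∧ a = σ₀.parent)) ?_ ?_ (fun _ _ h => h) ?_ h
  · intro p hp
    exact hp.elim
  · intro t σ h p hp
    obtain ⟨h₁, h₂, h₃, t₀, σ₀, a, l, h₄, h₅⟩ := h p hp
    exact ⟨h₁, h₂, h₃, t₀, σ₀, a, l, by omega, h₅⟩
  · intro t σ σ' hs hσ hσ' hM h p hp
    rcases hM.new_proposed hp with hp | ⟨⟨v, a, l, hl, hr, hpl, rfl⟩, h₂, -⟩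
    · obtain ⟨h₁, h₂, h₃⟩ := h p hp
      exact ⟨h₁, fun k => hM.le.sent (h₂ k), h₃⟩
    · rcases hr with ⟨hf, rfl, rfl⟩ | ⟨-, -, rfl, ha, hv, ⟨C, hC⟩, -⟩
      · exact ⟨hE.one_le_view hi hσ, h₂, hl, t, σ, σ.parent, l, le_rfl, hs, hσ, rfl, hpl, rfl,
          fun _ => ⟨rfl, rfl⟩⟩
      · refine ⟨Nat.succ_le_succ (Nat.zero_le _), h₂, ?_, t, σ, a, l, le_rfl, hs, hσ, hv, hpl, rfl,
          fun hI => ?_⟩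
        · show (i : ℕ) = P.superview (a.view + 1) % n
          rw [hv]
          exact hl
        · have := Protocol.superview_lt hx (h _ hC).1 (Nat.lt_succ_self _) hI
          exact absurd (ha.trans hv.symm) this.ne

/-- Each proposal extends an earlier one in the same superview, except for the first one, which is
for the initial view. -/
theorem proposed_initial (h : E.At P i t σ) : ∀ p ∈ σ.proposed, ∃ p₀ ∈ σ.proposed,
    P.superview p₀.1.view = P.superview p.1.view ∧ P.IsInitial p₀.1.view := by
  refine hE.invariant hi (Q := fun _ σ => ∀ p ∈ σ.proposed, ∃ p₀ ∈ σ.proposed,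
    P.superview p₀.1.view = P.superview p.1.view ∧ P.IsInitial p₀.1.view)
    ?_ (fun _ _ h => h) (fun _ _ h => h) ?_ h
  · intro p hp
    exact hp.elim
  · intro t σ σ' _ _ _ hM h p hp
    rcases hM.new_proposed hp with hp' | ⟨⟨v, a, l, -, hr, -, rfl⟩, -⟩
    · obtain ⟨p₀, hp₀, h₀⟩ := h p hp'
      exact ⟨p₀, hM.le.proposed hp₀, h₀⟩
    · rcases hr with ⟨hf, rfl, rfl⟩ | ⟨-, -, rfl, ha, hv, ⟨C, hC⟩, -⟩
      · exact ⟨_, hp, rfl, hf.1⟩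
      · obtain ⟨p₀, hp₀, h₀, h₁⟩ := h _ hC
        exact ⟨p₀, hM.le.proposed hp₀, h₀.trans (ha.trans hv.symm), h₁⟩

/-- Within a superview the views of successive proposals strictly increase. -/
theorem proposed_unique (h : E.At P i t σ) : ∀ p ∈ σ.proposed, ∀ p' ∈ σ.proposed,
    p.1.view = p'.1.view → p = p' := by
  refine hE.invariant hi (Q := fun _ σ => ∀ p ∈ σ.proposed, ∀ p' ∈ σ.proposed,
    p.1.view = p'.1.view → p = p') ?_ (fun _ _ h => h) (fun _ _ h => h) ?_ h
  · intro p hp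
    exact hp.elim
  · intro t σ σ' _ _ _ hM h
    have key : ∀ p ∈ σ'.proposed, p ∉ σ.proposed → ∀ p' ∈ σ'.proposed,
        p.1.view = p'.1.view → p' = p := by
      intro p hp hn p' hp' e
      obtain ⟨⟨v, a, l, -, hr, -, rfl⟩, -, hu⟩ := (hM.new_proposed hp).resolve_left hn
      refine (hu p' hp').resolve_right fun hp' => ?_
      have e : v = p'.1.view := e
      rcases hr with ⟨hf, rfl, -⟩ | ⟨-, -, rfl, ha, hv, -, hmax⟩
      · exact hf.2 p' hp' (by rw [e])
      · have := hmax p' hp' (by rw [← e, hv])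
        omega
    intro p hp p' hp' e
    by_cases ho : p ∈ σ.proposed
    · by_cases ho' : p' ∈ σ.proposed
      · exact h p ho p' ho' e
      · exact key p' hp' ho' p hp e.symm
    · exact (key p hp ho p' hp' e).symm

/-- Messages mention blocks of correct leaders only if these have been proposed. -/
theorem mention (hn : 3 * P.f + 1 ≤ n) (hx : 0 < P.x) (h : E.At P i t σ) :
    ∀ m ∈ σ.msgs, ∀ b, m.block? = some b → 1 ≤ b.view → ∀ j ∈ E.correct, P.IsLeader j b.view →
      ∃ C, (b, C) ∈ (E.st t j).proposed := by
  refine hE.invariant hi (Q := fun t σ => ∀ m ∈ σ.msgs, ∀ b, m.block? = some b → 1 ≤ b.view →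
    ∀ j ∈ E.correct, P.IsLeader j b.view → ∃ C, (b, C) ∈ (E.st t j).proposed) ?_ ?_ ?_ ?_ h
  · rintro m ⟨q, hq⟩
    exact hq.elim
  · intro t σ h m hm b hb hv j hj hl
    obtain ⟨C, hC⟩ := h m hm b hb hv j hj hl
    exact ⟨C, (hE.st_le_st hj (Nat.le_succ t)).proposed hC⟩
  · rintro t σ h m ⟨q, hq | hq⟩ b hb hv j hj hl
    · exact h m ⟨q, hq⟩ b hb hv j hj hl
    · cases q with
      | none =>
        obtain ⟨tr, rfl⟩ := hE.env t i m hq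
        simp [Msg.block?] at hb
      | some q =>
        obtain ⟨t', ht', C, hC⟩ := (hE.unforged t i q m hq).1 b hb hv j hj hl
        exact ⟨C, (hE.st_le_st hj ht'.le).proposed hC⟩
  · intro t σ σ' _ hσ hσ' hM h m hm b hb hv j hj hl
    by_cases hmo : m ∈ σ.msgs
    · exact h m hmo b hb hv j hj hl
    · have hs := (hM.new_msgs hm).resolve_left hmo
      -- A message produced by `i` mentions a block that `i` has seen mentioned before, or one that
      -- `i` itself proposed; in the latter case `i` is the leader in question.
      have key : (∃ m ∈ σ.msgs, m.block? = some b) → ∃ C, (b, C) ∈ (E.st t j).proposed :=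
        fun ⟨m, hm, hb⟩ => h m hm b hb hv j hj hl
      have key' : σ.timer b ≠ none → ∃ C, (b, C) ∈ (E.st t j).proposed := by
        intro ht
        obtain ⟨h₁, h₂⟩ := hE.timer_inDiamond hi hσ b ht
        exact key ((h₂.resolve_left h₁).2.1.mention hn)
      have hold : (i, m) ∉ σ.sent := fun hc => hmo ⟨_, hE.self_receipt hi hσ m hc⟩
      cases (hM.new_sent hs).resolve_left hold with
      | certN | nullify => simp [Msg.block?] at hb
      | cert1 b' hc =>
        obtain rfl : b' = b := by simpa [Msg.block?] using hb
        exact key (hc.mention hn)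
      | certM b' hc =>
        obtain rfl : b' = b := by simpa [Msg.block?] using hb
        exact key hc.mention
      | vote1 b' c path _ hc =>
        obtain rfl : b' = b := by simpa [Msg.block?] using hb
        exact key ⟨_, hc.2.2.1, rfl⟩
      | vote2 b' hc =>
        obtain rfl : b' = b := by simpa [Msg.block?] using hb
        refine key ((hc.mention hn).resolve_left ?_)
        rintro rfl
        simp [Protocol.genesis] at hv
      | ownFrag | ownRecFrag => exact absurd ‹_› hmo
      | propFrag b' C c path hp =>
        obtain rfl : b' = b := by simpa [Msg.block?] using hb
        have := (hE.proposed_spec hi hx hσ' _ hp).2.2.1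
        obtain rfl := this.unique hl
        exact ⟨C, hσ'.le_st.proposed hp⟩
      | recovFrag b' c path ht =>
        obtain rfl : b' = b := by simpa [Msg.block?] using hb
        exact key' ht
      | recovRecFrag b' c path ht =>
        obtain rfl : b' = b := by simpa [Msg.block?] using hb
        exact key' ht

end IsExecution

/-! ### Messages are supported by enough signatures -/

variable (E) in
/-- The processors that are faulty or have sent their version of the message `m` by the end of
timeslot `t`. -/
def support (m : Fin n → Msg n D Tx) (t : ℕ) : Set (Fin n) :=
  {i | i ∈ E.correct → ∃ k, (k, m i) ∈ (E.st t i).sent}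

variable (P E) in
/-- By the end of timeslot `t`, enough processors have signed what `m` needs. -/
def Supported (t : ℕ) : Msg n D Tx → Prop
  | .vote1 b i => i ∈ E.support (.vote1 b) t
  | .vote2 b i => i ∈ E.support (.vote2 b) t
  | .nullify v i => i ∈ E.support (.nullify v) t
  | .cert1 b => n - P.f ≤ (E.support (.vote1 b) t).ncard
  | .certM b => P.f + 1 ≤ (E.support (.vote2 b) t).ncard
  | .cert2 b => n - P.f ≤ (E.support (.vote2 b) t).ncard
  | .certN v => n - P.f ≤ (E.support (.nullify v) t).ncard
  | _ => True

theorem ncard_mono {A B : Set (Fin n)} (h : A ⊆ B) {k : ℕ} (hk : k ≤ A.ncard) : k ≤ B.ncard :=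
  hk.trans (Set.ncard_le_ncard h (Set.toFinite _))

namespace IsExecution

variable (hE : E.IsExecution P)
include hE

theorem support_mono (m : Fin n → Msg n D Tx) {t t' : ℕ} (h : t ≤ t') :
    E.support m t ⊆ E.support m t' :=
  fun _ hi hc => (hi hc).imp fun _ hk => (hE.st_le_st hc h).sent hk

theorem signers_subset (m : Fin n → Msg n D Tx) (t : ℕ) : E.signers m t ⊆ E.support m t := by
  intro i hi hc
  obtain ⟨t', ht', k, hk⟩ := hi hc
  exact ⟨k, (hE.st_le_st hc ht'.le).sent hk⟩

theorem Supported.mono {t t' : ℕ} (h : t ≤ t') {m : Msg n D Tx} (hm : E.Supported P t m) :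
    E.Supported P t' m := by
  cases m with
  | vote1 | vote2 | nullify => exact hE.support_mono _ h hm
  | cert1 | certM | cert2 | certN => exact ncard_mono (hE.support_mono _ h) hm
  | _ => trivial

theorem supported_of_recv {q : Option (Fin n)} {m : Msg n D Tx} (hm : (q, m) ∈ E.recv t i) :
    E.Supported P t m := by
  cases q with
  | none =>
    obtain ⟨tr, rfl⟩ := hE.env t i m hm
    trivial
  | some q =>
    have := (hE.unforged t i q m hm).2
    cases m with
    | vote1 | vote2 | nullify => exact hE.signers_subset _ _ this
    | cert1 | certM | cert2 | certN => exact ncard_mono (hE.signers_subset _ _) this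
    | _ => trivial

/-- A certificate assembled by a correct processor rests on votes that are supported already; one
that arrives from outside is covered by unforgeability. -/
theorem supported (hi : i ∈ E.correct) (h : E.At P i t σ) : ∀ m ∈ σ.msgs, E.Supported P t m := by
  refine hE.invariant hi (Q := fun t σ => ∀ m ∈ σ.msgs, E.Supported P t m) ?_ ?_ ?_ ?_ h
  · rintro m ⟨q, hq⟩
    exact hq.elim
  · exact fun t σ h m hm => Supported.mono hE (Nat.le_succ t) (h m hm)
  · rintro t σ h m ⟨q, hq | hq⟩
    · exact h m ⟨q, hq⟩
    · exact hE.supported_of_recv hq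
  · intro t σ σ' _ hσ hσ' hM h m hm
    by_cases hmo : m ∈ σ.msgs
    · exact h m hmo
    · have hs := (hM.new_msgs hm).resolve_left hmo
      have hold : (i, m) ∉ σ.sent := fun hc => hmo ⟨_, hE.self_receipt hi hσ m hc⟩
      cases (hM.new_sent hs).resolve_left hold with
      | certN v hc =>
        rcases hc with hc | hc
        · exact absurd hc hmo
        · exact ncard_mono (fun j hj => h _ hj) hc
      | cert1 b hc =>
        rcases hc with hc | hc
        · exact absurd hc hmo
        · exact ncard_mono (fun j hj => h _ hj) hc
      | certM b hc =>
        rcases hc with hc | hc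
        · exact absurd hc hmo
        · exact ncard_mono (fun j hj => h _ hj) hc
      | vote1 | vote2 | nullify => exact fun _ => ⟨i, hσ'.le_st.sent hs⟩
      | _ => trivial

/-- Messages received by anyone are eventually supported. -/
theorem supported_of_mem_allMsgs {m : Msg n D Tx} (hm : m ∈ E.allMsgs) :
    ∃ t, E.Supported P t m := by
  rcases hm with ⟨t, i, q, hq⟩ | ⟨t, i, hi, hm⟩
  · exact ⟨t, hE.supported_of_recv hq⟩
  · exact ⟨t, hE.supported hi (hE.at_st hi t) m hm⟩

end IsExecution

/-! ### Quorums -/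

/-- The intersection has at least `n - 2f ≥ f + 1` members. -/
theorem quorum_inter (hn : 3 * P.f + 1 ≤ n) (hE : E.IsExecution P) {A B : Set (Fin n)}
    (hA : n - P.f ≤ A.ncard) (hB : n - P.f ≤ B.ncard) : ∃ i ∈ E.correct, i ∈ A ∧ i ∈ B := by
  by_contra! h
  have h₁ := Set.ncard_union_add_ncard_inter A B (Set.toFinite _) (Set.toFinite _)
  have h₂ : (A ∪ B).ncard ≤ n := by
    simpa using Set.ncard_le_ncard (Set.subset_univ (A ∪ B)) (Set.toFinite _)
  have h₃ : (A ∩ B).ncard ≤ P.f :=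
    (Set.ncard_le_ncard (fun i hi hc => h i hc hi.1 hi.2) (Set.toFinite _)).trans hE.faulty
  omega

theorem exists_correct (hE : E.IsExecution P) {A : Set (Fin n)} (hA : P.f + 1 ≤ A.ncard) :
    ∃ i ∈ E.correct, i ∈ A := by
  by_contra! h
  have h₃ : A.ncard ≤ P.f :=
    (Set.ncard_le_ncard (fun i hi hc => h i hc hi) (Set.toFinite _)).trans hE.faulty
  omega

theorem IsExecution.ncard_correct (hE : E.IsExecution P) : n - P.f ≤ E.correct.ncard := by
  have h₁ := Set.ncard_add_ncard_compl E.correct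
  have h₂ := hE.faulty
  simp only [Nat.card_eq_fintype_card, Fintype.card_fin] at h₁
  omega

/-! ### Safety -/

variable (P E)

/-- Eventually there is a stage-1 certificate for `b`. -/
def Cert1 (b : Block D) : Prop := ∃ t, n - P.f ≤ (E.support (.vote1 b) t).ncard

/-- Eventually there is a stage-2 certificate for `b`. -/
def Cert2 (b : Block D) : Prop := ∃ t, n - P.f ≤ (E.support (.vote2 b) t).ncard

/-- Eventually there is an N-certificate for `v`. -/
def CertN (v : ℕ) : Prop := ∃ t, n - P.f ≤ (E.support (.nullify v) t).ncard

/-- Eventually there is a stage-1 certificate for `b` and a correct processor recovers its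
payload. -/
def Sound (b : Block D) : Prop := P.WellFormed b ∧ E.Cert1 P b ∧
  ∃ i ∈ E.correct, ∃ t C, P.Recovers (E.st t i).msgs b C

variable {P E}

namespace IsExecution

variable (hE : E.IsExecution P)
include hE

/-- A sequence of messages can be collected at one time. -/
theorem exists_le_ncard_support {A : Set (Fin n)} {m : Fin n → Msg n D Tx} {k : ℕ}
    (hk : k ≤ A.ncard) (h : ∀ i ∈ A, ∃ t, i ∈ E.support m t) :
    ∃ t, k ≤ (E.support m t).ncard := by
  classical
  choose! T hT using h
  refine ⟨Finset.univ.sup T, ncard_mono (fun i hi => ?_) hk⟩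
  exact hE.support_mono m (Finset.le_sup (Finset.mem_univ i)) (hT i hi)

variable {M : Set (Msg n D Tx)} {b : Block D}

theorem cert1_of_subset (hM : M ⊆ E.allMsgs) (h : P.HasCert1 M b) : E.Cert1 P b := by
  rcases h with h | h
  · exact hE.supported_of_mem_allMsgs (hM h)
  · exact hE.exists_le_ncard_support h fun i hi => hE.supported_of_mem_allMsgs (hM hi)

theorem cert2_of_subset (hM : M ⊆ E.allMsgs) (h : P.HasCert2 M b) : E.Cert2 P b := by
  rcases h with h | h
  · exact hE.supported_of_mem_allMsgs (hM h)
  · exact hE.exists_le_ncard_support h fun i hi => hE.supported_of_mem_allMsgs (hM hi)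

theorem certN_at (hi : i ∈ E.correct) (h : E.At P i t σ) {v : ℕ} (hN : P.HasCertN σ.msgs v) :
    n - P.f ≤ (E.support (.nullify v) t).ncard := by
  rcases hN with hN | hN
  · exact hE.supported hi h _ hN
  · exact ncard_mono (fun j hj => hE.supported hi h _ hj) hN

/-- The members of `blocks` of correct processors are sound, as well as the blocks that correct
processors send stage-2 votes for. -/
theorem sound_aux (T : ℕ) : ∀ i ∈ E.correct, ∀ t < T, ∀ σ, E.At P i t σ →
    (∀ b, Msg.certM b ∈ σ.msgs → E.Sound P b) ∧
    (∀ b, ∀ j ∈ E.correct, Msg.vote2 b j ∈ σ.msgs → E.Sound P b) ∧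
    (∀ k b, (k, Msg.vote2 b i) ∈ σ.sent → E.Sound P b) := by
  -- An M-certificate contains a stage-2 vote of a correct processor. If this voter relied on an
  -- M-certificate too, there is an earlier correct vote, and the regress ends at a voter with a
  -- stage-1 certificate and the payload. Induction on `T` treats messages of others, which were
  -- sent in earlier timeslots; `invariant` treats the instructions within a timeslot.
  induction T with
  | zero => exact fun _ _ t ht => absurd ht (Nat.not_lt_zero t)
  | succ T ihT =>
    intro i hi t ht σ hσ
    revert ht
    refine hE.invariant hi (Q := fun t σ => t < T + 1 →
      (∀ b, Msg.certM b ∈ σ.msgs → E.Sound P b) ∧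
      (∀ b, ∀ j ∈ E.correct, Msg.vote2 b j ∈ σ.msgs → E.Sound P b) ∧
      (∀ k b, (k, Msg.vote2 b i) ∈ σ.sent → E.Sound P b)) ?_ ?_ ?_ ?_ hσ
    · refine fun _ => ⟨?_, ?_, ?_⟩
      · rintro b ⟨q, hq⟩
        exact hq.elim
      · rintro b j - ⟨q, hq⟩
        exact hq.elim
      · rintro k b hq
        exact hq.elim
    · exact fun t σ h ht => h (by omega)
    · intro t σ h ht
      obtain ⟨h₁, h₂, h₃⟩ := h ht
      have key : ∀ b, ∀ j ∈ E.correct, E.SentBefore j (.vote2 b j) t → E.Sound P b := by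
        rintro b j hj ⟨t', ht', k, hk⟩
        exact (ihT j hj t' (by omega) _ (hE.at_st hj t')).2.2 k b hk
      refine ⟨?_, ?_, h₃⟩
      · rintro b ⟨q, hq | hq⟩
        · exact h₁ b ⟨q, hq⟩
        · cases q with
          | none =>
            obtain ⟨tr, htr⟩ := hE.env t i _ hq
            simp at htr
          | some q =>
            obtain ⟨j, hj, hjs⟩ := exists_correct hE (hE.unforged t i q _ hq).2
            exact key b j hj (hjs hj)
      · rintro b j hj ⟨q, hq | hq⟩
        · exact h₂ b j hj ⟨q, hq⟩
        · cases q with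
          | none =>
            obtain ⟨tr, htr⟩ := hE.env t i _ hq
            simp at htr
          | some q => exact key b j hj ((hE.unforged t i q _ hq).2 hj)
    · intro t σ σ' _ hσ hσ' hM h ht
      obtain ⟨h₁, h₂, h₃⟩ := h ht
      have hcM : ∀ b, P.HasCertM σ.msgs b → E.Sound P b := by
        rintro b (hb | hb)
        · exact h₁ b hb
        · obtain ⟨j, hj, hjs⟩ := exists_correct hE hb
          exact h₂ b j hj hjs
      have h₃' : ∀ k b, (k, Msg.vote2 b i) ∈ σ'.sent → E.Sound P b := by
        intro k b hk
        rcases hM.new_sent hk with hk | hr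
        · exact h₃ k b hk
        · cases hr with
          | vote2 _ hb hv _ =>
            have hv₁ := hE.one_le_view hi hσ
            rcases hb.cases with rfl | ⟨hw, hc | ⟨hc, C, hC⟩, -⟩
            · simp [Protocol.genesis] at hv
              omega
            · exact hcM b hc
            · have hsub := hσ.le_st.msgs
              exact ⟨hw, hE.cert1_of_subset (hsub.trans (st_subset_allMsgs hi)) hc, i, hi, t, C,
                hC.mono P hsub⟩
      refine ⟨fun b hb => ?_, fun b j hj hb => ?_, h₃'⟩
      · by_cases hmo : Msg.certM b ∈ σ.msgs
        · exact h₁ b hmo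
        · have hs := (hM.new_msgs hb).resolve_left hmo
          have hold : (i, Msg.certM b) ∉ σ.sent :=
            fun hc => hmo ⟨_, hE.self_receipt hi hσ _ hc⟩
          cases (hM.new_sent hs).resolve_left hold with
          | certM _ hc => exact hcM b hc
      · rcases hM.new_msgs hb with hb | hb
        · exact h₂ b j hj hb
        · obtain ⟨rfl, -⟩ := hE.sent_vote2 hi hσ' hb
          exact h₃' _ b hb

theorem sound_of_inBlocks (hi : i ∈ E.correct) (hσ : E.At P i t σ)
    (hb : P.InBlocks σ.msgs b) : b = P.genesis ∨ E.Sound P b := by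
  obtain ⟨h₁, h₂, -⟩ := hE.sound_aux (t + 1) i hi t (Nat.lt_succ_self t) σ hσ
  rcases hb.cases with rfl | ⟨hw, (hc | hc) | ⟨hc, C, hC⟩, -⟩
  · exact .inl rfl
  · exact .inr (h₁ b hc)
  · obtain ⟨j, hj, hjs⟩ := exists_correct hE hc
    exact .inr (h₂ b j hj hjs)
  · have hsub := hσ.le_st.msgs
    exact .inr ⟨hw, hE.cert1_of_subset (hsub.trans (st_subset_allMsgs hi)) hc, i, hi, t, C,
      hC.mono P hsub⟩

theorem sound_of_vote2 (hi : i ∈ E.correct) {k : Fin n}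
    (h : (k, Msg.vote2 b i) ∈ (E.st t i).sent) : E.Sound P b :=
  (hE.sound_aux (t + 1) i hi t (Nat.lt_succ_self t) _ (hE.at_st hi t)).2.2 k b h

theorem sound_of_cert2 (hn : 3 * P.f + 1 ≤ n) (h : E.Cert2 P b) : E.Sound P b := by
  obtain ⟨t, h⟩ := h
  obtain ⟨j, hj, hjs⟩ := exists_correct hE (A := E.support (.vote2 b) t) (by omega)
  obtain ⟨k, hk⟩ := hjs hj
  exact hE.sound_of_vote2 hj hk

/-- There is at most one block with a stage-1 certificate per view. -/
theorem cert1_unique (hn : 3 * P.f + 1 ≤ n) {b' : Block D} (h : E.Cert1 P b) (h' : E.Cert1 P b')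
    (e : b.view = b'.view) : b = b' := by
  obtain ⟨t, h⟩ := h
  obtain ⟨t', h'⟩ := h'
  obtain ⟨j, hj, h₁, h₂⟩ := quorum_inter hn hE h h'
  obtain ⟨k, hk⟩ := hE.support_mono _ (le_max_left t t') h₁ hj
  obtain ⟨k', hk'⟩ := hE.support_mono _ (le_max_right t t') h₂ hj
  exact hE.vote1_unique hj (hE.at_st hj _) hk hk' e

/-- A correct member of both quorums would contradict `voted2_spec`. -/
theorem not_certN_of_cert2 (hn : 3 * P.f + 1 ≤ n) (h : E.Cert2 P b) : ¬ E.CertN P b.view := by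
  rintro ⟨t', h'⟩
  obtain ⟨t, h⟩ := h
  obtain ⟨j, hj, h₁, h₂⟩ := quorum_inter hn hE h h'
  obtain ⟨k, hk⟩ := hE.support_mono _ (le_max_left t t') h₁ hj
  obtain ⟨k', hk'⟩ := hE.support_mono _ (le_max_right t t') h₂ hj
  have a := hE.at_st hj (max t t')
  exact (hE.voted2_spec hj a _ (hE.sent_vote2 hj a hk).2).2 (hE.sent_nullify hj a hk').2

/-- What a stage-1 certificate implies for the parent. -/
theorem exists_parent (hn : 3 * P.f + 1 ≤ n) (h : E.Cert1 P b) : ∃ a, P.IsParent a b ∧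
    a.view < b.view ∧ (a = P.genesis ∨ E.Sound P a) ∧
    ∀ u, a.view < u → u < b.view → E.CertN P u := by
  obtain ⟨t, h⟩ := h
  obtain ⟨j, hj, hjs⟩ := exists_correct hE (A := E.support (.vote1 b) t) (by omega)
  obtain ⟨k, hk⟩ := hjs hj
  obtain ⟨-, -, c, path, -, -, -, -, a, ha, hp, hv, hN⟩ := hE.sent_vote1 hj (hE.at_st hj t) hk
  exact ⟨a, hp, hv, hE.sound_of_inBlocks hj (hE.at_st hj t) ha,
    fun u h₁ h₂ => ⟨t, hE.certN_at hj (hE.at_st hj t) (hN u h₁ h₂)⟩⟩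

/-- Blocks with a stage-2 certificate are ancestors of all later blocks. -/
theorem isAncestor_of_cert2 (hn : 3 * P.f + 1 ≤ n) (h : E.Cert2 P b) :
    ∀ (v : ℕ) (b' : Block D), b'.view = v → E.Cert1 P b' → b.view ≤ b'.view →
      P.IsAncestor b b' := by
  intro v
  induction v using Nat.strong_induction_on with
  | _ v ih =>
    rintro b' rfl h' hv
    have hs := hE.sound_of_cert2 hn h
    rcases hv.eq_or_lt with e | hlt
    · exact hE.cert1_unique hn hs.2.1 h' e ▸ .refl
    · obtain ⟨a, hp, hav, ha, hN⟩ := hE.exists_parent hn h'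
      -- If the view of the parent were smaller than that of `b`, then the view of `b` would be
      -- among the skipped ones, for which there are N-certificates.
      have hle : b.view ≤ a.view := by
        by_contra! hc
        exact hE.not_certN_of_cert2 hn h (hN _ hc hlt)
      have ha' : E.Sound P a := by
        refine ha.resolve_left ?_
        rintro rfl
        have := hs.1.1
        simp [Protocol.genesis] at hle
        omega
      exact (ih a.view hav a rfl ha'.2.1 hle).tail hp

end IsExecution

end Trace

end Carnot

/-! ### Relaying after GST: agreement and progression -/

namespace Carnot

open LState (Le)

namespace Trace

variable {n : ℕ} {D Tx : Type*} {P : Protocol n D Tx} {E : Trace n D Tx}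
variable {i j : Fin n} {t T : ℕ} {σ : LState n D Tx} {b : Block D}

namespace IsExecution

variable (hE : E.IsExecution P)
include hE

/-! ### Delivery -/

/-- The conclusion is about `inb`, the state before the instructions of timeslot `T`: a message that
arrives exactly at a deadline still forestalls the time-out. -/
theorem delivered (hi : i ∈ E.correct) (hj : j ∈ E.correct) {m : Msg n D Tx}
    (hm : (j, m) ∈ (E.st t i).sent) (hT : max t E.GST + E.δ ≤ T) : m ∈ (E.inb P j T).msgs := by
  have hδ := hE.delay_pos
  by_cases e : i = j
  · subst e
    have hs := hE.self_receipt hi (hE.at_st hi t) m hm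
    exact (hE.st_le_inb hi (by omega)).msgs ⟨_, hs⟩
  · obtain ⟨t', ht', hr⟩ := hE.delivery i hi j hj e t m hm
    exact (hE.inb_le_inb hj (by omega)).msgs ⟨_, recv_subset_inb hr⟩

/-- Received messages that need not be sent by the receiver itself have been sent before. -/
theorem sent_of_received (hi : i ∈ E.correct) (hj : j ∈ E.correct) {m : Msg n D Tx}
    (hm : (some j, m) ∈ (E.st t i).S) : (i, m) ∈ (E.st t j).sent := by
  rcases hE.source hi (hE.at_st hi t) _ _ hm with ⟨e, hs⟩ | ⟨t', ht', hr⟩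
  · obtain rfl : j = i := by simpa using e
    exact hs
  · obtain ⟨t'', ht'', hs⟩ := hE.auth t' i j hj m hr
    exact (hE.st_le_st hj (by omega)).sent hs

theorem relay_certN (hi : i ∈ E.correct) (hj : j ∈ E.correct) {v : ℕ}
    (h : P.HasCertN (E.st t i).msgs v) (hT : max t E.GST + E.δ ≤ T) :
    P.HasCertN (E.inb P j T).msgs v := by
  -- The certificate may be received before `i` begins; it is disseminated by the end of timeslot
  -- `max t (E.start i)`, which is at most `max t E.GST`.
  have hs := hE.start_le i hi
  have := (hE.stable hi (le_max_right t (E.start i))).certN v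
    (h.mono P (hE.st_le_st hi (le_max_left _ _)).msgs) j
  exact .inl (hE.delivered hi hj this (by omega))

theorem relay_cert1 (hi : i ∈ E.correct) (hj : j ∈ E.correct)
    (h : P.HasCert1 (E.st t i).msgs b) (hT : max t E.GST + E.δ ≤ T) :
    P.HasCert1 (E.inb P j T).msgs b := by
  have hs := hE.start_le i hi
  have := (hE.stable hi (le_max_right t (E.start i))).cert1 b
    (h.mono P (hE.st_le_st hi (le_max_left _ _)).msgs) j
  exact .inl (hE.delivered hi hj this (by omega))

theorem relay_certM (hi : i ∈ E.correct) (hj : j ∈ E.correct)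
    (h : P.HasCertM (E.st t i).msgs b) (hT : max t E.GST + E.δ ≤ T) :
    P.HasCertM (E.inb P j T).msgs b := by
  have hs := hE.start_le i hi
  have := (hE.stable hi (le_max_right t (E.start i))).certM b
    (h.mono P (hE.st_le_st hi (le_max_left _ _)).msgs) j
  exact .inl (hE.delivered hi hj this (by omega))

/-- A correct processor other than the leader echoes its own fragments. -/
theorem relay_recFrag (hi : i ∈ E.correct) (hj : j ∈ E.correct) {c : List Bool} {m : Msg n D Tx}
    (hm : m ∈ (E.st t i).msgs) (hw : P.WellFormed b) (hf : P.IsRecFrag b i c m)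
    (hl : ¬ P.IsLeader i b.view) (hc : P.HasCert1 (E.st t i).msgs b)
    (hT : max t E.GST + E.δ ≤ T) : m ∈ (E.inb P j T).msgs := by
  have hs := hE.start_le i hi
  have hle := (hE.st_le_st hi (le_max_left t (E.start i))).msgs
  have := (hE.stable hi (le_max_right t (E.start i))).echo m (hle hm) b c hw (.inr hf) hl
    (hc.mono P hle) j
  exact hE.delivered hi hj this (by omega)

/-- If a correct processor has sent or received the recovery fragment of another one, then the other
one has received it. -/
theorem own_recFrag (hi : i ∈ E.correct) (hj : j ∈ E.correct) {c : List Bool} {m : Msg n D Tx}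
    (hf : P.IsRecFrag b j c m) (h : (j, m) ∈ (E.st t i).sent ∨ (some j, m) ∈ (E.st t i).S)
    (hT : max t E.GST + E.δ ≤ T) : m ∈ (E.st T j).msgs := by
  rcases h with h | h
  · exact (hE.inb_le_st hj).msgs (hE.delivered hi hj h hT)
  · have hs := hE.sent_of_received hi hj h
    have hle := (hE.st_le_st hj (show t ≤ T by omega)).msgs
    rcases hf with ⟨-, path, rfl, -⟩ | ⟨-, path, rfl, -⟩
    · rcases hE.sent_frag hj (hE.at_st hj t) hs with rfl | ⟨-, hm⟩
      · exact hle ⟨_, hE.self_receipt hj (hE.at_st hj t) _ hs⟩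
      · exact hle hm
    · rcases hE.sent_recFrag hj (hE.at_st hj t) hs with rfl | ⟨-, hm⟩
      · exact hle ⟨_, hE.self_receipt hj (hE.at_st hj t) _ hs⟩
      · exact hle hm

/-- The correct processors other than the leader of `v`. -/
theorem ncard_correct_diff_leader (v : ℕ) :
    n - P.f - 1 ≤ {j | j ∈ E.correct ∧ ¬ P.IsLeader j v}.ncard := by
  have h₁ := hE.ncard_correct
  by_cases h : ∃ l : Fin n, P.IsLeader l v
  · obtain ⟨l, hl⟩ := h
    have : E.correct \ {l} ⊆ {j | j ∈ E.correct ∧ ¬ P.IsLeader j v} :=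
      fun j ⟨hj, hjl⟩ => ⟨hj, fun hc => hjl (hc.unique hl)⟩
    refine ncard_mono this ?_
    have := Set.pred_ncard_le_ncard_sdiff_singleton E.correct l
    omega
  · have : E.correct ⊆ {j | j ∈ E.correct ∧ ¬ P.IsLeader j v} := fun j hj =>
      ⟨hj, fun hc => h ⟨j, hc⟩⟩
    exact ncard_mono this (by omega)

/-! ### Agreement on blocks -/

/-- When the timer of `b` expires, `i` either has an M-certificate to relay, or sees to it that each
correct processor has its recovery fragment one delay later. Those other than the leader echo it, as
the stage-1 certificate has reached them as well; after a second delay `j` has `n - f - 1`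
fragments. -/
theorem relay_diamond (hn : 3 * P.f + 1 ≤ n) (hn₂ : 2 ≤ n) (hi : i ∈ E.correct)
    (hj : j ∈ E.correct) (hb : b ≠ P.genesis) (hd : P.InDiamond (E.st t i).msgs b)
    (hT : max t E.GST + 2 * E.δ + P.s ≤ T) : P.HasCertM (E.inb P j T).msgs b ∨
      (P.HasCert1 (E.inb P j T).msgs b ∧ ∃ C, P.Recovers (E.inb P j T).msgs b C) := by
  have hs := hE.start_le i hi
  have hδ := hE.delay_pos
  obtain ⟨e, he⟩ := (hE.stable hi (le_max_right t (E.start i))).timer b hb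
    (hd.mono P (hE.st_le_st hi (le_max_left _ _)).msgs)
  obtain ⟨t₀, ht₀, hst, rfl, he⟩ := hE.timer_spec hi (hE.at_st hi _) b e he
  have he' := (hE.st_le_st hi (show t₀ ≤ t₀ + P.s by omega)).timer b _ he
  obtain ⟨hw, hc, ⟨C, hC⟩, b', hb', hp⟩ :=
    ((hE.timer_inDiamond hi (hE.at_st hi (t₀ + P.s)) b (by simp [he'])).2).resolve_left hb
  have hstab := hE.stable hi (show E.start i ≤ t₀ + P.s by omega)
  by_cases hdag : P.InDagger (E.st (t₀ + P.s) i).msgs b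
  · exact .inl (hE.relay_certM hi hj (hdag.resolve_left hb).2.1 (by omega))
  · right
    refine ⟨hE.relay_cert1 hi hj hc (by omega), C, ?_⟩
    refine P.recovers_of_recFrags hn hn₂ hw hC.2.1 hC.2.2 (hE.ncard_correct_diff_leader b.view) ?_
    rintro k ⟨hk, hkl⟩
    have key : ∃ c m, P.IsRecFrag b k c m ∧
        m ∈ (E.st (max (t₀ + P.s) E.GST + E.δ) k).msgs := by
      rcases hstab.recovery b C he' hdag hC k with h | ⟨c, m, hf, h⟩
      · obtain ⟨c, hf⟩ := P.isRecFrag_recFragOf (Tx := Tx) hn hn₂ hC.2.1 hC.2.2 k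
        exact ⟨c, _, hf, hE.own_recFrag hi hk hf (.inl h) le_rfl⟩
      · exact ⟨c, m, hf, hE.own_recFrag hi hk hf h le_rfl⟩
    obtain ⟨c, m, hf, hm⟩ := key
    exact ⟨c, m, hE.relay_recFrag hk hj hm hw hf hkl
      ((hE.relay_cert1 hi hk hc le_rfl).mono P (hE.inb_le_st hk).msgs) (by omega), hf⟩

/-- All ancestors are in `blocks` of `i` at the same time `t`, so they are relayed in parallel and
the bound does not grow with the height of the block. -/
theorem relay_inBlocks (hn : 3 * P.f + 1 ≤ n) (hn₂ : 2 ≤ n) (hi : i ∈ E.correct)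
    (hj : j ∈ E.correct) (hb : P.InBlocks (E.st t i).msgs b)
    (hT : max t E.GST + 2 * E.δ + P.s ≤ T) : P.InBlocks (E.inb P j T).msgs b := by
  induction hb with
  | genesis => exact .genesis
  | step b b' hw hc hb hp ih =>
    refine .step b b' hw ?_ ih hp
    rcases hc with hc | ⟨hc, hr⟩
    · exact .inl (hE.relay_certM hi hj hc (by omega))
    · exact hE.relay_diamond hn hn₂ hi hj (hw.ne_genesis P) (.inr ⟨hw, hc, hr, b', hb, hp⟩) hT

theorem blocksAgreement (hn : 3 * P.f + 1 ≤ n) (hn₂ : 2 ≤ n) : P.BlocksAgreement E :=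
  fun _ hi _ hj _ _ hb =>
    (hE.relay_inBlocks hn hn₂ hi hj hb le_rfl).mono P (hE.inb_le_st hj).msgs

/-! ### Progression -/

/-- Correct processors catch up on views. -/
theorem catch_up (hn : 3 * P.f + 1 ≤ n) (hn₂ : 2 ≤ n) (hi : i ∈ E.correct) (hj : j ∈ E.correct)
    (hT : max t E.GST + 2 * E.δ + P.s ≤ T) : (E.st t i).view ≤ (E.st T j).view := by
  by_contra! hc
  have hle := (hE.inb_le_st (t := T) hj).msgs
  have hs := hE.start_le j hj
  have hstab := hE.stable hj (show E.start j ≤ T by omega)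
  -- What let `i` leave the view in which `j` is stuck has reached `j` by now; but a stable state
  -- has neither a block nor an N-certificate for its own view.
  rcases hE.past_views hi (hE.at_st hi t) _ (hE.one_le_view hj (hE.at_st hj T)) hc with
    ⟨b, hb, hv, -⟩ | hN
  · exact hstab.noBlock b ((hE.relay_inBlocks hn hn₂ hi hj hb hT).mono P hle) hv
  · exact hstab.noCertN ((hE.relay_certN hi hj hN (by omega)).mono P hle)

/-- If no correct processor got beyond `v`, then all would remain in it without a stage-2 vote until
their timers run out, and their nullify messages would form an N-certificate for `v`. -/
theorem view_unbounded (hn : 3 * P.f + 1 ≤ n) (hn₂ : 2 ≤ n) (v : ℕ) :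
    ∀ i ∈ E.correct, ∃ t, v ≤ (E.st t i).view := by
  induction v with
  | zero => exact fun _ _ => ⟨0, Nat.zero_le _⟩
  | succ v ih =>
    suffices ∃ j ∈ E.correct, ∃ t, v < (E.st t j).view by
      obtain ⟨j, hj, t, ht⟩ := this
      exact fun i hi => ⟨_, ht.trans_le (hE.catch_up hn hn₂ hj hi le_rfl)⟩
    by_contra! hc
    have key : ∀ i ∈ E.correct, ∃ t, E.start i ≤ t ∧ v ∈ (E.st t i).nullified := by
      intro i hi
      obtain ⟨t₁, ht₁, hst₁⟩ : ∃ t, v ≤ (E.st t i).view ∧ E.start i ≤ t := by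
        obtain ⟨t, ht⟩ := ih i hi
        exact ⟨max t (E.start i), ht.trans (hE.st_le_st hi (le_max_left _ _)).view,
          le_max_right _ _⟩
      obtain ⟨hst, het, hev⟩ := hE.entered_spec hi (hE.at_st hi t₁)
      set e := (E.st t₁ i).entered with he
      have hview : ∀ t, e ≤ t → (E.st t i).view = v :=
        fun t ht => le_antisymm (hc i hi t) (ht₁.trans (hev.trans (hE.st_le_st hi ht).view))
      -- The timer is reset only together with an increase of the view.
      have hent : ∀ t, e ≤ t → (E.st t i).entered = (E.st e i).entered := by
        intro t ht
        induction t, ht using Nat.le_induction with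
        | base => rfl
        | succ t ht ih' =>
          rcases hE.at_st hi (t + 1) with ⟨h, -⟩ | ⟨-, h, -⟩
          · omega
          · rw [← ih']
            have hv₀ : (E.inb P i (t + 1)).view = v := hview t ht
            have : ∀ σ, P.Micros i (t + 1) (E.inb P i (t + 1)) σ → σ.view = v →
                σ.entered = (E.inb P i (t + 1)).entered := by
              intro σ hσ
              induction hσ with
              | refl => exact fun _ => rfl
              | tail h₁ hM ih'' =>
                intro hv
                have h₁ := Protocol.Micros.le h₁
                rcases hM.new_view with ⟨e, -, e'⟩ | ⟨e, -⟩
                · exact e'.trans (ih'' (e.symm.trans hv))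
                · have := h₁.view
                  omega
            exact this _ h (hview _ (by omega))
      have hee : (E.st e i).entered = e := (hent t₁ (by omega)).symm
      have hnv : ∀ t, e ≤ t → (E.st t i).view ∉ (E.st t i).voted2 := fun t ht h =>
        lt_irrefl _ (hE.voted2_spec hi (hE.at_st hi t) _ h).1
      -- Time-out conditions are equations, so the exact timeslot is used. The larger threshold
      -- applies whether or not a stage-1 vote was sent.
      by_cases hI : P.IsInitial v
      · have ht : e ≤ e + (5 * P.Δ + 2 * P.s) := Nat.le_add_right _ _
        have hv := hview _ ht
        refine ⟨_, hst.trans ht, ?_⟩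
        have := (hE.stable hi (hst.trans ht)).timeout (.inr (.inr (.inr ⟨hv.symm ▸ hI, by
          rw [hent _ ht, hee]; omega, hnv _ ht⟩)))
        rwa [hv] at this
      · have ht : e ≤ e + 3 * P.Δ := Nat.le_add_right _ _
        have hv := hview _ ht
        refine ⟨_, hst.trans ht, ?_⟩
        have := (hE.stable hi (hst.trans ht)).timeout (.inr (.inl ⟨hv.symm ▸ hI, by
          rw [hent _ ht, hee]; omega, hnv _ ht⟩))
        rwa [hv] at this
    have hN : ∃ i ∈ E.correct, ∃ t, v ≤ (E.st t i).view ∧ E.start i ≤ t ∧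
        P.HasCertN (E.st t i).msgs v := by
      classical
      obtain ⟨i, hi, -⟩ := exists_correct hE (A := E.correct)
        (by have := hE.ncard_correct; omega)
      obtain ⟨t₁, ht₁⟩ := ih i hi
      choose! τ hτ hτ' using key
      set T := max (max t₁ (E.start i)) (max (Finset.univ.sup τ) E.GST + E.δ)
      refine ⟨i, hi, T, ht₁.trans (hE.st_le_st hi (by omega)).view, by omega, .inr ?_⟩
      refine ncard_mono (A := E.correct) (fun j hj => ?_) hE.ncard_correct
      have hs := (hE.nullified_sent hj (hE.at_st hj (τ j)) v (hτ' j hj)).1 i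
      have hτj : τ j ≤ Finset.univ.sup τ := Finset.le_sup (Finset.mem_univ j)
      exact (hE.inb_le_st hi).msgs (hE.delivered hj hi hs (by omega))
    obtain ⟨i, hi, t, hv, hs, hN⟩ := hN
    have hv' := le_antisymm (hc i hi t) hv
    exact (hE.stable hi hs).noCertN (hv'.symm ▸ hN)

theorem viewProgression (hn : 3 * P.f + 1 ≤ n) (hn₂ : 2 ≤ n) : E.ViewProgression := by
  intro i hi v _
  obtain ⟨t, ht⟩ := hE.view_unbounded hn hn₂ v i hi
  exact ⟨max t (E.start i), le_max_right _ _, ht.trans (hE.st_le_st hi (le_max_left _ _)).view⟩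

end IsExecution

end Trace

end Carnot

/-! ### Finalisation in initial views with a correct leader -/

namespace Carnot

open LState (Le)

namespace Trace

variable {n : ℕ} {D Tx : Type*} {P : Protocol n D Tx} {E : Trace n D Tx}
variable {i j : Fin n} {t T : ℕ} {σ : LState n D Tx} {b : Block D}

/-! ### Initial views with correct leaders -/

variable (P E) in
/-- The initial view `v` has the correct leader `i`, and the first correct processors enter it at
the timeslot `t₁`, which is not before `GST`. -/
structure SynchronousView (v t₁ : ℕ) (i : Fin n) : Prop where
  pos : 1 ≤ v
  initial : P.IsInitial v
  correct : i ∈ E.correct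
  leader : P.IsLeader i v
  gst_le : E.GST ≤ t₁
  first : ∀ j ∈ E.correct, ∀ t, E.HasEntered j v t → t₁ ≤ t
  entered : ∃ j ∈ E.correct, v ≤ (E.st t₁ j).view

namespace IsExecution

variable (hE : E.IsExecution P)
include hE

theorem exists_nullified (hn : 3 * P.f + 1 ≤ n) (hj : j ∈ E.correct) {v : ℕ}
    (h : P.HasCertN (E.st t j).msgs v) : ∃ k ∈ E.correct, v ∈ (E.st t k).nullified := by
  obtain ⟨k, hk, hks⟩ := exists_correct hE (A := E.support (.nullify v) t)
    (by have := hE.certN_at hj (hE.at_st hj t) h; omega)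
  obtain ⟨q, hq⟩ := hks hk
  exact ⟨k, hk, (hE.sent_nullify hk (hE.at_st hk t) hq).2⟩

variable {v t₁ : ℕ} (hV : E.SynchronousView P v t₁ i)
include hV

theorem entered_ge (hj : j ∈ E.correct) (hσ : E.At P j t σ) (hv : v ≤ σ.view) :
    t₁ ≤ σ.entered := by
  obtain ⟨h₁, -, h₂⟩ := hE.entered_spec hj hσ
  exact hV.first j hj _ ⟨h₁, hv.trans h₂⟩

/-- An initial view is nullified only from within, by a timer that started at `t₁` or later. The
missing stage-1 vote is recorded because `nullified_later` refutes it. -/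
theorem nullified_late (hx : 0 < P.x) (hj : j ∈ E.correct) (h : v ∈ (E.st t j).nullified) :
    ∃ t₀ σ₀, t₀ ≤ t ∧ E.At P j t₀ σ₀ ∧ σ₀.view = v ∧ P.NullifyReady j t₀ σ₀ ∧
      ((t₁ + 4 * P.Δ + 2 * P.s ≤ t₀ ∧ v ∉ σ₀.voted1) ∨ t₁ + 5 * P.Δ + 2 * P.s ≤ t₀) := by
  obtain ⟨-, t₀, σ₀, h₀, -, hσ₀, hle, hsup, hr⟩ := hE.nullified_sent hj (hE.at_st hj t) v h
  obtain hv : σ₀.view = v :=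
    Protocol.eq_of_superview_eq hx (hE.one_le_view hj hσ₀) hle hV.initial hsup
  have hent := hE.entered_ge hV hj hσ₀ hv.ge
  have hΔ := hE.one_le_Δ
  refine ⟨t₀, σ₀, h₀, hσ₀, hv, hr, ?_⟩
  have hI := hV.initial
  rw [← hv] at hI
  rcases hr.timeout with h | h | h | h
  · exact absurd hI h.1
  · exact absurd hI h.1
  · exact .inl ⟨by omega, hv ▸ h.2.2.1⟩
  · exact .inr (by omega)

theorem certN_late (hn : 3 * P.f + 1 ≤ n) (hx : 0 < P.x) (hj : j ∈ E.correct)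
    (h : P.HasCertN (E.st t j).msgs v) : t₁ + 4 * P.Δ + 2 * P.s ≤ t := by
  obtain ⟨k, hk, hkv⟩ := hE.exists_nullified hn hj h
  obtain ⟨t₀, σ₀, h₀, -, -, -, h⟩ := hE.nullified_late hV hx hk hkv
  omega

theorem view_ge (hn : 3 * P.f + 1 ≤ n) (hn₂ : 2 ≤ n) (hj : j ∈ E.correct)
    (hT : t₁ + 2 * E.δ + P.s ≤ T) : v ≤ (E.st T j).view := by
  obtain ⟨k, hk, hkv⟩ := hV.entered
  have := hV.gst_le
  exact hkv.trans (hE.catch_up hn hn₂ hk hj (by omega))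

/-- By timeslot `T` the leader has caught up with the view. If it is still there, stability says
that it has proposed. If it has left, this was because of a block which only the leader can have
signed, as it is too early for an N-certificate. -/
theorem exists_proposed (hn : 3 * P.f + 1 ≤ n) (hn₂ : 2 ≤ n) (hx : 0 < P.x)
    (hT : T = t₁ + 2 * E.δ + P.s) : ∃ b C, (b, C) ∈ (E.st T i).proposed ∧ b.view = v := by
  have hi := hV.correct
  have ha := hE.at_st hi T
  have hδ := hE.delay_pos
  have hδ' := hE.delay_le
  have hG := hV.gst_le
  have hst := hE.start_le i hi
  rcases (hE.view_ge hV hn hn₂ hi hT.ge).eq_or_lt with hv | hv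
  · have := (hE.stable hi (show E.start i ≤ T by omega)).proposed (hv ▸ hV.leader)
    simp only [Protocol.FirstProposal, not_and] at this
    have := this (hv ▸ hV.initial)
    push Not at this
    obtain ⟨p, hp, hs⟩ := this
    obtain ⟨⟨b, C⟩, hb, hbs, hbI⟩ := hE.proposed_initial hi ha p hp
    refine ⟨b, C, hb, ?_⟩
    refine Protocol.initial_eq_of_superview_eq hx (hE.proposed_spec hi hx ha _ hb).1 hV.pos hbI
      hV.initial ?_
    rw [hbs, hs, ← hv]
  · rcases hE.past_views hi ha v hV.pos hv with ⟨b, hb, rfl, -⟩ | hN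
    · have hv := hV.pos
      obtain ⟨m, hm, hmb⟩ := (hb.mention hn).resolve_left (by
        rintro rfl
        simp [Protocol.genesis] at hv)
      obtain ⟨C, hC⟩ := hE.mention hi hn hx ha m hm b hmb hv i hi hV.leader
      exact ⟨b, C, hC, rfl⟩
    · have := hE.certN_late hV hn hx hi hN
      omega

variable {C : List Bool} {tL : ℕ} (hp : (b, C) ∈ (E.st tL i).proposed) (hbv : b.view = v)
include hp hbv

/-- The blocks of the view that occur are proposed by the leader. -/
theorem eq_of_mention (hn : 3 * P.f + 1 ≤ n) (hx : 0 < P.x) (hj : j ∈ E.correct) {b' : Block D}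
    {m : Msg n D Tx} (hm : m ∈ (E.st t j).msgs) (hmb : m.block? = some b') (hv : b'.view = v) :
    b' = b := by
  have hpos := hV.pos
  have hi := hV.correct
  obtain ⟨C', hC'⟩ := hE.mention hj hn hx (hE.at_st hj t) m hm b' hmb (by omega) i hi
    (hv ▸ hV.leader)
  have := hE.proposed_unique hi (hE.at_st hi (max t tL)) _
    ((hE.st_le_st hi (le_max_left _ _)).proposed hC') _
    ((hE.st_le_st hi (le_max_right _ _)).proposed hp) (hv.trans hbv.symm)
  simp only [Prod.mk.injEq] at this
  exact this.1

theorem eq_of_inBlocks (hn : 3 * P.f + 1 ≤ n) (hx : 0 < P.x) (hj : j ∈ E.correct) {b' : Block D}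
    (hb : P.InBlocks (E.st t j).msgs b') (hv : b'.view = v) : b' = b := by
  have hpos := hV.pos
  obtain ⟨m, hm, hmb⟩ := (hb.mention hn).resolve_left (by
    rintro rfl
    simp [Protocol.genesis] at hv
    omega)
  exact hE.eq_of_mention hV hp hbv hn hx hj hm hmb hv

/-- In initial views `g` returns `n - f - 1`, so the two tags coincide and ordinary fragments serve
as recovery fragments. -/
theorem proposal_spec (hx : 0 < P.x) : P.WellFormed b ∧ b.tag.k = n - P.f - 1 ∧
    P.tau C b.tag.k = b.tag ∧ P.tau C (n - P.f - 1) = b.recTag ∧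
    (∀ k, (k, P.fragOf b C k) ∈ (E.st tL i).sent) ∧
    ∃ a, P.InBlocks (E.st tL i).msgs a ∧ P.IsParent a b ∧ a.view < v ∧
      ∀ u, a.view < u → u < v → P.HasCertN (E.st tL i).msgs u := by
  have hi := hV.correct
  obtain ⟨h₁, h₂, h₃, t₀, σ₀, a, l, ht₀, -, hσ₀, -, -, e, hI⟩ :=
    hE.proposed_spec hi hx (hE.at_st hi tL) _ hp
  simp only [Prod.mk.injEq] at e h₁
  obtain ⟨e, rfl⟩ := e
  have hI₀ : P.IsInitial b.view := hbv ▸ hV.initial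
  obtain ⟨hv, rfl⟩ := hI hI₀
  have hg := P.g_initial σ₀.S b.view hI₀
  have hg' := P.g_mem σ₀.S b.view
  obtain ⟨hb, hlt, hN⟩ := hE.parent_spec hi hσ₀
  have hle := (hσ₀.le_st.trans (hE.st_le_st hi ht₀)).msgs
  have htag : b.tag = P.tau (P.ser l) (n - P.f - 1) := by rw [e, ← hg]; rfl
  have hrec : b.recTag = P.tau (P.ser l) (n - P.f - 1) := by rw [e]; rfl
  have hk : b.tag.k = n - P.f - 1 := by rw [htag]; rfl
  have hpar : b.par = some (P.hash (.block σ₀.parent)) := by rw [e]; rfl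
  refine ⟨⟨h₁, by omega, by omega, by rw [hrec]; rfl, by rw [hrec, htag], by simp [hpar]⟩, hk,
    by rw [hk, htag], hrec.symm, h₂, σ₀.parent, hb.mono P hle, hpar, ?_, ?_⟩
  · rw [← hbv]
    exact hv ▸ hlt
  · intro u hu hu'
    exact (hN u hu (by rw [← hbv] at hu'; exact hv ▸ hu')).mono P hle

/-- The leader's block becomes votable for all correct processors. -/
theorem votable (hn : 3 * P.f + 1 ≤ n) (hn₂ : 2 ≤ n) (hx : 0 < P.x) (hj : j ∈ E.correct)
    (hL : E.GST ≤ tL) (hT : tL + 2 * E.δ + P.s ≤ T) : ∃ c path,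
      P.Votable (E.inb P j T).msgs v j b c path ∧ P.IsFrag (Tx := Tx) b j c (.frag b j c path) := by
  have hi := hV.correct
  have hδ := hE.delay_pos
  obtain ⟨hw, hk, h₁, h₂, hs, a, ha, hp, hlt, hN⟩ := hE.proposal_spec hV hp hbv hx
  have hf : P.CertifiedAt b.tag j (P.code.encode b.tag.k C j)
      (P.merklePath (P.code.encode b.tag.k C) j) := by
    have := P.certifiedAt_tau (k := b.tag.k) (by omega) (by omega) C j
    rwa [h₁] at this
  refine ⟨_, _, ⟨hw, hbv, ?_, hf, a, ?_, hp, hlt, fun u hu hu' => ?_⟩, _, rfl, hf⟩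
  · exact hE.delivered hi hj (hs j) (by omega)
  · exact hE.relay_inBlocks hn hn₂ hi hj ha (by omega)
  · exact hE.relay_certN hi hj (hN u hu hu') (by omega)

omit hbv hp in
-- The earlier time-out is ruled out: the leader proposes by `t₁ + 2δ + s`, the block is votable for
-- everyone after another `2δ + s`, and the vote instruction precedes the time-out instruction.
theorem nullified_later (hn : 3 * P.f + 1 ≤ n) (hn₂ : 2 ≤ n) (hx : 0 < P.x)
    (hj : j ∈ E.correct) (h : v ∈ (E.st t j).nullified) : ∃ t₀ σ₀, t₀ ≤ t ∧ E.At P j t₀ σ₀ ∧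
      σ₀.view = v ∧ P.NullifyReady j t₀ σ₀ ∧ t₁ + 5 * P.Δ + 2 * P.s ≤ t₀ := by
  have hδ := hE.delay_le
  have hG := hV.gst_le
  obtain ⟨b, C, hp, hbv⟩ := hE.exists_proposed hV hn hn₂ hx rfl
  obtain ⟨t₀, σ₀, h₀, hσ₀, hv, hr, h⟩ := hE.nullified_late hV hx hj h
  refine ⟨t₀, σ₀, h₀, hσ₀, hv, hr, h.elim (fun ⟨h, hnv⟩ => ?_) id⟩
  obtain ⟨c, path, hvot, -⟩ := hE.votable (T := t₀) hV hp hbv hn hn₂ hx hj (by omega) (by omega)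
  refine absurd (hr.voted1 b c path ?_) (hv.symm ▸ hnv)
  rw [hv]
  exact hvot.mono P hσ₀.inb_le.msgs

/-- The leader's block gets into `blocks` of all correct processors in time. -/
theorem inBlocks_in_time (hn : 3 * P.f + 1 ≤ n) (hn₂ : 2 ≤ n) (hx : 0 < P.x)
    (hL : tL = t₁ + 2 * E.δ + P.s) (hj : j ∈ E.correct) (hT : tL + 3 * E.δ + P.s ≤ T) :
    P.InBlocks (E.inb P j T).msgs b := by
  have hδ := hE.delay_pos
  have hδ' := hE.delay_le
  have hG := hV.gst_le
  obtain ⟨hw, hk, h₁, h₂, -, a, ha, hpar, -, -⟩ := hE.proposal_spec hV hp hbv hx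
  refine .step b a hw ?_ (hE.relay_inBlocks hn hn₂ hV.correct hj ha (by omega)) hpar
  -- At `T₀ = t₁ + 4δ + 2s` each correct processor has voted for `b` or has a certificate for it.
  -- One further delay spreads what is needed, so `b` is in `blocks` by `t₁ + 5δ + 2s`.
  set T₀ := tL + 2 * E.δ + P.s with hT₀
  have cases : ∀ k ∈ E.correct, P.HasCertM (E.st T₀ k).msgs b ∨ P.HasCert1 (E.st T₀ k).msgs b ∨
      ((∀ q, (q, Msg.vote1 b k) ∈ (E.st T₀ k).sent) ∧ (¬ P.IsLeader k v → ∃ c path,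
        P.CertifiedAt b.tag k c path ∧ ∀ q, (q, Msg.frag b k c path) ∈ (E.st T₀ k).sent)) := by
    intro k hk
    have hst := hE.start_le k hk
    have hat := hE.at_st hk T₀
    have hle := (hE.inb_le_st (t := T₀) hk).msgs
    obtain ⟨c, path, hvot, -⟩ := hE.votable (T := T₀) hV hp hbv hn hn₂ hx hk (by omega) le_rfl
    rcases (hE.view_ge (T := T₀) hV hn hn₂ hk (by omega)).eq_or_lt with hv | hv
    · have := (hE.stable hk (show E.start k ≤ T₀ by omega)).voted1 b c path
        (hv ▸ hvot.mono P hle)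
      obtain ⟨b', hb', hs, hf⟩ := hE.voted1_sent hk hat _ this
      rw [← hv] at hb' hf
      obtain rfl : b' = b := hE.eq_of_mention hV hp hbv hn hx hk
        ⟨_, hE.self_receipt hk hat _ (hs k)⟩ rfl hb'
      exact .inr (.inr ⟨hs, hf⟩)
    · rcases hE.past_views hk hat v hV.pos hv with ⟨b', hb', hbv', -⟩ | hN
      · obtain rfl := hE.eq_of_inBlocks hV hp hbv hn hx hk hb' hbv'
        rcases hb'.cases with rfl | ⟨-, hc | ⟨hc, -⟩, -⟩
        · exact absurd rfl (hw.ne_genesis P)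
        · exact .inl hc
        · exact .inr (.inl hc)
      · obtain ⟨q, hq, hqv⟩ := hE.exists_nullified hn hk hN
        obtain ⟨t₀, σ₀, h₀, -, -, -, h⟩ := hE.nullified_later hV hn hn₂ hx hq hqv
        omega
  by_cases hM : ∃ k ∈ E.correct, P.HasCertM (E.st T₀ k).msgs b
  · obtain ⟨k, hk, hM⟩ := hM
    exact .inl (hE.relay_certM hk hj hM (by omega))
  · right
    push Not at hM
    have cases := fun k hk => (cases k hk).resolve_left (hM k hk)
    constructor
    · by_cases hc : ∃ k ∈ E.correct, P.HasCert1 (E.st T₀ k).msgs b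
      · obtain ⟨k, hk, hc⟩ := hc
        exact hE.relay_cert1 hk hj hc (by omega)
      · push Not at hc
        refine .inr (ncard_mono (A := E.correct) (fun k hk => ?_) hE.ncard_correct)
        have := ((cases k hk).resolve_left (hc k hk)).1 j
        exact hE.delivered hk hj this (by omega)
    -- Each correct processor other than the leader has sent its fragment to all, with its vote or
    -- as an echo upon a stage-1 certificate.
    · refine ⟨C, P.recovers_of_recFrags hn hn₂ hw h₁ h₂ (hE.ncard_correct_diff_leader v) ?_⟩
      rintro k ⟨hkc, hkl⟩
      rcases cases k hkc with hc | ⟨-, hf⟩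
      · obtain ⟨c, path, hvot, hf⟩ :=
          hE.votable (T := T₀) hV hp hbv hn hn₂ hx hkc (by omega) le_rfl
        refine ⟨c, _, ?_, .inl ⟨hk, hf⟩⟩
        exact hE.relay_recFrag hkc hj ((hE.inb_le_st hkc).msgs hvot.2.2.1) hw (.inl ⟨hk, hf⟩)
          (hbv ▸ hkl) hc (by omega)
      · obtain ⟨c, path, hc, hs⟩ := hf hkl
        exact ⟨c, _, hE.delivered hkc hj (hs j) (by omega), .inl ⟨hk, path, rfl, hc⟩⟩

omit hbv hp in
-- At the remaining time-out, the leader's block is in `blocks` before the instructions of the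
-- timeslot, and the block instruction precedes the time-out instruction.
theorem not_nullified (hn : 3 * P.f + 1 ≤ n) (hn₂ : 2 ≤ n) (hx : 0 < P.x) (hj : j ∈ E.correct) :
    v ∉ (E.st t j).nullified := by
  intro h
  have hδ := hE.delay_le
  have hG := hV.gst_le
  obtain ⟨b, C, hp, hbv⟩ := hE.exists_proposed hV hn hn₂ hx rfl
  obtain ⟨t₀, σ₀, h₀, hσ₀, hv, hr, ht₀⟩ := hE.nullified_later hV hn hn₂ hx hj h
  have := hE.inBlocks_in_time (T := t₀) hV hp hbv hn hn₂ hx rfl hj (by omega)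
  exact hr.noBlock b (this.mono P hσ₀.inb_le.msgs) (hbv.trans hv.symm)

end IsExecution

theorem IsExecution.exists_synchronousView (hE : E.IsExecution P) (hn : 3 * P.f + 1 ≤ n)
    (hn₂ : 2 ≤ n) {v : ℕ} (hv : 1 ≤ v) (hI : P.IsInitial v) (hi : i ∈ E.correct)
    (hl : P.IsLeader i v) (H : ∀ j ∈ E.correct, ∀ t, E.HasEntered j v t → E.GST ≤ t) :
    ∃ t₁, E.SynchronousView P v t₁ i := by
  classical
  have hex : ∃ t, ∃ j ∈ E.correct, E.HasEntered j v t := by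
    obtain ⟨t, ht⟩ := hE.viewProgression hn hn₂ i hi v hv
    exact ⟨t, i, hi, ht⟩
  obtain ⟨j, hj, hjt⟩ := Nat.find_spec hex
  exact ⟨Nat.find hex, hv, hI, hi, hl, H j hj _ hjt,
    fun k hk t ht => Nat.find_min' hex ⟨k, hk, ht⟩, j, hj, hjt.2⟩

theorem IsExecution.leadersFinalise (hE : E.IsExecution P) (hn : 3 * P.f + 1 ≤ n)
    (hn₂ : 2 ≤ n) (hx : 0 < P.x) : P.LeadersFinalise E := by
  classical
  intro v hv hI i hi hl H
  obtain ⟨t₁, hV⟩ := hE.exists_synchronousView hn hn₂ hv hI hi hl H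
  obtain ⟨b, C, hp, hbv⟩ := hE.exists_proposed hV hn hn₂ hx rfl
  have hnull : ∀ j ∈ E.correct, ∀ t, v ∉ (E.st t j).nullified :=
    fun j hj t => hE.not_nullified hV hn hn₂ hx hj
  refine ⟨⟨b, (hE.proposal_spec hV hp hbv hx).1, hbv, ?_⟩, fun j hj t k hs =>
    hnull j hj t (hE.sent_nullify hj (hE.at_st hj t) hs).2⟩
  -- Every correct processor leaves `v`, and not by an N-certificate, so it does so because of `b`;
  -- as it has not nullified `v`, it sends a stage-2 vote.
  have hvote : ∀ j ∈ E.correct, ∃ t, ∀ k, (k, Msg.vote2 b j) ∈ (E.st t j).sent := by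
    intro j hj
    obtain ⟨t, ht⟩ := hE.view_unbounded hn hn₂ (v + 1) j hj
    refine ⟨t, ?_⟩
    rcases hE.past_views hj (hE.at_st hj t) v hv ht with ⟨b', hb', hbv', h⟩ | hN
    · obtain rfl := hE.eq_of_inBlocks hV hp hbv hn hx hj hb' hbv'
      exact h.resolve_left (hnull j hj t)
    · obtain ⟨k, hk, hkv⟩ := hE.exists_nullified hn hj hN
      exact absurd hkv (hnull k hk t)
  choose! τ hτ using hvote
  refine ⟨max (Finset.univ.sup τ) E.GST + E.δ, fun j hj => .inr ?_⟩
  refine ncard_mono (A := E.correct) (fun k hk => ?_) hE.ncard_correct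
  have hτk : τ k ≤ Finset.univ.sup τ := Finset.le_sup (Finset.mem_univ k)
  exact (hE.inb_le_st hj).msgs (hE.delivered hk hj (hτ k hk j) (by omega))

end Trace

end Carnot

/-! ### Extraction: consistency and liveness -/

namespace Carnot

/-! ### Concatenation -/

theorem flatMap_range_prefix {α : Type*} (l : ℕ → List α) {N N' : ℕ} (h : N ≤ N') :
    (List.range N).flatMap l <+: (List.range N').flatMap l := by
  induction h with
  | refl => exact List.prefix_refl _
  | step _ ih =>
    refine ih.trans ?_
    rw [List.range_succ, List.flatMap_append]
    exact List.prefix_append _ _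

/-- Longer ranges extend shorter ones, so the entry at `m` is independent of `N` once it exists. -/
theorem concat_eq_some_iff {α : Type*} (l : ℕ → List α) (m : ℕ) (a : α) :
    concat l m = some a ↔ ∃ N, ((List.range N).flatMap l)[m]? = some a := by
  have huniq : ∀ a a', (∃ N, ((List.range N).flatMap l)[m]? = some a) →
      (∃ N, ((List.range N).flatMap l)[m]? = some a') → a = a' := by
    rintro a a' ⟨N, h⟩ ⟨N', h'⟩
    have key : ∀ N' ≥ N, ((List.range N').flatMap l)[m]? = some a := by
      intro N' hN'
      obtain ⟨r, e⟩ := flatMap_range_prefix l hN'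
      rw [← e, List.getElem?_append_left (List.getElem?_eq_some_iff.1 h).1, h]
    obtain ⟨r, e⟩ := flatMap_range_prefix l (le_max_right N N')
    have h₁ := key _ (le_max_left N N')
    rw [← e, List.getElem?_append_left (List.getElem?_eq_some_iff.1 h').1, h'] at h₁
    simpa using h₁.symm
  unfold concat
  constructor
  · intro h
    split_ifs at h with hc
    have := hc.choose_spec
    simp only [Option.some.injEq] at h
    rwa [h] at this
  · intro h
    have hc : ∃ a N, ((List.range N).flatMap l)[m]? = some a := ⟨a, h⟩
    rw [dif_pos hc, huniq _ _ hc.choose_spec h]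

theorem isPrefix_concat {α : Type*} {l l' : ℕ → List α}
    (h : ∀ N, ∃ N', (List.range N).flatMap l = (List.range N').flatMap l') :
    IsPrefix (concat l) (concat l') := by
  intro m a hm
  rw [concat_eq_some_iff] at hm ⊢
  obtain ⟨N, hN⟩ := hm
  obtain ⟨N', e⟩ := h N
  exact ⟨N', e ▸ hN⟩

theorem exists_concat_eq_some {α : Type*} {l : ℕ → List α} {a : α} {k : ℕ} (h : a ∈ l k) :
    ∃ m, concat l m = some a := by
  have : a ∈ (List.range (k + 1)).flatMap l :=
    List.mem_flatMap.2 ⟨k, List.mem_range.2 (Nat.lt_succ_self k), h⟩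
  obtain ⟨m, hm⟩ := List.mem_iff_getElem?.1 this
  exact ⟨m, (concat_eq_some_iff l m a).2 ⟨_, hm⟩⟩

namespace Protocol

variable {n : ℕ} {D Tx : Type*} {P : Protocol n D Tx}
variable {M M' : Set (Msg n D Tx)} {c c' : ℕ → Option (Block D)}

/-! ### Chains of blocks -/

variable (P) in
/-- `c` is a sequence of blocks, each the parent of the next, which starts with a child of the
genesis block. -/
structure IsChain (c : ℕ → Option (Block D)) : Prop where
  isSeq : IsSeq c
  first : ∀ b, c 0 = some b → P.IsParent P.genesis b
  parent : ∀ i b b', c i = some b → c (i + 1) = some b' → P.IsParent b b'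

theorem IsFinalChain.isChain (h : P.IsFinalChain M c) : P.IsChain c := ⟨h.1, h.2.1, h.2.2.1⟩

namespace IsChain

variable (h : P.IsChain c)
include h

theorem exists_pred {i : ℕ} {b : Block D} (hb : c (i + 1) = some b) :
    ∃ a, c i = some a ∧ P.IsParent a b := by
  obtain ⟨a, ha⟩ := Option.ne_none_iff_exists'.1 (fun hc => by simp [h.isSeq i hc] at hb :
    c i ≠ none)
  exact ⟨a, ha, h.parent i a b ha hb⟩

theorem exists_of_le {i j : ℕ} (hij : i ≤ j) (hj : c j ≠ none) : c i ≠ none := by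
  induction hij with
  | refl => exact hj
  | step _ ih => exact ih fun hc => hj (h.isSeq _ hc)

theorem ne_genesis {i : ℕ} {b : Block D} (hb : c i = some b) : b ≠ P.genesis := by
  rintro rfl
  cases i with
  | zero => exact P.not_isParent_genesis (h.first _ hb)
  | succ i =>
    obtain ⟨a, -, ha⟩ := h.exists_pred hb
    exact P.not_isParent_genesis ha

/-- Parents are unique and the chain starts at a child of genesis, so walking back from `b` passes
only through the chain before it ends at genesis. -/
theorem ancestor {j : ℕ} : ∀ {a b : Block D}, c j = some b → P.IsAncestor a b →
    a = P.genesis ∨ ∃ k ≤ j, c k = some a := by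
  induction j with
  | zero =>
    intro a b hb hab
    rcases hab.cases_tail with rfl | ⟨d, had, hd⟩
    · exact .inr ⟨0, le_rfl, hb⟩
    · obtain rfl := hd.unique P (h.first _ hb)
      rcases had.cases_tail with e | ⟨_, -, hd'⟩
      · exact .inl e.symm
      · exact absurd hd' (P.not_isParent_genesis)
  | succ j ih =>
    intro a b hb hab
    rcases hab.cases_tail with rfl | ⟨d, had, hd⟩
    · exact .inr ⟨j + 1, le_rfl, hb⟩
    · obtain ⟨d', hd', hp⟩ := h.exists_pred hb
      obtain rfl := hd.unique P hp
      exact (ih hd' had).imp_right fun ⟨k, hk, e⟩ => ⟨k, hk.trans (Nat.le_succ j), e⟩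

/-- Both chains are walked back from the common block. Genesis lies on neither of them, so they
reach their first blocks at the same time. -/
theorem eq_of_common (h' : P.IsChain c') {j : ℕ} : ∀ {k : ℕ} {b : Block D}, c j = some b →
    c' k = some b → j = k ∧ ∀ i ≤ j, c i = c' i := by
  induction j with
  | zero =>
    intro k b hb hb'
    cases k with
    | zero =>
      refine ⟨rfl, fun i hi => ?_⟩
      obtain rfl : i = 0 := by omega
      rw [hb, hb']
    | succ k =>
      obtain ⟨a, ha, hp⟩ := h'.exists_pred hb'
      exact absurd (hp.unique P (h.first _ hb)) (h'.ne_genesis ha)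
  | succ j ih =>
    intro k b hb hb'
    obtain ⟨a, ha, hp⟩ := h.exists_pred hb
    cases k with
    | zero => exact absurd (hp.unique P (h'.first _ hb')) (h.ne_genesis ha)
    | succ k =>
      obtain ⟨a', ha', hp'⟩ := h'.exists_pred hb'
      obtain rfl := hp.unique P hp'
      obtain ⟨rfl, hi⟩ := ih ha ha'
      refine ⟨rfl, fun i hij => ?_⟩
      rcases hij.eq_or_lt with rfl | hlt
      · rw [hb, hb']
      · exact hi i (by omega)

end IsChain

theorem payloadTxs_eq (hn : 3 * P.f + 1 ≤ n) (hn₂ : 2 ≤ n) {b : Block D} {C : List Bool}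
    (hr : ∃ C, P.Recovers M b C) (hC : P.tau C (n - P.f - 1) = b.recTag) :
    P.payloadTxs M b = (P.parse C).getD [] := by
  rw [payloadTxs, dif_pos hr, P.payload_unique hn hn₂ hr.choose_spec.2.2 hC]

theorem IsFinalChain.mono (hM : M ⊆ M') (h : P.IsFinalChain M c) : P.IsFinalChain M' c := by
  refine ⟨h.1, h.2.1, h.2.2.1, fun i b hb => ?_⟩
  obtain ⟨⟨j, b', hj, hb', hc⟩, C, hC⟩ := h.2.2.2 i b hb
  exact ⟨⟨j, b', hj, hb', hc.mono P hM⟩, C, hC.mono P hM⟩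

end Protocol

namespace Trace.IsExecution

open Protocol

variable {n : ℕ} {D Tx : Type*} {P : Protocol n D Tx} {E : Trace n D Tx}
variable {M M' : Set (Msg n D Tx)} {c c' : ℕ → Option (Block D)}
variable (hE : E.IsExecution P) (hn : 3 * P.f + 1 ≤ n)
include hE hn

/-! ### Consistency -/

/-- At or after position `i`, each chain has a block with a stage-2 certificate. By
`isAncestor_of_cert2`, the one with the smaller view is an ancestor of the other, hence on both
chains. -/
theorem chains_agree (hM : M ⊆ E.allMsgs) (hM' : M' ⊆ E.allMsgs) (h : P.IsFinalChain M c)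
    (h' : P.IsFinalChain M' c') {i : ℕ} (hi : c i ≠ none) (hi' : c' i ≠ none) : c i = c' i := by
  obtain ⟨b, hb⟩ := Option.ne_none_iff_exists'.1 hi
  obtain ⟨b', hb'⟩ := Option.ne_none_iff_exists'.1 hi'
  obtain ⟨⟨j, d, hij, hd, hdc⟩, -⟩ := h.2.2.2 i b hb
  obtain ⟨⟨j', d', hij', hd', hdc'⟩, -⟩ := h'.2.2.2 i b' hb'
  have e := hE.cert2_of_subset hM hdc
  have e' := hE.cert2_of_subset hM' hdc'
  rcases le_total d.view d'.view with hv | hv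
  · have := hE.isAncestor_of_cert2 hn e _ d' rfl (hE.sound_of_cert2 hn e').2.1 hv
    obtain ⟨k, -, hk⟩ := (h'.isChain.ancestor hd' this).resolve_left (h.isChain.ne_genesis hd)
    exact (h.isChain.eq_of_common h'.isChain hd hk).2 i hij
  · have := hE.isAncestor_of_cert2 hn e' _ d rfl (hE.sound_of_cert2 hn e).2.1 hv
    obtain ⟨k, -, hk⟩ := (h.isChain.ancestor hd this).resolve_left (h'.isChain.ne_genesis hd')
    exact ((h'.isChain.eq_of_common h.isChain hd' hk).2 i hij').symm

theorem existsUnique_longest (hM : M ⊆ E.allMsgs) : ∃! c, P.IsLongestFinalChain M c := by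
  classical
  -- The union of all final chains, which is a final chain because these agree wherever they are
  -- defined.
  let u : ℕ → Option (Block D) := fun i =>
    if h : ∃ b c, P.IsFinalChain M c ∧ c i = some b then some h.choose else none
  have hu : ∀ {c}, P.IsFinalChain M c → ∀ i, c i ≠ none → u i = c i := by
    intro c hc i hi
    obtain ⟨b, hb⟩ := Option.ne_none_iff_exists'.1 hi
    have h : ∃ b c, P.IsFinalChain M c ∧ c i = some b := ⟨b, c, hc, hb⟩
    obtain ⟨c', hc', hb'⟩ := h.choose_spec
    have := hE.chains_agree hn hM hM hc' hc (by simp [hb']) hi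
    rw [← this, hb']
    exact dif_pos h
  have hu' : ∀ i b, u i = some b → ∃ c, P.IsFinalChain M c ∧ c i = some b := by
    intro i b hb
    by_cases h : ∃ b c, P.IsFinalChain M c ∧ c i = some b
    · have e : u i = some h.choose := dif_pos h
      obtain rfl : h.choose = b := by simpa [e] using hb
      exact h.choose_spec
    · have e : u i = none := dif_neg h
      simp [e] at hb
  have hfin : P.IsFinalChain M u := by
    refine ⟨fun i hi => ?_, fun b hb => ?_, fun i b b' hb hb' => ?_, fun i b hb => ?_⟩
    · by_contra hc
      obtain ⟨b, hb⟩ := Option.ne_none_iff_exists'.1 hc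
      obtain ⟨c, hc, hci⟩ := hu' _ b hb
      obtain ⟨a, ha, -⟩ := hc.isChain.exists_pred hci
      rw [hu hc i (by simp [ha]), ha] at hi
      simp at hi
    · obtain ⟨c, hc, hci⟩ := hu' _ b hb
      exact hc.2.1 b hci
    · obtain ⟨c, hc, hci⟩ := hu' _ b' hb'
      obtain ⟨a, ha, hp⟩ := hc.isChain.exists_pred hci
      rw [hu hc i (by simp [ha]), ha] at hb
      obtain rfl : a = b := by simpa using hb
      exact hp
    · obtain ⟨c, hc, hci⟩ := hu' _ b hb
      obtain ⟨⟨j, d, hij, hd, hdc⟩, hr⟩ := hc.2.2.2 i b hci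
      exact ⟨⟨j, d, hij, (hu hc j (by simp [hd])).trans hd, hdc⟩, hr⟩
  refine ⟨u, ⟨hfin, fun c hc i hi => ?_⟩, fun c hc => ?_⟩
  · rwa [hu hc i hi]
  · funext i
    by_cases hi : c i = none
    · rw [hi]
      by_contra hui
      exact hc.2 u hfin i (Ne.symm hui) hi
    · exact (hu hc.1 i hi).symm

theorem extract_eq (hM : M ⊆ E.allMsgs) : ∃ c, P.IsLongestFinalChain M c ∧
    P.extract M = concat (fun i => ((c i).map (P.payloadTxs M)).getD []) := by
  have h := hE.existsUnique_longest hn hM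
  exact ⟨h.choose, h.choose_spec.1, by rw [Protocol.extract, dif_pos h]⟩

theorem consistency (hn₂ : 2 ≤ n) : P.Consistency E := by
  intro M₁ M₂ h₁₂ hM₂
  obtain ⟨c₁, h₁, e₁⟩ := hE.extract_eq hn (h₁₂.trans hM₂)
  obtain ⟨c₂, h₂, e₂⟩ := hE.extract_eq hn hM₂
  rw [e₁, e₂]
  have key : ∀ i, c₁ i ≠ none → ((c₁ i).map (P.payloadTxs M₁)).getD [] =
      ((c₂ i).map (P.payloadTxs M₂)).getD [] := by
    intro i hi
    -- A final chain for `M₁` is one for `M₂`, hence agrees with the longest chain `c₂`; verified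
    -- payloads do not depend on the message set.
    have h₁' := h₁.1.mono h₁₂
    rw [← hE.chains_agree hn hM₂ hM₂ h₁' h₂.1 hi (h₂.2 _ h₁' i hi)]
    obtain ⟨b, hb⟩ := Option.ne_none_iff_exists'.1 hi
    obtain ⟨-, C, hC⟩ := h₁.1.2.2.2 i b hb
    rw [hb, Option.map_some, Option.map_some, payloadTxs_eq hn hn₂ ⟨C, hC⟩ hC.2.2,
      payloadTxs_eq hn hn₂ ⟨C, hC.mono P h₁₂⟩ hC.2.2]
  refine isPrefix_concat fun N => ?_
  induction N with
  | zero => exact ⟨0, rfl⟩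
  | succ N ih =>
    by_cases hN : c₁ N = none
    -- Past the end of `c₁` nothing is appended, so the previous `N'` still works.
    · obtain ⟨N', e⟩ := ih
      refine ⟨N', ?_⟩
      rw [← e, List.range_succ, List.flatMap_append]
      simp [hN]
    · refine ⟨N + 1, List.flatMap_congr fun i hi => key i ?_⟩
      exact h₁.1.isChain.exists_of_le (Nat.lt_succ_iff.1 (List.mem_range.1 hi)) hN

/-! ### Liveness -/

omit hn in
theorem correctMsgs_mono {t t' : ℕ} (h : t ≤ t') : E.correctMsgs t ⊆ E.correctMsgs t' :=
  fun _ ⟨i, hi, hm⟩ => ⟨i, hi, (hE.st_le_st hi h).msgs hm⟩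

/-- By `exists_parent`, the parent of a sound block is genesis or sound, and has a smaller view. -/
theorem exists_chain : ∀ (v : ℕ) (b : Block D), b.view = v → E.Sound P b → ∃ c L, P.IsChain c ∧
    c L = some b ∧ (∀ i, L < i → c i = none) ∧ ∀ i d, c i = some d → E.Sound P d := by
  intro v
  induction v using Nat.strong_induction_on with
  | _ v ih =>
    rintro b rfl hb
    obtain ⟨a, hp, hv, rfl | ha, -⟩ := hE.exists_parent hn hb.2.1
    · refine ⟨fun i => if i = 0 then some b else none, 0, ⟨fun i => by simp, ?_, ?_⟩, rfl, ?_, ?_⟩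
      · rintro d hd
        obtain rfl : b = d := by simpa using hd
        exact hp
      · simp
      · intro i hi
        simp
        omega
      · intro i d hd
        by_cases hi : i = 0
        · obtain rfl : b = d := by simpa [hi] using hd
          exact hb
        · simp [hi] at hd
    · obtain ⟨c, L, hc, hL, hend, hs⟩ := ih a.view hv a rfl ha
      let c' : ℕ → Option (Block D) := fun i => if i = L + 1 then some b else c i
      have e₁ : c' (L + 1) = some b := if_pos rfl
      have e₂ : ∀ i, i ≠ L + 1 → c' i = c i := fun i hi => if_neg hi
      refine ⟨c', L + 1, ⟨fun i hi => ?_, fun d hd => ?_, fun i d d' hd hd' => ?_⟩, e₁,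
        fun i hi => ?_, fun i d hd => ?_⟩
      · have hi₁ : i ≠ L + 1 := by
          rintro rfl
          simp [e₁] at hi
        rw [e₂ i hi₁] at hi
        have hi₂ : i ≠ L := by
          rintro rfl
          simp [hL] at hi
        rw [e₂ _ (by omega)]
        exact hc.isSeq i hi
      · rw [e₂ 0 (by omega)] at hd
        exact hc.first d hd
      · by_cases hi : i = L
        · subst hi
          rw [e₂ _ (by omega), hL] at hd
          rw [e₁] at hd'
          obtain rfl : a = d := by simpa using hd
          obtain rfl : b = d' := by simpa using hd'
          exact hp
        · rw [e₂ (i + 1) (by omega)] at hd'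
          have : i ≠ L + 1 := by
            rintro rfl
            rw [hend _ (by omega)] at hd'
            simp at hd'
          rw [e₂ i this] at hd
          exact hc.parent i d d' hd hd'
      · rw [e₂ i (by omega)]
        exact hend i (by omega)
      · by_cases hi : i = L + 1
        · subst hi
          rw [e₁] at hd
          obtain rfl : b = d := by simpa using hd
          exact hb
        · rw [e₂ i hi] at hd
          exact hs i d hd

/-- Blocks with stage-2 certificates at correct processors, and their ancestors, are extracted. -/
theorem exists_extract (hn₂ : 2 ≤ n) {i : Fin n} (hi : i ∈ E.correct) {t : ℕ} {a b : Block D}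
    (hb : P.HasCert2 (E.st t i).msgs b) (hab : P.IsAncestor a b) (ha : a ≠ P.genesis)
    {C : List Bool} {l : List Tx} (hC : P.tau C (n - P.f - 1) = a.recTag) (hl : P.parse C = some l)
    {tr : Tx} (htr : tr ∈ l) : ∃ t' m, P.extract (E.correctMsgs t') m = some tr := by
  have hsb := hE.sound_of_cert2 hn (hE.cert2_of_subset (st_subset_allMsgs hi) hb)
  obtain ⟨c, L, hc, hL, hend, hs⟩ := hE.exists_chain hn _ b rfl hsb
  obtain ⟨k, -, hk⟩ := (hc.ancestor hL hab).resolve_left ha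
  -- The payloads may be recovered by different correct processors at different times; as the chain
  -- is finite, a common time exists.
  have hrec : ∀ i, ∃ t, ∀ d, c i = some d → ∃ C, P.Recovers (E.correctMsgs t) d C := by
    intro q
    rcases hq : c q with _ | d
    · exact ⟨0, by simp⟩
    · obtain ⟨-, -, j, hj, t, C, hC⟩ := hs q d hq
      refine ⟨t, fun d' hd' => ?_⟩
      obtain rfl : d = d' := by simpa using hd'
      exact ⟨C, hC.mono P fun m hm => ⟨j, hj, hm⟩⟩
  choose τ hτ using hrec
  set T := max t ((Finset.range (L + 1)).sup τ)
  have hfin : P.IsFinalChain (E.correctMsgs T) c := by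
    refine ⟨hc.1, hc.2, hc.3, fun q d hd => ?_⟩
    have hqL : q ≤ L := by
      by_contra! h
      simp [hend q h] at hd
    have hT : τ q ≤ T := (Finset.le_sup (f := τ)
      (Finset.mem_range.2 (Nat.lt_succ_iff.2 hqL))).trans (le_max_right _ _)
    obtain ⟨C, hC⟩ := hτ q d hd
    refine ⟨⟨L, b, hqL, hL, hb.mono P ?_⟩, C, hC.mono P (hE.correctMsgs_mono hT)⟩
    exact fun m hm => hE.correctMsgs_mono (le_max_left t _) ⟨i, hi, hm⟩
  have hM : E.correctMsgs T ⊆ E.allMsgs := fun m hm => .inr ⟨T, hm⟩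
  obtain ⟨c', hc', e⟩ := hE.extract_eq hn hM
  have hk' : c' k = some a := by
    have hne : c k ≠ none := by simp [hk]
    rw [← hk, hE.chains_agree hn hM hM hfin hc'.1 hne (hc'.2 c hfin k hne)]
  refine ⟨T, ?_⟩
  rw [e]
  refine exists_concat_eq_some (k := k) ?_
  rw [hk', Option.map_some, Option.getD_some,
    payloadTxs_eq hn hn₂ (hfin.2.2.2 k a hk).2 hC, hl]
  exact htr

theorem liveness (hn₂ : 2 ≤ n) (hx : 0 < P.x) : P.Liveness E := by
  classical
  intro i hi t tr htr
  set T := max t E.GST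
  let N := Finset.univ.sup fun j => (E.st T j).view
  -- A superview led by `i`, since `w ≡ i` modulo `n`. Its initial view `v` exceeds all views that
  -- correct processors have reached by `T`, so it is entered after GST and after the receipt of
  -- `tr`.
  set w := (i : ℕ) + n * (N + 1) with hw
  have hwN : N + 1 ≤ w := by nlinarith
  set v := (w - 1) * P.x + 1 with hv
  have hvw : w ≤ v := by
    have := Nat.le_mul_of_pos_right (w - 1) hx
    omega
  have hI : P.IsInitial v := by simp [Protocol.IsInitial, hv]
  have hsup : P.superview v = w := by
    simp only [Protocol.superview, hv, Nat.add_sub_cancel, Nat.mul_div_cancel _ hx]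
    omega
  have hl : P.IsLeader i v := by
    rw [Protocol.IsLeader, hsup, hw, Nat.add_mul_mod_self_left, Nat.mod_eq_of_lt i.2]
  have hlate : ∀ j ∈ E.correct, ∀ t', v ≤ (E.st t' j).view → T < t' := by
    intro j hj t' h
    by_contra! hc
    have h₁ := (hE.st_le_st hj hc).view
    have h₂ : (E.st T j).view ≤ N :=
      Finset.le_sup (f := fun j => (E.st T j).view) (Finset.mem_univ j)
    omega
  obtain ⟨⟨b, hwf, hbv, t₁, hcert⟩, -⟩ := hE.leadersFinalise hn hn₂ hx v (by omega) hI i hi hl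
    fun j hj t' h => (le_max_right _ _).trans (hlate j hj t' h.2).le
  have hcert := hcert i hi
  obtain ⟨m, hm, hmb⟩ := hcert.mention hn
  have hat := hE.at_st hi t₁
  obtain ⟨C, hC⟩ := hE.mention hi hn hx hat m hm b hmb hwf.1 i hi (hbv.symm ▸ hl)
  obtain ⟨-, -, -, t₀, σ₀, a, l, ht₀, -, hσ₀, -, hpay, e, hinit⟩ :=
    hE.proposed_spec hi hx hat _ hC
  have hv₀ := (hinit (hbv.symm ▸ hI)).1
  simp only [Prod.mk.injEq] at e hv₀
  obtain ⟨e, rfl⟩ := e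
  have hlt := hlate i hi t₀ (by rw [← hbv, hv₀]; exact hσ₀.le_st.view)
  have hmem : Msg.tx tr ∈ σ₀.msgs :=
    hσ₀.inb_le.msgs ((hE.st_le_inb hi ((le_max_left _ _).trans_lt hlt)).msgs htr)
  -- A transaction left out of the payload is in an ancestor of `b` whose payload the leader knows,
  -- and this ancestor is extracted along with `b`.
  by_cases hkn : P.KnownIncluded σ₀ a tr
  · obtain ⟨b₀, C, l', hanc, hrp, hl', htr'⟩ := hkn
    have hab : P.IsParent a b := by rw [e]; rfl
    refine hE.exists_extract hn hn₂ hi hcert (hanc.tail hab) ?_ (C := C) ?_ hl' htr'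
    · rintro rfl
      rcases hrp with h | h
      · exact P.not_recovers_genesis hn₂ h
      · have := (hE.proposed_spec hi hx hσ₀ _ h).1
        simp [Protocol.genesis] at this
    · rcases hrp with h | h
      · exact h.2.2
      · obtain ⟨-, -, -, _, _, a', l'', -, -, -, -, -, e', -⟩ := hE.proposed_spec hi hx hσ₀ _ h
        simp only [Prod.mk.injEq] at e'
        rw [e'.1, e'.2]
        rfl
  · refine hE.exists_extract hn hn₂ hi hcert .refl (hwf.ne_genesis P) (C := P.ser l) ?_
      (P.parse_ser l) ((hpay.2 tr).2 ⟨hmem, hkn⟩)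
    rw [e]
    rfl

end Trace.IsExecution

end Carnot

theorem mainTheorem6 {n : ℕ} {D Tx : Type*} (P : Carnot.Protocol n D Tx) (hn : 3 * P.f + 1 ≤ n)
    (hn₂ : 2 ≤ n) (hx : 2 ≤ P.x) (E : Carnot.Trace n D Tx) (hE : E.IsExecution P) :
    P.Consistency E ∧ P.Liveness E ∧
      P.BlocksAgreement E ∧ E.ViewProgression ∧ P.LeadersFinalise E :=
  ⟨hE.consistency hn hn₂, hE.liveness hn hn₂ (by omega), hE.blocksAgreement hn hn₂,
    hE.viewProgression hn hn₂, hE.leadersFinalise hn hn₂ (by omega)⟩
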